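/- For $r\in\mathbb{R}$ let $X_r=L_1((0,\infty),x^r\,\mathrm{d}x)$ (complex-valued functions), and for a non-empty interval $I\subset\mathbb{R}$ let $\mathsf{X}_I=\bigcap_{r\in I}X_r$. Let $\kappa<1$ and $\kappa-2<m\le 1$, and let $\mathcal{G}_\kappa f=f''+\frac{\kappa}{x}f'$ in the sense of distributions on $(0,\infty)$. Define the operator $A_{1,m}f:=\mathcal{G}_\kappa f$ in $X_m$ for $f\in\mathrm{dom}(A_{1,m})$, where - (c1) if $\kappa-2<m\le\kappa$, then $\mathrm{dom}(A_{1,m})=\{f\in\mathsf{X}_{(\kappa-2,m]} : \mathcal{G}_\kappa f\in X_m\}$; - (c2) if $\kappa<m<1$, then $\mathrm{dom}(A_{1,m})=\{f\in\mathsf{X}_{[m-2,m]} : \mathcal{G}_\kappa f\in X_m\}$; - (c3) if $m=1$, then $\mathrm{dom}(A_{1,1})=\{f\in\mathsf{X}_{(-1,1]} : \mathcal{G}_\kappa f\in X_1 \text{ and } \lim_{x\to 0}f(x)=0\}$, where the limit is that of the continuous representative of $f$. Then $A_{1,m}$ is the infinitesimal generator of a bounded analytic semigroup $S_{1,m}$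 of angle $\pi/2$ on $X_m$. That is, there is a map $S_{1,m}$ from $\{0\}\cup\{z\in\mathbb{C}: z\ne 0,\ |\arg z|<\pi/2\}$ to the bounded linear operators on $X_m$ with the following properties: $S_{1,m}(0)=\mathrm{id}$ and $S_{1,m}(z+w)=S_{1,m}(z)S_{1,m}(w)$; it is analytic on $\{z\neq 0,\ |\arg z|<\pi/2\}$; for each $\theta\in(0,\pi/2)$ it is uniformly bounded on $\{z\neq 0,\ |\arg z|<\theta\}$ and satisfies $S_{1,m}(z)f\to f$ as $z\to0$ in this sector, for all $f\in X_m$; and, for $f,g\in X_m$, one has $\lim_{t\to0+}t^{-1}(S_{1,m}(t)f-f)=g$ in $X_m$ if and only if $f\in\mathrm{dom}(A_{1,m})$ and $A_{1,m}f=g$. Moreover, $S_{1,m}$ is positive: $S_{1,m}(t)f\ge 0$ a.e. for all $t\ge0$ and all $f\in X_m$ with $f\ge 0$ a.e. If in addition $m\in(\kappa,1]$, then $S_{1,m}$ is a semigroup of contractions: $\|S_{1,m}(t)\|_{\mathcal{L}(X_m)}\le 1$ for all $t\ge 0$. -/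

import Mathlib

open MeasureTheory Set Filter Topology
open scoped ContDiff ComplexOrder

noncomputable section

namespace BesselHalfLine

/-! ### Weighted spaces on the half-line -/

/-- The measure `x ^ r dx` on `(0, ∞)`, viewed as a measure on `ℝ` that does not charge `(-∞, 0]`. -/
def weight (r : ℝ) : Measure ℝ :=
  (volume.restrict (Ioi 0)).withDensity (fun x => ENNReal.ofReal (x ^ r))

/-- `X r = L₁((0, ∞), x ^ r dx)`, with complex scalars. -/
abbrev X (r : ℝ) : Type := Lp ℂ 1 (weight r)

/-- Membership of (the class of) `f` in the intersection of all `X r`, `r ∈ I`.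
The measures `weight r` all have the same null sets, so this does not depend on the chosen
representative. -/
def MemInter (I : Set ℝ) (f : ℝ → ℂ) : Prop :=
  ∀ r ∈ I, MemLp f 1 (weight r)

/-! ### The Bessel operator in the sense of distributions -/

/-- The formal adjoint `φ'' - (κ φ / x)'` of `f ↦ f'' + (κ / x) f'`, with the derivative of the
quotient carried out. -/
def besselAdjoint (κ : ℝ) (φ : ℝ → ℝ) (x : ℝ) : ℝ :=
  deriv (deriv φ) x - (κ / x) * deriv φ x + (κ / x ^ 2) * φ x

/-- `f'' + (κ / x) f' = g` in the sense of distributions on `(0, ∞)`. -/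
def IsBessel (κ : ℝ) (f g : ℝ → ℂ) : Prop :=
  ∀ φ : ℝ → ℝ, ContDiff ℝ ∞ φ → HasCompactSupport φ → tsupport φ ⊆ Ioi 0 →
    ∫ x in Ioi (0 : ℝ), besselAdjoint κ φ x • f x = ∫ x in Ioi (0 : ℝ), φ x • g x

/-- The Dirichlet condition `f(0+) = 0` for (the continuous representative of) `f`. -/
def DirichletAtZero (f : ℝ → ℂ) : Prop :=
  ∃ h : ℝ → ℂ, ContinuousOn h (Ioi 0) ∧ f =ᵐ[volume.restrict (Ioi 0)] h ∧
    Tendsto h (𝓝[>] 0) (𝓝 0)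

/-- The side conditions in the domain of the operator in the three ranges of `m`. (Only `m ≤ 1` is
of interest, so that the last case is `m = 1`.) -/
def SideCondition (κ m : ℝ) (f : ℝ → ℂ) : Prop :=
  if m ≤ κ then MemInter (Ioc (κ - 2) m) f
  else if m < 1 then MemInter (Icc (m - 2) m) f
  else MemInter (Ioc (-1) 1) f ∧ DirichletAtZero f

/-! ### Auxiliary facts: linearity, and uniqueness of the distributional value -/

theorem restrict_ac_weight (r : ℝ) : volume.restrict (Ioi (0 : ℝ)) ≪ weight r := by
  refine withDensity_absolutelyContinuous' (by fun_prop) ?_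
  filter_upwards [ae_restrict_mem measurableSet_Ioi] with x hx
  simpa using Real.rpow_pos_of_pos hx r

theorem weight_ac (r s : ℝ) : weight r ≪ weight s :=
  (withDensity_absolutelyContinuous _ _).trans (restrict_ac_weight s)

theorem locallyIntegrableOn_X {m : ℝ} (f : X m) :
    LocallyIntegrableOn (f : ℝ → ℂ) (Ioi 0) := by
  have h1 : Integrable (f : ℝ → ℂ) (weight m) := memLp_one_iff_integrable.1 (Lp.memLp f)
  have h2 : Integrable (fun x : ℝ => (x ^ m) • (f : ℝ → ℂ) x) (volume.restrict (Ioi 0)) := by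
    have := (integrable_withDensity_iff_integrable_smul' (by fun_prop)
      (by simp)).1 h1
    refine this.congr ?_
    filter_upwards [ae_restrict_mem measurableSet_Ioi] with x hx
    rw [ENNReal.toReal_ofReal (Real.rpow_nonneg (le_of_lt hx) m)]
  have h3 : LocallyIntegrableOn (fun x : ℝ => (x ^ (-m)) • ((x ^ m) • (f : ℝ → ℂ) x)) (Ioi 0) :=
    (IntegrableOn.locallyIntegrableOn h2).continuousOn_smul isOpen_Ioi.isLocallyClosed
      (fun x hx => (Real.continuousAt_rpow_const x (-m) (Or.inl (ne_of_gt hx))).continuousWithinAt)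
  rw [locallyIntegrableOn_iff isOpen_Ioi.isLocallyClosed] at h3 ⊢
  intro K hK hKc
  refine (h3 K hK hKc).congr ?_
  filter_upwards [ae_restrict_mem hKc.measurableSet] with x hx
  have hx0 : (0 : ℝ) < x := hK hx
  rw [smul_smul, ← Real.rpow_add hx0, neg_add_cancel, Real.rpow_zero, one_smul]

theorem integrable_test {f : ℝ → ℂ} (hf : LocallyIntegrableOn f (Ioi 0)) {φ ψ : ℝ → ℝ}
    (hφc : HasCompactSupport φ) (hφs : tsupport φ ⊆ Ioi 0)
    (hψ : ContinuousOn ψ (Ioi 0)) (h0 : ∀ x, x ∉ tsupport φ → ψ x = 0) :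
    Integrable (fun x => ψ x • f x) (volume.restrict (Ioi 0)) := by
  have h1 : LocallyIntegrableOn (fun x => ψ x • f x) (Ioi 0) :=
    hf.continuousOn_smul isOpen_Ioi.isLocallyClosed hψ
  have h2 : IntegrableOn (fun x => ψ x • f x) (tsupport φ) :=
    h1.integrableOn_compact_subset hφs hφc
  refine ((integrableOn_iff_integrable_of_support_subset ?_).1 h2).restrict
  intro x hx
  by_contra hn
  exact hx (by simp [h0 x hn])

theorem integrable_test_left {f : ℝ → ℂ} (hf : LocallyIntegrableOn f (Ioi 0)) (κ : ℝ)
    {φ : ℝ → ℝ} (hφ : ContDiff ℝ ∞ φ) (hφc : HasCompactSupport φ) (hφs : tsupport φ ⊆ Ioi 0) :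
    Integrable (fun x => besselAdjoint κ φ x • f x) (volume.restrict (Ioi 0)) := by
  have hd : ContDiff ℝ ∞ (deriv φ) := (contDiff_infty_iff_deriv.1 hφ).2
  have hdd : Continuous (deriv (deriv φ)) := (contDiff_infty_iff_deriv.1 hd).2.continuous
  refine integrable_test hf hφc hφs ?_ ?_
  · have hx : ∀ x ∈ Ioi (0 : ℝ), x ≠ 0 := fun x hx => ne_of_gt hx
    have hx2 : ∀ x ∈ Ioi (0 : ℝ), x ^ 2 ≠ 0 := fun x h => pow_ne_zero 2 (hx x h)
    unfold besselAdjoint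
    exact (hdd.continuousOn.sub ((continuousOn_const.div continuousOn_id hx).mul
      hd.continuous.continuousOn)).add
      ((continuousOn_const.div (continuousOn_id.pow 2) hx2).mul hφ.continuous.continuousOn)
  · intro x hx
    have h1 : φ =ᶠ[𝓝 x] 0 := notMem_tsupport_iff_eventuallyEq.1 hx
    have h2 : deriv φ =ᶠ[𝓝 x] 0 := by simpa using h1.deriv
    have h3 : deriv (deriv φ) =ᶠ[𝓝 x] 0 := by simpa using h2.deriv
    simp [besselAdjoint, h1.eq_of_nhds, h2.eq_of_nhds, h3.eq_of_nhds]

theorem integrable_test_right {f : ℝ → ℂ} (hf : LocallyIntegrableOn f (Ioi 0))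
    {φ : ℝ → ℝ} (hφ : ContDiff ℝ ∞ φ) (hφc : HasCompactSupport φ) (hφs : tsupport φ ⊆ Ioi 0) :
    Integrable (fun x => φ x • f x) (volume.restrict (Ioi 0)) :=
  integrable_test hf hφc hφs hφ.continuous.continuousOn
    (fun _ hx => image_eq_zero_of_notMem_tsupport hx)

theorem IsBessel.congr {κ : ℝ} {f f' g g' : ℝ → ℂ} (h : IsBessel κ f g)
    (hf : f =ᵐ[volume.restrict (Ioi 0)] f') (hg : g =ᵐ[volume.restrict (Ioi 0)] g') :
    IsBessel κ f' g' := by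
  intro φ h1 h2 h3
  rw [← integral_congr_ae (hf.mono fun x hx => congrArg (besselAdjoint κ φ x • ·) hx),
    ← integral_congr_ae (hg.mono fun x hx => congrArg (φ x • ·) hx)]
  exact h φ h1 h2 h3

theorem isBessel_zero {κ m : ℝ} : IsBessel κ (0 : X m) (0 : X m) := by
  have h : ((0 : X m) : ℝ → ℂ) =ᵐ[volume.restrict (Ioi 0)] 0 :=
    (restrict_ac_weight m).ae_eq (Lp.coeFn_zero ℂ 1 (weight m))
  exact IsBessel.congr (f := 0) (g := 0) (fun φ _ _ _ => by simp) h.symm h.symm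

theorem IsBessel.add {κ m : ℝ} {f f' g g' : X m} (h : IsBessel κ f g) (h' : IsBessel κ f' g') :
    IsBessel κ (f + f' : X m) (g + g' : X m) := by
  have e : ∀ u v : X m, ((u : ℝ → ℂ) + (v : ℝ → ℂ)) =ᵐ[volume.restrict (Ioi 0)] ((u + v : X m) : ℝ → ℂ) :=
    fun u v => ((restrict_ac_weight m).ae_eq (Lp.coeFn_add u v)).symm
  refine IsBessel.congr (fun φ h1 h2 h3 => ?_) (e f f') (e g g')
  simp only [Pi.add_apply, smul_add]
  rw [integral_add (integrable_test_left (locallyIntegrableOn_X f) κ h1 h2 h3)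
      (integrable_test_left (locallyIntegrableOn_X f') κ h1 h2 h3),
    integral_add (integrable_test_right (locallyIntegrableOn_X g) h1 h2 h3)
      (integrable_test_right (locallyIntegrableOn_X g') h1 h2 h3),
    h φ h1 h2 h3, h' φ h1 h2 h3]

theorem IsBessel.smul {κ m : ℝ} {f g : X m} (c : ℂ) (h : IsBessel κ f g) :
    IsBessel κ (c • f : X m) (c • g : X m) := by
  have e : ∀ u : X m, (c • (u : ℝ → ℂ)) =ᵐ[volume.restrict (Ioi 0)] ((c • u : X m) : ℝ → ℂ) :=
    fun u => ((restrict_ac_weight m).ae_eq (Lp.coeFn_smul c u)).symm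
  refine IsBessel.congr (fun φ h1 h2 h3 => ?_) (e f) (e g)
  simp only [Pi.smul_apply, smul_comm _ c]
  rw [integral_smul, integral_smul, h φ h1 h2 h3]

theorem IsBessel.unique {κ m : ℝ} {f g g' : X m} (h : IsBessel κ f g) (h' : IsBessel κ f g') :
    g = g' := by
  have hl := (locallyIntegrableOn_X g).sub (locallyIntegrableOn_X g')
  have h0 := isOpen_Ioi.ae_eq_zero_of_integral_contDiff_smul_eq_zero hl (by
    intro φ h1 h2 h3
    have hs : ∀ x, x ∉ Ioi (0 : ℝ) → φ x • ((g : ℝ → ℂ) - g') x = 0 := fun x hx => by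
      simp [image_eq_zero_of_notMem_tsupport (fun hn => hx (h3 hn))]
    rw [← setIntegral_eq_integral_of_forall_compl_eq_zero hs]
    simp only [Pi.sub_apply, smul_sub]
    rw [integral_sub (integrable_test_right (locallyIntegrableOn_X g) h1 h2 h3)
      (integrable_test_right (locallyIntegrableOn_X g') h1 h2 h3),
      ← h φ h1 h2 h3, ← h' φ h1 h2 h3, sub_self])
  refine Lp.ext ?_
  refine (withDensity_absolutelyContinuous _ _).ae_eq ?_
  refine (ae_restrict_iff' measurableSet_Ioi).2 ?_
  filter_upwards [h0] with x hx hx0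
  exact sub_eq_zero.1 (hx hx0)

theorem memInter_zero {m : ℝ} (I : Set ℝ) : MemInter I (0 : X m) := fun r _ =>
  (memLp_congr_ae ((weight_ac r m).ae_eq (Lp.coeFn_zero ℂ 1 (weight m)))).2 MemLp.zero

theorem MemInter.add {m : ℝ} {I : Set ℝ} {f g : X m} (hf : MemInter I f) (hg : MemInter I g) :
    MemInter I (f + g : X m) := fun r hr =>
  (memLp_congr_ae ((weight_ac r m).ae_eq (Lp.coeFn_add f g))).2 ((hf r hr).add (hg r hr))

theorem MemInter.smul {m : ℝ} {I : Set ℝ} {f : X m} (c : ℂ) (hf : MemInter I f) :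
    MemInter I (c • f : X m) := fun r hr =>
  (memLp_congr_ae ((weight_ac r m).ae_eq (Lp.coeFn_smul c f))).2 ((hf r hr).const_smul c)

theorem dirichletAtZero_zero {m : ℝ} : DirichletAtZero (0 : X m) :=
  ⟨0, continuousOn_const, (restrict_ac_weight m).ae_eq (Lp.coeFn_zero ℂ 1 (weight m)),
    tendsto_const_nhds⟩

theorem DirichletAtZero.add {m : ℝ} {f g : X m} (hf : DirichletAtZero f)
    (hg : DirichletAtZero g) : DirichletAtZero (f + g : X m) := by
  obtain ⟨u, hu, hfu, hu0⟩ := hf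
  obtain ⟨v, hv, hgv, hv0⟩ := hg
  exact ⟨u + v, hu.add hv,
    ((restrict_ac_weight m).ae_eq (Lp.coeFn_add f g)).trans (hfu.add hgv),
    (add_zero (0 : ℂ)) ▸ hu0.add hv0⟩

theorem DirichletAtZero.smul {m : ℝ} {f : X m} (c : ℂ) (hf : DirichletAtZero f) :
    DirichletAtZero (c • f : X m) := by
  obtain ⟨u, hu, hfu, hu0⟩ := hf
  exact ⟨c • u, hu.const_smul c,
    ((restrict_ac_weight m).ae_eq (Lp.coeFn_smul c f)).trans (hfu.const_smul c),
    (smul_zero c : c • (0 : ℂ) = 0) ▸ hu0.const_smul c⟩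

/-! ### The operator -/

/-- The domain of the Bessel operator in `X m`: all `f` in `X m` that satisfy the side conditions
and for which the distribution `f'' + (κ / x) f'` belongs to `X m`. -/
def besselDomain (κ m : ℝ) : Submodule ℂ (X m) where
  carrier := {f | SideCondition κ m f ∧ ∃ g : X m, IsBessel κ f g}
  zero_mem' := by
    refine ⟨?_, 0, isBessel_zero⟩
    unfold SideCondition
    split_ifs
    · exact memInter_zero _
    · exact memInter_zero _
    · exact ⟨memInter_zero _, dirichletAtZero_zero⟩
  add_mem' := by
    rintro f f' ⟨hf, g, hg⟩ ⟨hf', g', hg'⟩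
    refine ⟨?_, g + g', hg.add hg'⟩
    unfold SideCondition at *
    split_ifs at *
    · exact hf.add hf'
    · exact hf.add hf'
    · exact ⟨hf.1.add hf'.1, hf.2.add hf'.2⟩
  smul_mem' := by
    rintro c f ⟨hf, g, hg⟩
    refine ⟨?_, c • g, hg.smul c⟩
    unfold SideCondition at *
    split_ifs at *
    · exact hf.smul c
    · exact hf.smul c
    · exact ⟨hf.1.smul c, hf.2.smul c⟩

/-- The operator `f ↦ f'' + (κ / x) f'` in `X m` with domain `besselDomain κ m`: its value at `f` is
the unique element of `X m` that represents the distribution `f'' + (κ / x) f'`. -/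
def besselOp (κ m : ℝ) : X m →ₗ.[ℂ] X m where
  domain := besselDomain κ m
  toFun :=
    { toFun := fun f => f.2.2.choose
      map_add' := fun f g => IsBessel.unique (f + g).2.2.choose_spec
        (f.2.2.choose_spec.add g.2.2.choose_spec)
      map_smul' := fun c f => IsBessel.unique (c • f).2.2.choose_spec
        (f.2.2.choose_spec.smul c) }

theorem besselOp_spec {κ m : ℝ} (f : (besselOp κ m).domain) :
    IsBessel κ (f : X m) (besselOp κ m f) :=
  f.2.2.choose_spec

end BesselHalfLine

/-! ### Analytic semigroups -/

section Semigroup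

variable {E : Type*} [NormedAddCommGroup E] [NormedSpace ℂ E]

/-- The open sector `{z ≠ 0 : |arg z| < θ}`. -/
def openSector (θ : ℝ) : Set ℂ := {z | z ≠ 0 ∧ |z.arg| < θ}

/-- `T` is an analytic semigroup of angle `θ` on `E`, where `0 < θ ≤ π / 2`. Only the values of
`T` at `0` and on the open sector of angle `θ` matter. -/
structure IsAnalyticSemigroup (θ : ℝ) (T : ℂ → E →L[ℂ] E) : Prop where
  angle_pos : 0 < θ
  angle_le : θ ≤ Real.pi / 2
  map_zero : T 0 = ContinuousLinearMap.id ℂ E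
  map_add : ∀ z ∈ openSector θ, ∀ w ∈ openSector θ, T (z + w) = (T z).comp (T w)
  analytic : DifferentiableOn ℂ T (openSector θ)
  tendsto_zero : ∀ θ' ∈ Ioo 0 θ, ∀ x : E, Tendsto (fun z => T z x) (𝓝[openSector θ'] 0) (𝓝 x)

/-- A bounded analytic semigroup of angle `θ`: it is uniformly bounded on each strictly smaller
sector. -/
structure IsBoundedAnalyticSemigroup (θ : ℝ) (T : ℂ → E →L[ℂ] E) : Prop
    extends IsAnalyticSemigroup θ T where
  bounded : ∀ θ' ∈ Ioo 0 θ, ∃ C : ℝ, ∀ z ∈ openSector θ', ‖T z‖ ≤ C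

/-- `A` is the infinitesimal generator of `T`: a vector `x` lies in the domain of `A` and `A x = y`
if and only if `(T t x - x) / t → y` as `t → 0+`. -/
def IsGenerator (A : E →ₗ.[ℂ] E) (T : ℂ → E →L[ℂ] E) : Prop :=
  ∀ x y : E, (x, y) ∈ A.graph ↔
    Tendsto (fun t : ℝ => (t : ℂ)⁻¹ • (T (t : ℂ) x - x)) (𝓝[>] 0) (𝓝 y)

/-- `T t` has norm at most one for all real `t ≥ 0`. -/
def IsContractionSemigroup (T : ℂ → E →L[ℂ] E) : Prop :=
  ∀ t : ℝ, 0 ≤ t → ‖T (t : ℂ)‖ ≤ 1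

end Semigroup

/-- For real `t ≥ 0`, `T t` maps (a.e.) nonnegative functions to nonnegative functions; `0 ≤ z` for
a complex number `z` means that `z` is real and nonnegative. -/
def IsPositiveSemigroup {μ : Measure ℝ} (T : ℂ → Lp ℂ 1 μ →L[ℂ] Lp ℂ 1 μ) : Prop :=
  ∀ t : ℝ, 0 ≤ t → ∀ f : Lp ℂ 1 μ, (∀ᵐ x ∂μ, 0 ≤ (f : ℝ → ℂ) x) →
    ∀ᵐ x ∂μ, 0 ≤ (T (t : ℂ) f : ℝ → ℂ) x

end

/-! Put α = 1 - κ > 0. If f = x^α u, then f'' + (κ/x) f' = x^α (u'' + ((α+1)/x) u'), so the operator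
is conjugate to the radial Laplacian in the possibly fractional dimension d = α + 2. The semigroup
is therefore the radial heat semigroup conjugated by x^α. Its kernel is x^α y times the average of a
planar Gaussian of |x - y e^{iφ}|² against |sin φ|^α dφ, which replaces Bessel functions by
elementary Gaussian integrals.

The main tool is the Gaussian transform f ↦ ∫ x e^{-a x²} f(x) dx, a > 0. It is injective on X_m for
m ≤ 1 (`X_ext_gaussTransform`), being a Laplace transform in x². Heat flow maps Gaussians to
Gaussians, so the transform turns the semigroup into the explicit transport F(a) ↦ (1+4at)^{-d/2}
F(a/(1+4at)) (`gaussTransform_heatOp`). The semigroup law, the integrated equation and the resolvent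
identity become identities between scalar functions of a and t.

Boundedness on X_m amounts to ∫ x^m K_t(x,y) dx ≤ M y^m (`exists_moment_bound`). It follows by
writing a power as a Gamma integral of Gaussians and pushing these through the flow. The resulting
factor (1-4tμ)^{(α-b)/2}, with b = 1 - m, is at most 1 when m ≥ κ, which gives contractions, and is
integrable exactly when m > κ - 2. At complex time z the Gaussian is dominated by the one at the
real time |z|²/Re z, so the same bounds give sectorial boundedness and, through pointwise Taylor
estimates, analyticity in operator norm.

The generator is identified through `GaussODE`, the infinitesimal form of the transport. A pair (f,
g) belongs to the generator iff it satisfies `GaussODE` (`tendsto_quotient_of_gaussODE`,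
`gaussODE_of_tendsto_quotient`). This in turn is equivalent to the distributional equation with the
side condition (`mem_graph_besselOp_iff_gaussODE`). In one direction x e^{-a x²}, cut off near 0 and
∞, is used as a test function (`gaussODE_of_isBessel`); the only obstruction is n ∫_{1/n}^{2/n} |f|,
and every side condition forces it to vanish in the limit. It excludes a constant term at 0, the
constants being the unwanted solutions next to x^α. In the other direction `GaussODE` gives f = R(f
- g), with R the explicit resolvent at 1 (`GaussODE.ae_eq_kerFun`). The kernel bounds of R yield the
side condition, and its symmetry yields the distributional equation. -/

open scoped ENNReal

noncomputable section

namespace BesselHalfLine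

/-! ### The angular measure and Gaussian integrals -/

/-- The measure `|sin φ| ^ α dφ` on `(-π, π)`. -/
def angMeasure (α : ℝ) : Measure ℝ :=
  (volume.restrict (Ioo (-Real.pi) Real.pi)).withDensity
    (fun φ => ENNReal.ofReal (|Real.sin φ| ^ α))

/-- The squared distance between the points with polar coordinates `(x, 0)` and `(y, φ)`. -/
def distSq (x y φ : ℝ) : ℝ := x ^ 2 + y ^ 2 - 2 * x * y * Real.cos φ

theorem distSq_comm (x y φ : ℝ) : distSq x y φ = distSq y x φ := by
  unfold distSq; ring

theorem distSq_eq (x y φ : ℝ) :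
    distSq x y φ = (x - y * Real.cos φ) ^ 2 + (y * Real.sin φ) ^ 2 := by
  unfold distSq; nlinarith [Real.sin_sq_add_cos_sq φ]

theorem sq_mul_sin_le_distSq (x y φ : ℝ) : (y * Real.sin φ) ^ 2 ≤ distSq x y φ := by
  rw [distSq_eq]; nlinarith [sq_nonneg (x - y * Real.cos φ)]

theorem distSq_nonneg (x y φ : ℝ) : 0 ≤ distSq x y φ :=
  (sq_nonneg _).trans (sq_mul_sin_le_distSq x y φ)

theorem measurable_sin_rpow (α : ℝ) :
    Measurable (fun φ => ENNReal.ofReal (|Real.sin φ| ^ α)) := by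
  fun_prop

theorem lintegral_angMeasure (α : ℝ) {F : ℝ → ℝ≥0∞} (hF : Measurable F) :
    ∫⁻ φ, F φ ∂angMeasure α =
      ∫⁻ φ in Ioo (-Real.pi) Real.pi, ENNReal.ofReal (|Real.sin φ| ^ α) * F φ := by
  rw [angMeasure, lintegral_withDensity_eq_lintegral_mul _ (measurable_sin_rpow α) hF]
  rfl

theorem isFiniteMeasure_angMeasure {α : ℝ} (hα : 0 < α) : IsFiniteMeasure (angMeasure α) := by
  refine isFiniteMeasure_withDensity (ne_top_of_le_ne_top (b := ∫⁻ _ in Ioo (-Real.pi) Real.pi, 1)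
    (by simp) (lintegral_mono fun φ => ?_))
  rw [← ENNReal.ofReal_one]
  exact ENNReal.ofReal_le_ofReal
    (Real.rpow_le_one (abs_nonneg _) (Real.abs_sin_le_one φ) hα.le)

instance (α : ℝ) : SFinite (angMeasure α) := by unfold angMeasure; infer_instance

/-- The exponent `α / 2 + 1`, half of the effective dimension. -/
def halfDim (α : ℝ) : ℝ := α / 2 + 1

/-- The normalising constant of the heat kernel. -/
def heatConst (α : ℝ) : ℝ := Real.sqrt Real.pi * Real.Gamma ((α + 1) / 2)

theorem heatConst_pos {α : ℝ} (hα : 0 < α) : 0 < heatConst α :=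
  mul_pos (Real.sqrt_pos.2 Real.pi_pos) (Real.Gamma_pos_of_pos (by linarith))

theorem lintegral_abs_rpow_mul_gaussian {α c : ℝ} (hα : 0 < α) (hc : 0 < c) :
    ∫⁻ v : ℝ, ENNReal.ofReal (|v| ^ α * Real.exp (-c * v ^ 2)) =
      ENNReal.ofReal (c ^ (-(α + 1) / 2) * Real.Gamma ((α + 1) / 2)) := by
  have h1 : ∫ v : ℝ, |v| ^ α * Real.exp (-c * v ^ 2) =
      c ^ (-(α + 1) / 2) * Real.Gamma ((α + 1) / 2) := by
    have h := integral_comp_abs (f := fun v => v ^ α * Real.exp (-c * v ^ (2 : ℝ)))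
    rw [integral_rpow_mul_exp_neg_mul_rpow two_pos (by linarith) hc] at h
    simp only [Real.rpow_two, sq_abs] at h
    rw [h]; ring
  have h2 : 0 < c ^ (-(α + 1) / 2) * Real.Gamma ((α + 1) / 2) :=
    mul_pos (Real.rpow_pos_of_pos hc _) (Real.Gamma_pos_of_pos (by linarith))
  rw [← h1, ofReal_integral_eq_lintegral_ofReal]
  -- A non-integrable function has Bochner integral 0, whereas the value computed in `h1` is
  -- positive; so integrability comes for free.
  · by_contra hn
    rw [integral_undef hn] at h1
    exact h2.ne h1
  · exact Eventually.of_forall fun v => by positivity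

theorem lintegral_shifted_gaussian {a b : ℝ} (hab : 0 < a + b) (x : ℝ) :
    ∫⁻ u : ℝ, ENNReal.ofReal (Real.exp (-a * u ^ 2 - b * (x - u) ^ 2)) =
      ENNReal.ofReal (Real.sqrt Real.pi * (a + b) ^ (-(1 / 2) : ℝ) *
        Real.exp (-(a * b / (a + b)) * x ^ 2)) := by
  have h0 : ∀ u : ℝ, Real.exp (-a * u ^ 2 - b * (x - u) ^ 2) =
      Real.exp (-(a * b / (a + b)) * x ^ 2) *
        Real.exp (-(a + b) * (u - b * x / (a + b)) ^ 2) := by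
    intro u
    rw [← Real.exp_add]
    congr 1
    field_simp
    ring
  have hi : Integrable fun u : ℝ => Real.exp (-a * u ^ 2 - b * (x - u) ^ 2) := by
    simp_rw [h0]
    exact ((integrable_exp_neg_mul_sq hab).comp_sub_right (b * x / (a + b))).const_mul _
  rw [← ofReal_integral_eq_lintegral_ofReal hi (Eventually.of_forall fun u => by positivity)]
  congr 1
  simp_rw [h0]
  rw [integral_const_mul, integral_sub_right_eq_self (fun u => Real.exp (-(a + b) * u ^ 2)),
    integral_gaussian, Real.sqrt_div Real.pi_pos.le, Real.rpow_neg hab.le, ← Real.sqrt_eq_rpow]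
  ring

/-- With u = y cos φ and v = y sin φ, the measure y^{α+1} |sin φ|^α dφ dy is |v|^α du dv on the
plane, and the integrand splits into a shifted Gaussian in u times e^{-(a+b)v²}. Only
one-dimensional integrals remain. -/
theorem lintegral_gaussian_angMeasure {α a b : ℝ} (hα : 0 < α) (hab : 0 < a + b) (x : ℝ) :
    ∫⁻ y in Ioi (0 : ℝ), ENNReal.ofReal (y ^ (α + 1) * Real.exp (-a * y ^ 2)) *
        ∫⁻ φ, ENNReal.ofReal (Real.exp (-b * distSq x y φ)) ∂angMeasure α =
      ENNReal.ofReal (heatConst α * (a + b) ^ (-halfDim α) *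
        Real.exp (-(a * b / (a + b)) * x ^ 2)) := by
  set F : ℝ × ℝ → ℝ≥0∞ := fun p =>
    ENNReal.ofReal (Real.exp (-a * p.1 ^ 2 - b * (x - p.1) ^ 2)) *
      ENNReal.ofReal (|p.2| ^ α * Real.exp (-(a + b) * p.2 ^ 2)) with hF
  have hFm : Measurable F := by fun_prop
  have h1 : ∫⁻ p, F p = ENNReal.ofReal (heatConst α * (a + b) ^ (-halfDim α) *
        Real.exp (-(a * b / (a + b)) * x ^ 2)) := by
    rw [hF, Measure.volume_eq_prod, lintegral_prod_mul
      (f := fun u => ENNReal.ofReal (Real.exp (-a * u ^ 2 - b * (x - u) ^ 2)))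
      (g := fun v => ENNReal.ofReal (|v| ^ α * Real.exp (-(a + b) * v ^ 2)))
      (by fun_prop) (by fun_prop), lintegral_shifted_gaussian hab, lintegral_abs_rpow_mul_gaussian hα hab,
      ← ENNReal.ofReal_mul (by positivity)]
    congr 1
    have : (a + b) ^ (-halfDim α) =
        (a + b) ^ (-(1 / 2) : ℝ) * (a + b) ^ (-(α + 1) / 2) := by
      rw [← Real.rpow_add hab, halfDim]; congr 1; ring
    rw [heatConst, this]; ring
  rw [← h1, ← lintegral_comp_polarCoord_symm, polarCoord_target, Measure.volume_eq_prod,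
    ← Measure.prod_restrict, lintegral_prod]
  · refine setLIntegral_congr_fun measurableSet_Ioi fun y (hy : 0 < y) => ?_
    rw [lintegral_angMeasure _ (by unfold distSq; fun_prop), ← lintegral_const_mul']
    · refine lintegral_congr fun φ => ?_
      simp only [polarCoord_symm_apply, hF, smul_eq_mul]
      rw [← ENNReal.ofReal_mul (by positivity), ← ENNReal.ofReal_mul (by positivity),
        ← ENNReal.ofReal_mul (by positivity), ← ENNReal.ofReal_mul (by positivity)]
      congr 1
      rw [abs_mul, abs_of_pos hy, Real.mul_rpow hy.le (abs_nonneg _), Real.rpow_add hy,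
        Real.rpow_one, distSq_eq]
      have : Real.exp (-a * y ^ 2) *
          Real.exp (-b * ((x - y * Real.cos φ) ^ 2 + (y * Real.sin φ) ^ 2)) =
          Real.exp (-a * (y * Real.cos φ) ^ 2 - b * (x - y * Real.cos φ) ^ 2) *
            Real.exp (-(a + b) * (y * Real.sin φ) ^ 2) := by
        rw [← Real.exp_add, ← Real.exp_add]
        congr 1
        have := Real.sin_sq_add_cos_sq φ
        linear_combination (a * y ^ 2) * this
      linear_combination (y ^ α * y * |Real.sin φ| ^ α) * this
    · exact ENNReal.ofReal_ne_top
  · refine Measurable.aemeasurable ?_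
    have : Measurable fun p : ℝ × ℝ => polarCoord.symm p := by
      simp only [polarCoord_symm_apply]; fun_prop
    fun_prop

/-! ### The heat profile -/

/-- The Gaussian profile of the heat kernel at time `t`, a function of the squared distance. -/
def heatProfile (α t s : ℝ) : ℝ :=
  (heatConst α)⁻¹ * (4 * t) ^ (-halfDim α) * Real.exp (-(s / (4 * t)))

theorem heatProfile_pos {α t : ℝ} (hα : 0 < α) (ht : 0 < t) (s : ℝ) : 0 < heatProfile α t s :=
  mul_pos (mul_pos (inv_pos.2 (heatConst_pos hα)) (Real.rpow_pos_of_pos (by linarith) _))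
    (Real.exp_pos _)

@[fun_prop]
theorem measurable_heatProfile (α : ℝ) : Measurable (fun p : ℝ × ℝ => heatProfile α p.1 p.2) := by
  unfold heatProfile; fun_prop

theorem continuous_heatProfile (α t : ℝ) : Continuous (heatProfile α t) := by
  unfold heatProfile; fun_prop

/-- The angular integral of the heat profile: the heat kernel without its weights. -/
def heatAngle (α t x y : ℝ) : ℝ≥0∞ :=
  ∫⁻ φ, ENNReal.ofReal (heatProfile α t (distSq x y φ)) ∂angMeasure α

theorem heatAngle_comm (α t x y : ℝ) : heatAngle α t x y = heatAngle α t y x := by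
  simp only [heatAngle, distSq_comm x y]

@[fun_prop]
theorem measurable_heatAngle (α : ℝ) :
    Measurable (fun p : ℝ × ℝ × ℝ => heatAngle α p.1 p.2.1 p.2.2) := by
  unfold heatAngle
  refine Measurable.lintegral_prod_right' (f := fun q : (ℝ × ℝ × ℝ) × ℝ =>
    ENNReal.ofReal (heatProfile α q.1.1 (distSq q.1.2.1 q.1.2.2 q.2))) ?_
  unfold heatProfile distSq
  fun_prop

/-- Heat flow maps Gaussians to Gaussians: this is the planar computation with b = 1/(4t). The case
a = 0 is conservation of mass and justifies `heatConst`. -/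
theorem lintegral_gaussian_heatAngle {α a t : ℝ} (hα : 0 < α) (ha : 0 ≤ a) (ht : 0 < t) (x : ℝ) :
    ∫⁻ y in Ioi (0 : ℝ), ENNReal.ofReal (y ^ (α + 1) * Real.exp (-a * y ^ 2)) *
        heatAngle α t x y =
      ENNReal.ofReal ((1 + 4 * a * t) ^ (-halfDim α) *
        Real.exp (-(a / (1 + 4 * a * t)) * x ^ 2)) := by
  have h4 : 0 < 4 * t := by linarith
  have hb : 0 < 1 / (4 * t) := by positivity
  have hab : 0 < a + 1 / (4 * t) := by positivity
  have hA : 0 < 1 + 4 * a * t := by positivity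
  have e1 : ∀ y, heatAngle α t x y = ENNReal.ofReal ((heatConst α)⁻¹ * (4 * t) ^ (-halfDim α)) *
      ∫⁻ φ, ENNReal.ofReal (Real.exp (-(1 / (4 * t)) * distSq x y φ)) ∂angMeasure α := by
    intro y
    have := heatConst_pos hα
    rw [← lintegral_const_mul' _ _ ENNReal.ofReal_ne_top, heatAngle]
    refine lintegral_congr fun φ => ?_
    rw [← ENNReal.ofReal_mul (by positivity), heatProfile]
    congr 3
    field_simp
  have hC := heatConst_pos hα
  simp_rw [e1, mul_left_comm _ (ENNReal.ofReal ((heatConst α)⁻¹ * (4 * t) ^ (-halfDim α)))]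
  rw [lintegral_const_mul' _ _ ENNReal.ofReal_ne_top, lintegral_gaussian_angMeasure hα hab,
    ← ENNReal.ofReal_mul (by positivity)]
  congr 1
  have e2 : a + 1 / (4 * t) = (1 + 4 * a * t) * (4 * t)⁻¹ := by field_simp; ring
  have e3 : a * (1 / (4 * t)) / (a + 1 / (4 * t)) = a / (1 + 4 * a * t) := by
    rw [e2]; field_simp
  rw [e3, e2, Real.mul_rpow hA.le (by positivity), Real.inv_rpow h4.le, Real.rpow_neg h4.le]
  have : (4 * t) ^ halfDim α ≠ 0 := (Real.rpow_pos_of_pos h4 _).ne'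
  field_simp

/-! ### Moments of the heat kernel -/

theorem lintegral_rpow_mul_exp_neg {c r : ℝ} (hc : 0 < c) (hr : 0 < r) :
    ∫⁻ l in Ioi (0 : ℝ), ENNReal.ofReal (l ^ (c - 1) * Real.exp (-(r * l))) =
      ENNReal.ofReal (Real.Gamma c * r ^ (-c)) := by
  have h := Real.integral_rpow_mul_exp_neg_mul_Ioi hc hr
  have hG := Real.Gamma_pos_of_pos hc
  have h2 : 0 < (1 / r) ^ c * Real.Gamma c := by positivity
  rw [← ofReal_integral_eq_lintegral_ofReal, h]
  · rw [one_div, Real.inv_rpow hr.le, Real.rpow_neg hr.le, mul_comm]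
  · by_contra hn
    rw [integral_undef hn] at h
    exact h2.ne h
  · filter_upwards [ae_restrict_mem measurableSet_Ioi] with l (hl : 0 < l)
    simp only [Pi.zero_apply]
    positivity

/-- The function `(1 - s) ^ γ`, cut off at `s = 1`. -/
def cutPow (γ s : ℝ) : ℝ≥0∞ := if s < 1 then ENNReal.ofReal ((1 - s) ^ γ) else 0

@[fun_prop]
theorem measurable_cutPow (γ : ℝ) : Measurable (cutPow γ) := by
  unfold cutPow
  exact Measurable.ite measurableSet_Iio (by fun_prop) measurable_const

theorem cutPow_le_one {γ s : ℝ} (hγ : 0 ≤ γ) (hs : 0 ≤ s) : cutPow γ s ≤ 1 := by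
  unfold cutPow
  split_ifs with h
  · rw [← ENNReal.ofReal_one]
    exact ENNReal.ofReal_le_ofReal (Real.rpow_le_one (by linarith) (by linarith) hγ)
  · exact zero_le

/-- For γ < 0 the singularity at s = 1 cannot be bounded, but there 2s ≥ 1. The factor 2s gained in
front of the singular term later cancels the time dependence of its integral. -/
theorem cutPow_le (γ : ℝ) {s : ℝ} (hs : 0 ≤ s) :
    cutPow γ s ≤ ENNReal.ofReal (1 + 2 ^ (-γ)) + ENNReal.ofReal (2 * s) * cutPow γ s := by
  rcases le_total s (1 / 2) with h | h
  · refine le_add_right ?_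
    rcases le_total 0 γ with hγ | hγ
    · refine (cutPow_le_one hγ hs).trans ?_
      rw [← ENNReal.ofReal_one]
      exact ENNReal.ofReal_le_ofReal (le_add_of_nonneg_right (by positivity))
    · rw [cutPow, if_pos (by linarith)]
      refine ENNReal.ofReal_le_ofReal ?_
      have h1 : (1 - s) ^ γ ≤ (1 / 2 : ℝ) ^ γ :=
        Real.rpow_le_rpow_of_nonpos (by norm_num) (by linarith) hγ
      rw [one_div, Real.inv_rpow zero_le_two, ← Real.rpow_neg zero_le_two] at h1
      linarith
  · refine le_add_left ?_
    conv_lhs => rw [← one_mul (cutPow γ s)]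
    gcongr
    rw [← ENNReal.ofReal_one]
    exact ENNReal.ofReal_le_ofReal (by linarith)

theorem lintegral_cutPow {γ c : ℝ} (hγ : -1 < γ) (hc : 0 < c) :
    ∫⁻ u in Ioi (0 : ℝ), cutPow γ (c * u) = ENNReal.ofReal (1 / (c * (γ + 1))) := by
  have hc' : 0 ≤ 1 / c := by positivity
  have h1 : ∫ u in (0 : ℝ)..(1 / c), (1 - c * u) ^ γ = 1 / (c * (γ + 1)) := by
    rw [intervalIntegral.integral_comp_sub_mul (fun u => u ^ γ) hc.ne' 1,
      mul_one_div_cancel hc.ne', sub_self, mul_zero, sub_zero, integral_rpow (Or.inl hγ),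
      Real.one_rpow, Real.zero_rpow (by linarith), smul_eq_mul]
    have : γ + 1 ≠ 0 := by linarith
    field_simp
    ring
  have hpos : 0 < 1 / (c * (γ + 1)) := by
    have : 0 < γ + 1 := by linarith
    positivity
  have h2 : ∀ u ∈ Ioi (0 : ℝ), cutPow γ (c * u) =
      (Iio (1 / c)).indicator (fun u => ENNReal.ofReal ((1 - c * u) ^ γ)) u := by
    intro u _
    have : c * u < 1 ↔ u < 1 / c := by rw [lt_div_iff₀ hc, mul_comm]
    simp only [cutPow, indicator, mem_Iio, this]
  rw [setLIntegral_congr_fun measurableSet_Ioi h2, lintegral_indicator measurableSet_Iio,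
    Measure.restrict_restrict measurableSet_Iio, inter_comm, Ioi_inter_Iio,
    setLIntegral_congr Ioo_ae_eq_Ioc, ← h1, intervalIntegral.integral_of_le hc',
    ofReal_integral_eq_lintegral_ofReal]
  · by_contra hn
    rw [intervalIntegral.integral_of_le hc', integral_undef hn] at h1
    exact hpos.ne h1
  · filter_upwards [ae_restrict_mem measurableSet_Ioc] with u hu
    have : u * c ≤ 1 := (le_div_iff₀ hc).1 hu.2
    exact Real.rpow_nonneg (by linarith) _

/-- Substitution μ = l/(1+4lt), which maps (0, ∞) onto (0, 1/(4t)) with 1 - 4tμ = 1/(1+4lt).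
Collecting the powers of 1+4lt, including the Jacobian, leaves the exponent (α-b)/2. -/
theorem lintegral_rational_change {α b t X : ℝ} (ht : 0 < t) :
    ∫⁻ l in Ioi (0 : ℝ), ENNReal.ofReal (l ^ (b / 2 - 1)) *
        ENNReal.ofReal ((1 + 4 * l * t) ^ (-halfDim α) *
          Real.exp (-(l / (1 + 4 * l * t)) * X)) =
      ∫⁻ μ in Ioi (0 : ℝ), ENNReal.ofReal (μ ^ (b / 2 - 1) * Real.exp (-(X * μ))) *
        cutPow ((α - b) / 2) (4 * t * μ) := by
  set f : ℝ → ℝ := fun l => l / (1 + 4 * l * t) with hf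
  have hP : ∀ l ∈ Ioi (0 : ℝ), 0 < 1 + 4 * l * t := fun l (hl : 0 < l) => by positivity
  have hd : ∀ l ∈ Ioi (0 : ℝ),
      HasDerivWithinAt f (1 / (1 + 4 * l * t) ^ 2) (Ioi 0) l := by
    intro l hl
    have h1 : HasDerivAt (fun l : ℝ => 1 + 4 * l * t) (4 * t) l := by
      have := (((hasDerivAt_id l).const_mul 4).mul_const t).const_add 1
      simpa using this
    have := (hasDerivAt_id l).div h1 (hP l hl).ne'
    refine (this.congr_deriv ?_).hasDerivWithinAt
    simp only [id]
    congr 1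
    ring
  have hinj : InjOn f (Ioi 0) := by
    intro l hl k hk h
    have h1 := (hP l hl).ne'
    have h2 := (hP k hk).ne'
    simp only [hf] at h
    rw [div_eq_div_iff h1 h2] at h
    linarith
  have himg : f '' Ioi 0 = Ioo 0 (1 / (4 * t)) := by
    ext μ
    constructor
    · rintro ⟨l, hl, rfl⟩
      have h1 := hP l hl
      have hl' : 0 < l := hl
      refine ⟨by positivity, ?_⟩
      simp only [hf]
      rw [div_lt_div_iff₀ h1 (by positivity)]
      linarith
    · rintro ⟨h1, h2⟩
      have h3 : μ * (4 * t) < 1 := (lt_div_iff₀ (by positivity)).1 h2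
      have h4 : 0 < 1 - 4 * t * μ := by linarith
      refine ⟨μ / (1 - 4 * t * μ), mem_Ioi.2 (by positivity), ?_⟩
      simp only [hf]
      have : 1 + 4 * (μ / (1 - 4 * t * μ)) * t = 1 / (1 - 4 * t * μ) := by
        rw [eq_div_iff h4.ne']
        linear_combination (4 * t) * div_mul_cancel₀ μ h4.ne'
      rw [this, div_div_eq_mul_div, div_one, div_mul_cancel₀ _ h4.ne']
  have h2 : ∀ u ∈ Ioi (0 : ℝ), ENNReal.ofReal (u ^ (b / 2 - 1) * Real.exp (-(X * u))) *
        cutPow ((α - b) / 2) (4 * t * u) =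
      (Iio (1 / (4 * t))).indicator (fun u => ENNReal.ofReal (u ^ (b / 2 - 1) *
        Real.exp (-(X * u))) * ENNReal.ofReal ((1 - 4 * t * u) ^ ((α - b) / 2))) u := by
    intro u _
    have : 4 * t * u < 1 ↔ u < 1 / (4 * t) := by rw [lt_div_iff₀ (by positivity), mul_comm]
    simp only [cutPow, indicator, mem_Iio, this]
    split_ifs <;> simp
  rw [setLIntegral_congr_fun measurableSet_Ioi h2, lintegral_indicator measurableSet_Iio,
    Measure.restrict_restrict measurableSet_Iio, inter_comm, Ioi_inter_Iio, ← himg,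
    lintegral_image_eq_lintegral_abs_deriv_mul measurableSet_Ioi hd hinj]
  refine setLIntegral_congr_fun measurableSet_Ioi fun l (hl : 0 < l) => ?_
  have hp := hP l hl
  have e1 : 1 - 4 * t * f l = (1 + 4 * l * t)⁻¹ := by
    simp only [hf]; field_simp; ring
  simp only [e1]
  rw [← ENNReal.ofReal_mul (by positivity), ← ENNReal.ofReal_mul (by positivity),
    ← ENNReal.ofReal_mul (by positivity)]
  congr 1
  have e2 : (1 + 4 * l * t) ^ (-halfDim α) = 1 / (1 + 4 * l * t) ^ 2 *
      ((1 + 4 * l * t) ^ (b / 2 - 1))⁻¹ * ((1 + 4 * l * t) ^ ((α - b) / 2))⁻¹ := by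
    rw [← Real.rpow_neg hp.le, ← Real.rpow_neg hp.le, one_div, ← Real.rpow_natCast,
      ← Real.rpow_neg hp.le, ← Real.rpow_add hp, ← Real.rpow_add hp]
    congr 1
    rw [halfDim]; push_cast; ring
  rw [e2, Real.inv_rpow hp.le, abs_of_pos (by positivity)]
  simp only [hf]
  rw [Real.div_rpow hl.le hp.le, show -(X * (l / (1 + 4 * l * t))) =
    -(l / (1 + 4 * l * t)) * X by ring]
  ring

/-- The power y^{-b} is Γ(b/2)⁻¹ ∫ l^{b/2-1} e^{-l y²} dl, a superposition of Gaussians, and the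
image of each Gaussian is explicit. Without the factor `cutPow` the right side would be exactly
x^{-b}, so that factor carries all the dependence on t. -/
theorem lintegral_rpow_heatAngle {α b t x : ℝ} (hα : 0 < α) (hb : 0 < b) (ht : 0 < t) :
    ∫⁻ y in Ioi (0 : ℝ), ENNReal.ofReal (y ^ (α + 1 - b)) * heatAngle α t x y =
      ENNReal.ofReal (Real.Gamma (b / 2))⁻¹ *
        ∫⁻ μ in Ioi (0 : ℝ), ENNReal.ofReal (μ ^ (b / 2 - 1) * Real.exp (-(x ^ 2 * μ))) *
          cutPow ((α - b) / 2) (4 * t * μ) := by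
  have hb2 : 0 < b / 2 := by linarith
  have hG := Real.Gamma_pos_of_pos hb2
  have h1 : ∀ y ∈ Ioi (0 : ℝ), ENNReal.ofReal (y ^ (α + 1 - b)) * heatAngle α t x y =
      ENNReal.ofReal (Real.Gamma (b / 2))⁻¹ * ∫⁻ l in Ioi (0 : ℝ),
        ENNReal.ofReal (l ^ (b / 2 - 1)) *
          (ENNReal.ofReal (y ^ (α + 1) * Real.exp (-l * y ^ 2)) * heatAngle α t x y) := by
    intro y (hy : 0 < y)
    have e : ∀ l ∈ Ioi (0 : ℝ), ENNReal.ofReal (l ^ (b / 2 - 1)) *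
          (ENNReal.ofReal (y ^ (α + 1) * Real.exp (-l * y ^ 2)) * heatAngle α t x y) =
        ENNReal.ofReal (l ^ (b / 2 - 1) * Real.exp (-(y ^ 2 * l))) *
          (ENNReal.ofReal (y ^ (α + 1)) * heatAngle α t x y) := by
      intro l (hl : 0 < l)
      rw [ENNReal.ofReal_mul (by positivity), ENNReal.ofReal_mul (by positivity),
        show -l * y ^ 2 = -(y ^ 2 * l) by ring]
      ring
    rw [setLIntegral_congr_fun measurableSet_Ioi e, lintegral_mul_const _ (by fun_prop),
      lintegral_rpow_mul_exp_neg hb2 (by positivity), ← mul_assoc, ← mul_assoc,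
      ← ENNReal.ofReal_mul (by positivity), ← ENNReal.ofReal_mul (by positivity)]
    congr 2
    rw [← Real.rpow_natCast, ← Real.rpow_mul hy.le, inv_mul_cancel_left₀ hG.ne',
      ← Real.rpow_add hy]
    congr 1
    push_cast; ring
  have hm : Measurable fun p : ℝ × ℝ => heatAngle α t x p.1 :=
    (measurable_heatAngle α).comp (by fun_prop : Measurable fun p : ℝ × ℝ => (t, x, p.1))
  have h2 : ∀ l ∈ Ioi (0 : ℝ), (∫⁻ y in Ioi (0 : ℝ), ENNReal.ofReal (l ^ (b / 2 - 1)) *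
          (ENNReal.ofReal (y ^ (α + 1) * Real.exp (-l * y ^ 2)) * heatAngle α t x y)) =
      ENNReal.ofReal (l ^ (b / 2 - 1)) *
        ENNReal.ofReal ((1 + 4 * l * t) ^ (-halfDim α) *
          Real.exp (-(l / (1 + 4 * l * t)) * x ^ 2)) := by
    intro l (hl : 0 < l)
    rw [lintegral_const_mul' _ _ ENNReal.ofReal_ne_top,
      lintegral_gaussian_heatAngle hα hl.le ht]
  rw [setLIntegral_congr_fun measurableSet_Ioi h1,
    lintegral_const_mul' _ _ ENNReal.ofReal_ne_top, lintegral_lintegral_swap,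
    setLIntegral_congr_fun measurableSet_Ioi h2, lintegral_rational_change ht]
  refine Measurable.aemeasurable ?_
  simp only [Function.uncurry_def]
  fun_prop

theorem lintegral_rpow_mul_exp_neg_sq {b x : ℝ} (hb : 0 < b) (hx : 0 < x) :
    ∫⁻ μ in Ioi (0 : ℝ), ENNReal.ofReal (μ ^ (b / 2 - 1) * Real.exp (-(x ^ 2 * μ))) =
      ENNReal.ofReal (Real.Gamma (b / 2) * x ^ (-b)) := by
  rw [lintegral_rpow_mul_exp_neg (by linarith) (by positivity), ← Real.rpow_natCast,
    ← Real.rpow_mul hx.le]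
  congr 3
  push_cast; ring

/-- For b ≤ α the cut-off power is at most 1, hence the constant is 1. This is the source of
contractivity. -/
theorem lintegral_rpow_heatAngle_le {α b t x : ℝ} (hα : 0 < α) (hb : 0 < b) (hbα : b ≤ α)
    (ht : 0 < t) (hx : 0 < x) :
    ∫⁻ y in Ioi (0 : ℝ), ENNReal.ofReal (y ^ (α + 1 - b)) * heatAngle α t x y ≤
      ENNReal.ofReal (x ^ (-b)) := by
  have hG := Real.Gamma_pos_of_pos (half_pos hb)
  have h : ∀ μ ∈ Ioi (0 : ℝ), ENNReal.ofReal (μ ^ (b / 2 - 1) * Real.exp (-(x ^ 2 * μ))) *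
      cutPow ((α - b) / 2) (4 * t * μ) ≤
        ENNReal.ofReal (μ ^ (b / 2 - 1) * Real.exp (-(x ^ 2 * μ))) := by
    intro μ (hμ : 0 < μ)
    exact mul_le_of_le_one_right' (cutPow_le_one (by linarith) (by positivity))
  rw [lintegral_rpow_heatAngle hα hb ht]
  grw [setLIntegral_mono' measurableSet_Ioi h, lintegral_rpow_mul_exp_neg_sq hb hx,
    ← ENNReal.ofReal_mul (by positivity), inv_mul_cancel_left₀ hG.ne']

/-- `u ^ c * exp (-u)` is bounded on the half-line. -/
theorem exists_rpow_mul_exp_neg_le {c : ℝ} (hc : 0 ≤ c) :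
    ∃ B : ℝ, 0 < B ∧ ∀ u : ℝ, 0 ≤ u → u ^ c * Real.exp (-u) ≤ B := by
  obtain ⟨n, hn⟩ := exists_nat_ge c
  refine ⟨1 + n.factorial, by positivity, fun u hu => ?_⟩
  have h1 : u ^ c ≤ 1 + u ^ n := by
    rcases le_total u 1 with h | h
    · exact (Real.rpow_le_one hu h hc).trans (le_add_of_nonneg_right (by positivity))
    · have := Real.rpow_le_rpow_of_exponent_le h hn
      rw [Real.rpow_natCast] at this
      linarith
  have h2 : u ^ n ≤ n.factorial * Real.exp u := by
    have := Real.pow_div_factorial_le_exp u hu n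
    rwa [div_le_iff₀' (by positivity)] at this
  have h3 : 1 ≤ Real.exp u := Real.one_le_exp hu
  rw [Real.exp_neg, ← div_eq_mul_inv, div_le_iff₀ (Real.exp_pos u)]
  nlinarith

/-- Now (α-b)/2 may be negative, but it exceeds -1, so `cutPow` is integrable. By `cutPow_le` the
singular part carries a factor 8tμ; the extra μ makes μ^{b/2} e^{-x²μ} bounded by a multiple of
x^{-b}, and t cancels against ∫ cutPow(4tμ) dμ = 1/(4t(γ+1)). The bound is thus uniform in t. -/
theorem exists_lintegral_rpow_heatAngle_le {α b : ℝ} (hα : 0 < α) (hb : 0 < b)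
    (hbα : b < α + 2) :
    ∃ C : ℝ, 0 < C ∧ ∀ t x : ℝ, 0 < t → 0 < x →
      ∫⁻ y in Ioi (0 : ℝ), ENNReal.ofReal (y ^ (α + 1 - b)) * heatAngle α t x y ≤
        ENNReal.ofReal (C * x ^ (-b)) := by
  have hG := Real.Gamma_pos_of_pos (half_pos hb)
  obtain ⟨B, hB0, hB⟩ := exists_rpow_mul_exp_neg_le (half_pos hb).le
  set γ := (α - b) / 2 with hγ
  have hγ1 : 0 < γ + 1 := by linarith
  set A : ℝ := 1 + 2 ^ (-γ) with hA
  have hA0 : 0 < A := by positivity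
  refine ⟨(Real.Gamma (b / 2))⁻¹ * (A * Real.Gamma (b / 2) + B * (2 / (γ + 1))),
    by positivity, fun t x ht hx => ?_⟩
  have h : ∀ μ ∈ Ioi (0 : ℝ), ENNReal.ofReal (μ ^ (b / 2 - 1) * Real.exp (-(x ^ 2 * μ))) *
      cutPow γ (4 * t * μ) ≤
        ENNReal.ofReal A * ENNReal.ofReal (μ ^ (b / 2 - 1) * Real.exp (-(x ^ 2 * μ))) +
        ENNReal.ofReal (8 * t * (B * x ^ (-b))) * cutPow γ (4 * t * μ) := by
    intro μ (hμ : 0 < μ)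
    grw [cutPow_le γ (by positivity : 0 ≤ 4 * t * μ)]
    rw [mul_add, ← mul_assoc, mul_comm (ENNReal.ofReal A), ← ENNReal.ofReal_mul (by positivity)
      (q := 2 * (4 * t * μ))]
    gcongr _ + ENNReal.ofReal ?_ * _
    have h1 := hB (x ^ 2 * μ) (by positivity)
    have h2 : (x ^ 2 * μ) ^ (b / 2) = x ^ b * (μ ^ (b / 2 - 1) * μ) := by
      rw [Real.mul_rpow (by positivity) hμ.le, ← Real.rpow_natCast, ← Real.rpow_mul hx.le,
        ← Real.rpow_add_one hμ.ne']
      congr 2 <;> push_cast <;> ring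
    rw [h2] at h1
    have h3 : μ ^ (b / 2 - 1) * μ * Real.exp (-(x ^ 2 * μ)) ≤ B * x ^ (-b) := by
      rw [Real.rpow_neg hx.le, ← div_eq_mul_inv, le_div_iff₀ (Real.rpow_pos_of_pos hx b)]
      linarith
    calc _ = 8 * t * (μ ^ (b / 2 - 1) * μ * Real.exp (-(x ^ 2 * μ))) := by ring
      _ ≤ _ := by gcongr
  rw [lintegral_rpow_heatAngle hα hb ht]
  grw [setLIntegral_mono' measurableSet_Ioi h]
  rw [lintegral_add_left (by fun_prop), lintegral_const_mul' _ _ ENNReal.ofReal_ne_top,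
    lintegral_const_mul' _ _ ENNReal.ofReal_ne_top, lintegral_rpow_mul_exp_neg_sq hb hx,
    lintegral_cutPow (by linarith) (by positivity), ← ENNReal.ofReal_mul (by positivity),
    ← ENNReal.ofReal_mul (by positivity), ← ENNReal.ofReal_add (by positivity) (by positivity),
    ← ENNReal.ofReal_mul (by positivity)]
  refine ENNReal.ofReal_le_ofReal (le_of_eq ?_)
  field_simp
  ring

/-- The Laplace transform in time of the moments, without the normalising factor. -/
theorem lintegral_exp_neg_mul_cutPow_le {γ : ℝ} (hγ : -1 < γ) {μ : ℝ} (hμ : 0 < μ) :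
    ∫⁻ t in Ioi (0 : ℝ), ENNReal.ofReal (Real.exp (-t)) * cutPow γ (4 * t * μ) ≤
      ENNReal.ofReal ((1 + 2 ^ (-γ) + 2 / (γ + 1)) * min 1 μ⁻¹) := by
  have hγ1 : 0 < γ + 1 := by linarith
  have hc : ∫⁻ t in Ioi (0 : ℝ), cutPow γ (4 * t * μ) =
      ENNReal.ofReal (1 / (4 * μ * (γ + 1))) := by
    rw [← lintegral_cutPow hγ (by positivity)]
    congr! 3
    ring
  rcases le_total 1 μ with h | h
  · rw [min_eq_right (inv_le_one_of_one_le₀ h)]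
    have : ∀ t ∈ Ioi (0 : ℝ), ENNReal.ofReal (Real.exp (-t)) * cutPow γ (4 * t * μ) ≤
        cutPow γ (4 * t * μ) := by
      intro t (ht : 0 < t)
      refine mul_le_of_le_one_left' ?_
      rw [← ENNReal.ofReal_one]
      exact ENNReal.ofReal_le_ofReal (Real.exp_le_one_iff.2 (by linarith))
    grw [setLIntegral_mono' measurableSet_Ioi this, hc]
    refine ENNReal.ofReal_le_ofReal ?_
    have e : 1 / (4 * μ * (γ + 1)) = (1 / 4 / (γ + 1)) * μ⁻¹ := by field_simp
    rw [e]
    gcongr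
    have : 1 / 4 / (γ + 1) ≤ 2 / (γ + 1) := by gcongr; norm_num
    have : (0 : ℝ) ≤ 2 ^ (-γ) := by positivity
    linarith
  · rw [min_eq_left ((one_le_inv₀ hμ).2 h), mul_one]
    have : ∀ t ∈ Ioi (0 : ℝ), ENNReal.ofReal (Real.exp (-t)) * cutPow γ (4 * t * μ) ≤
        ENNReal.ofReal (1 + 2 ^ (-γ)) * ENNReal.ofReal (Real.exp (-t)) +
          ENNReal.ofReal (8 * μ) * cutPow γ (4 * t * μ) := by
      intro t (ht : 0 < t)
      grw [cutPow_le γ (by positivity : 0 ≤ 4 * t * μ)]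
      rw [mul_add, ← mul_assoc, mul_comm (ENNReal.ofReal (1 + 2 ^ (-γ))),
        ← ENNReal.ofReal_mul (by positivity) (q := 2 * (4 * t * μ))]
      gcongr _ + ENNReal.ofReal ?_ * _
      have h1 : Real.exp (-t) * t ≤ 1 := by
        rw [Real.exp_neg, inv_mul_le_iff₀ (Real.exp_pos t)]
        linarith [Real.add_one_le_exp t]
      calc _ = 8 * μ * (Real.exp (-t) * t) := by ring
        _ ≤ 8 * μ * 1 := by gcongr
        _ = 8 * μ := mul_one _
    grw [setLIntegral_mono' measurableSet_Ioi this]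
    have he : ∫⁻ t in Ioi (0 : ℝ), ENNReal.ofReal (Real.exp (-t)) = 1 := by
      rw [← ofReal_integral_eq_lintegral_ofReal (integrableOn_exp_neg_Ioi 0)
        (Eventually.of_forall fun t => (Real.exp_pos _).le), integral_exp_neg_Ioi_zero,
        ENNReal.ofReal_one]
    rw [lintegral_add_left (by fun_prop), lintegral_const_mul' _ _ ENNReal.ofReal_ne_top,
      lintegral_const_mul' _ _ ENNReal.ofReal_ne_top, hc, he, mul_one,
      ← ENNReal.ofReal_mul (by positivity), ← ENNReal.ofReal_add (by positivity) (by positivity)]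
    refine ENNReal.ofReal_le_ofReal (le_of_eq ?_)
    field_simp
    ring

/-- Since 0 ≤ (b-a)/2 ≤ 1, one has min(1, 1/μ) ≤ μ^{(a-b)/2}, which replaces the exponent b by a in
the Gamma integral. For a = 0 that integral diverges; instead the exponential is dropped, and
μ^{b/2-1} min(1, 1/μ) is integrable because 0 < b < 2. -/
theorem exists_lintegral_rpow_mul_min_le {a b : ℝ} (hb : 0 < b) (hab : a ≤ b)
    (hba : b ≤ a + 2) (h0 : 0 < a ∨ a = 0 ∧ b < 2) :
    ∃ C : ℝ, 0 < C ∧ ∀ x : ℝ, 0 < x →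
      ∫⁻ μ in Ioi (0 : ℝ), ENNReal.ofReal (μ ^ (b / 2 - 1) * Real.exp (-(x ^ 2 * μ)) *
        min 1 μ⁻¹) ≤ ENNReal.ofReal (C * x ^ (-a)) := by
  rcases h0 with ha | ⟨rfl, hb2⟩
  · refine ⟨Real.Gamma (a / 2), Real.Gamma_pos_of_pos (half_pos ha), fun x hx => ?_⟩
    rw [← lintegral_rpow_mul_exp_neg_sq ha hx]
    refine setLIntegral_mono' measurableSet_Ioi fun μ (hμ : 0 < μ) => ?_
    refine ENNReal.ofReal_le_ofReal ?_
    have h1 : min 1 μ⁻¹ ≤ μ ^ ((a - b) / 2) := by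
      rcases le_total 1 μ with h | h
      · refine (min_le_right _ _).trans ?_
        rw [← Real.rpow_neg_one]
        exact Real.rpow_le_rpow_of_exponent_le h (by linarith)
      · exact (min_le_left _ _).trans (Real.one_le_rpow_of_pos_of_le_one_of_nonpos hμ h
          (by linarith))
    calc _ ≤ μ ^ (b / 2 - 1) * Real.exp (-(x ^ 2 * μ)) * μ ^ ((a - b) / 2) := by gcongr
      _ = μ ^ (b / 2 - 1) * μ ^ ((a - b) / 2) * Real.exp (-(x ^ 2 * μ)) := by ring
      _ = _ := by rw [← Real.rpow_add hμ]; congr 2; ring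
  · have hi : IntegrableOn (fun μ : ℝ => μ ^ (b / 2 - 1) * min 1 μ⁻¹) (Ioi 0) := by
      rw [← Ioc_union_Ioi_eq_Ioi zero_le_one]
      refine IntegrableOn.union ?_ ?_
      · have h1 : IntegrableOn (fun μ : ℝ => μ ^ (b / 2 - 1)) (Ioc 0 1) := by
          rw [← intervalIntegrable_iff_integrableOn_Ioc_of_le zero_le_one]
          exact intervalIntegral.intervalIntegrable_rpow' (by linarith)
        refine h1.congr_fun (fun μ hμ => ?_) measurableSet_Ioc
        simp only
        rw [min_eq_left ((one_le_inv₀ hμ.1).2 hμ.2), mul_one]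
      · have h1 : IntegrableOn (fun μ : ℝ => μ ^ (b / 2 - 2)) (Ioi 1) :=
          integrableOn_Ioi_rpow_of_lt (by linarith) one_pos
        refine h1.congr_fun (fun μ (hμ : 1 < μ) => ?_) measurableSet_Ioi
        have hμ0 : 0 < μ := by linarith
        simp only
        rw [min_eq_right (inv_le_one_of_one_le₀ hμ.le), ← Real.rpow_neg_one,
          ← Real.rpow_add hμ0]
        congr 1; ring
    have hn : ∀ᵐ μ : ℝ ∂volume.restrict (Ioi 0), 0 ≤ μ ^ (b / 2 - 1) * min 1 μ⁻¹ := by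
      filter_upwards [ae_restrict_mem measurableSet_Ioi] with μ (hμ : 0 < μ)
      positivity
    refine ⟨(∫ μ in Ioi (0 : ℝ), μ ^ (b / 2 - 1) * min 1 μ⁻¹) + 1,
      by linarith [integral_nonneg_of_ae hn], fun x hx => ?_⟩
    rw [neg_zero, Real.rpow_zero, mul_one]
    refine le_trans ?_ (ENNReal.ofReal_le_ofReal (le_add_of_nonneg_right zero_le_one))
    rw [ofReal_integral_eq_lintegral_ofReal hi hn]
    refine setLIntegral_mono' measurableSet_Ioi fun μ (hμ : 0 < μ) => ?_
    refine ENNReal.ofReal_le_ofReal ?_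
    have h1 : Real.exp (-(x ^ 2 * μ)) ≤ 1 := Real.exp_le_one_iff.2 (by
      have : 0 < x ^ 2 * μ := by positivity
      linarith)
    calc _ ≤ μ ^ (b / 2 - 1) * 1 * min 1 μ⁻¹ := by gcongr
      _ = _ := by rw [mul_one]

/-- Gain of integrability by the resolvent: integration in time against e^{-t} turns `cutPow` into
min(1, 1/μ), which improves x^{-b} to x^{-a}. It is applied with a = 1 - m and b = 1 - r to map X_m
into X_r. -/
theorem exists_lintegral_exp_neg_rpow_heatAngle_le {α a b : ℝ} (hα : 0 < α) (hb : 0 < b)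
    (hbα : b < α + 2) (hab : a ≤ b) (hba : b ≤ a + 2) (h0 : 0 < a ∨ a = 0 ∧ b < 2) :
    ∃ C : ℝ, 0 < C ∧ ∀ x : ℝ, 0 < x →
      ∫⁻ t in Ioi (0 : ℝ), ENNReal.ofReal (Real.exp (-t)) *
        ∫⁻ y in Ioi (0 : ℝ), ENNReal.ofReal (y ^ (α + 1 - b)) * heatAngle α t x y ≤
        ENNReal.ofReal (C * x ^ (-a)) := by
  obtain ⟨C, hC0, hC⟩ := exists_lintegral_rpow_mul_min_le hb hab hba h0
  have hG := Real.Gamma_pos_of_pos (half_pos hb)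
  set γ := (α - b) / 2 with hγ
  have hγ1 : 0 < γ + 1 := by linarith
  set K : ℝ := 1 + 2 ^ (-γ) + 2 / (γ + 1) with hK
  have hK0 : 0 < K := by positivity
  refine ⟨(Real.Gamma (b / 2))⁻¹ * (K * C), by positivity, fun x hx => ?_⟩
  have h1 : ∀ t ∈ Ioi (0 : ℝ), ENNReal.ofReal (Real.exp (-t)) *
        (∫⁻ y in Ioi (0 : ℝ), ENNReal.ofReal (y ^ (α + 1 - b)) * heatAngle α t x y) =
      ENNReal.ofReal (Real.Gamma (b / 2))⁻¹ * ∫⁻ μ in Ioi (0 : ℝ),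
        ENNReal.ofReal (μ ^ (b / 2 - 1) * Real.exp (-(x ^ 2 * μ))) *
          (ENNReal.ofReal (Real.exp (-t)) * cutPow γ (4 * t * μ)) := by
    intro t (ht : 0 < t)
    rw [lintegral_rpow_heatAngle hα hb ht, mul_left_comm,
      ← lintegral_const_mul' _ _ ENNReal.ofReal_ne_top]
    simp only [mul_left_comm (ENNReal.ofReal (Real.exp (-t)))]
    rfl
  have h2 : ∀ μ ∈ Ioi (0 : ℝ), (∫⁻ t in Ioi (0 : ℝ),
        ENNReal.ofReal (μ ^ (b / 2 - 1) * Real.exp (-(x ^ 2 * μ))) *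
          (ENNReal.ofReal (Real.exp (-t)) * cutPow γ (4 * t * μ))) ≤
      ENNReal.ofReal K * ENNReal.ofReal (μ ^ (b / 2 - 1) * Real.exp (-(x ^ 2 * μ)) *
        min 1 μ⁻¹) := by
    intro μ (hμ : 0 < μ)
    rw [lintegral_const_mul' _ _ ENNReal.ofReal_ne_top]
    grw [lintegral_exp_neg_mul_cutPow_le (by linarith) hμ]
    rw [← ENNReal.ofReal_mul (by positivity), ← ENNReal.ofReal_mul (by positivity)]
    refine ENNReal.ofReal_le_ofReal (le_of_eq ?_)
    ring
  rw [setLIntegral_congr_fun measurableSet_Ioi h1,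
    lintegral_const_mul' _ _ ENNReal.ofReal_ne_top, lintegral_lintegral_swap]
  · grw [setLIntegral_mono' measurableSet_Ioi h2]
    rw [lintegral_const_mul' _ _ ENNReal.ofReal_ne_top]
    grw [hC x hx]
    rw [← ENNReal.ofReal_mul (by positivity), ← ENNReal.ofReal_mul (by positivity)]
    refine ENNReal.ofReal_le_ofReal (le_of_eq ?_)
    ring
  · refine Measurable.aemeasurable ?_
    simp only [Function.uncurry_def]
    fun_prop

/-! ### Weighted spaces -/

theorem lintegral_weight (r : ℝ) (F : ℝ → ℝ≥0∞) :
    ∫⁻ x, F x ∂weight r = ∫⁻ x in Ioi (0 : ℝ), ENNReal.ofReal (x ^ r) * F x := by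
  rw [weight, lintegral_withDensity_eq_lintegral_mul_non_measurable _ (by fun_prop)
    (by simp)]
  rfl

theorem eLpNorm_weight (r : ℝ) (f : ℝ → ℂ) :
    eLpNorm f 1 (weight r) = ∫⁻ x in Ioi (0 : ℝ), ENNReal.ofReal (x ^ r) * ‖f x‖ₑ := by
  rw [eLpNorm_one_eq_lintegral_enorm, lintegral_weight]

theorem enorm_X {m : ℝ} (f : X m) :
    ‖f‖ₑ = ∫⁻ x in Ioi (0 : ℝ), ENNReal.ofReal (x ^ m) * ‖(f : ℝ → ℂ) x‖ₑ := by
  rw [Lp.enorm_def, eLpNorm_weight]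

theorem weight_ac_restrict (r : ℝ) : weight r ≪ volume.restrict (Ioi (0 : ℝ)) :=
  withDensity_absolutelyContinuous _ _

theorem memLp_weight_iff {r : ℝ} {f : ℝ → ℂ} :
    MemLp f 1 (weight r) ↔ AEStronglyMeasurable f (volume.restrict (Ioi (0 : ℝ))) ∧
      ∫⁻ x in Ioi (0 : ℝ), ENNReal.ofReal (x ^ r) * ‖f x‖ₑ < ⊤ := by
  rw [MemLp, eLpNorm_weight]
  exact and_congr_left fun _ => ⟨fun h => AEStronglyMeasurable.mono_ac (restrict_ac_weight r) h,
    fun h => AEStronglyMeasurable.mono_ac (weight_ac_restrict r) h⟩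

/-- Passing between weighted spaces by an almost everywhere equality for Lebesgue measure. -/
theorem memLp_weight_congr {r : ℝ} {f g : ℝ → ℂ} (h : f =ᵐ[volume.restrict (Ioi 0)] g)
    (hf : MemLp f 1 (weight r)) : MemLp g 1 (weight r) :=
  (memLp_congr_ae ((weight_ac_restrict r).ae_eq h)).1 hf

theorem X_ext {m : ℝ} {f g : X m} (h : (f : ℝ → ℂ) =ᵐ[volume.restrict (Ioi 0)] g) : f = g :=
  Lp.ext ((weight_ac_restrict m).ae_eq h)

/-! ### Integral pairings -/

/-- The pairing of a function with a real weight function. -/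
def pair (w : ℝ → ℝ) (f : ℝ → ℂ) : ℂ := ∫ x in Ioi (0 : ℝ), w x • f x

theorem pair_congr {w : ℝ → ℝ} {f g : ℝ → ℂ} (h : f =ᵐ[volume.restrict (Ioi 0)] g) :
    pair w f = pair w g :=
  integral_congr_ae (h.mono fun x hx => congrArg (w x • ·) hx)

theorem lintegral_pair_le {m C : ℝ} {w : ℝ → ℝ} (hw : ∀ x, 0 < x → |w x| ≤ C * x ^ m)
    (f : ℝ → ℂ) :
    ∫⁻ x in Ioi (0 : ℝ), ‖w x • f x‖ₑ ≤
      ENNReal.ofReal C * ∫⁻ x in Ioi (0 : ℝ), ENNReal.ofReal (x ^ m) * ‖f x‖ₑ := by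
  rw [← lintegral_const_mul' _ _ ENNReal.ofReal_ne_top]
  refine setLIntegral_mono' measurableSet_Ioi fun x (hx : 0 < x) => ?_
  rw [enorm_smul, ← mul_assoc, ← ENNReal.ofReal_mul' (by positivity)]
  gcongr
  rw [← ofReal_norm]
  exact ENNReal.ofReal_le_ofReal (hw x hx)

theorem integrable_pair {m C : ℝ} {w : ℝ → ℝ} (hwm : Measurable w)
    (hw : ∀ x, 0 < x → |w x| ≤ C * x ^ m) {f : ℝ → ℂ} (hf : MemLp f 1 (weight m)) :
    Integrable (fun x => w x • f x) (volume.restrict (Ioi 0)) := by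
  obtain ⟨h1, h2⟩ := memLp_weight_iff.1 hf
  refine ⟨hwm.aestronglyMeasurable.smul h1, (lintegral_pair_le hw f).trans_lt ?_⟩
  exact ENNReal.mul_lt_top ENNReal.ofReal_lt_top h2

theorem exists_pair_clm {m C : ℝ} {w : ℝ → ℝ} (hwm : Measurable w) (hC : 0 ≤ C)
    (hw : ∀ x, 0 < x → |w x| ≤ C * x ^ m) :
    ∃ L : X m →L[ℂ] ℂ, ∀ f : X m, L f = pair w f := by
  let l : X m →ₗ[ℂ] ℂ :=
    { toFun := fun f => pair w f
      map_add' := fun f g => by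
        rw [pair_congr ((restrict_ac_weight m).ae_eq (Lp.coeFn_add f g))]
        simp only [pair, Pi.add_apply, smul_add]
        exact integral_add (integrable_pair hwm hw (Lp.memLp f))
          (integrable_pair hwm hw (Lp.memLp g))
      map_smul' := fun c f => by
        rw [pair_congr ((restrict_ac_weight m).ae_eq (Lp.coeFn_smul c f))]
        simp only [pair, Pi.smul_apply, smul_comm _ c, RingHom.id_apply]
        exact integral_smul _ _ }
  refine ⟨l.mkContinuous C fun f => ?_, fun f => rfl⟩
  have h1 : ‖l f‖ₑ ≤ ENNReal.ofReal C * ‖f‖ₑ := by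
    rw [enorm_X]
    exact (enorm_integral_le_lintegral_enorm _).trans (lintegral_pair_le hw f)
  rw [← ofReal_norm, ← ofReal_norm, ← ENNReal.ofReal_mul hC] at h1
  exact (ENNReal.ofReal_le_ofReal_iff (by positivity)).1 h1

/-! ### Integral operators -/

/-- `K` is measurable and `∫ x ^ r |K x y| dx ≤ C y ^ m` for all `y > 0`. -/
structure KernelBound (r m C : ℝ) (K : ℝ → ℝ → ℂ) : Prop where
  meas : Measurable (Function.uncurry K)
  bound : ∀ y, 0 < y →
    ∫⁻ x in Ioi (0 : ℝ), ENNReal.ofReal (x ^ r) * ‖K x y‖ₑ ≤ ENNReal.ofReal (C * y ^ m)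

/-- The function `x ↦ ∫ K x y f y dy`. -/
def kerFun (K : ℝ → ℝ → ℂ) (f : ℝ → ℂ) (x : ℝ) : ℂ := ∫ y in Ioi (0 : ℝ), K x y * f y

namespace KernelBound

variable {r m C : ℝ} {K : ℝ → ℝ → ℂ}

/-- On weighted L₁ spaces a bound on the columns of the kernel suffices, by Tonelli. -/
theorem lintegral_lintegral_le (h : KernelBound r m C K) {f : ℝ → ℂ}
    (hf : AEStronglyMeasurable f (volume.restrict (Ioi (0 : ℝ)))) :
    ∫⁻ x in Ioi (0 : ℝ), ENNReal.ofReal (x ^ r) *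
        ∫⁻ y in Ioi (0 : ℝ), ‖K x y * f y‖ₑ ≤
      ENNReal.ofReal C * ∫⁻ y in Ioi (0 : ℝ), ENNReal.ofReal (y ^ m) * ‖f y‖ₑ := by
  simp_rw [← lintegral_const_mul' _ _ ENNReal.ofReal_ne_top]
  rw [lintegral_lintegral_swap]
  · refine setLIntegral_mono_ae' measurableSet_Ioi (Eventually.of_forall fun y (hy : 0 < y) => ?_)
    simp_rw [enorm_mul, ← mul_assoc]
    rw [lintegral_mul_const', ← ENNReal.ofReal_mul' (by positivity)]
    · gcongr
      exact h.bound y hy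
    · exact enorm_ne_top
  · refine AEMeasurable.mul (by fun_prop) (AEMeasurable.enorm ?_)
    exact h.meas.aemeasurable.mul hf.aemeasurable.comp_snd

theorem ae_integrable (h : KernelBound r m C K) {f : ℝ → ℂ} (hf : MemLp f 1 (weight m)) :
    ∀ᵐ x ∂volume.restrict (Ioi (0 : ℝ)),
      Integrable (fun y => K x y * f y) (volume.restrict (Ioi 0)) := by
  obtain ⟨h1, h2⟩ := memLp_weight_iff.1 hf
  have h3 := (h.lintegral_lintegral_le h1).trans_lt (ENNReal.mul_lt_top ENNReal.ofReal_lt_top h2)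
  have hm : AEMeasurable (fun x => ENNReal.ofReal (x ^ r) *
      ∫⁻ y in Ioi (0 : ℝ), ‖K x y * f y‖ₑ) (volume.restrict (Ioi (0 : ℝ))) := by
    refine AEMeasurable.mul (by fun_prop) (AEMeasurable.lintegral_prod_right' (f := fun p : ℝ × ℝ =>
      ‖K p.1 p.2 * f p.2‖ₑ) (AEMeasurable.enorm ?_))
    exact h.meas.aemeasurable.mul h1.aemeasurable.comp_snd
  filter_upwards [ae_lt_top' hm h3.ne, ae_restrict_mem measurableSet_Ioi] with x hx (hx0 : 0 < x)
  refine ⟨?_, lt_top_iff_ne_top.2 fun ht => hx.ne ?_⟩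
  · have : Measurable fun y => K x y := h.meas.comp (measurable_const.prodMk measurable_id)
    exact this.aestronglyMeasurable.mul h1
  · rw [ht, ENNReal.mul_top]
    simpa using Real.rpow_pos_of_pos hx0 r

theorem aestronglyMeasurable (h : KernelBound r m C K) {f : ℝ → ℂ}
    (hf : AEStronglyMeasurable f (volume.restrict (Ioi (0 : ℝ)))) :
    AEStronglyMeasurable (kerFun K f) (volume.restrict (Ioi (0 : ℝ))) :=
  AEStronglyMeasurable.integral_prod_right' (f := fun p : ℝ × ℝ => K p.1 p.2 * f p.2)
    (h.meas.aestronglyMeasurable.mul hf.comp_snd)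

theorem lintegral_kerFun_le (h : KernelBound r m C K) {f : ℝ → ℂ}
    (hf : AEStronglyMeasurable f (volume.restrict (Ioi (0 : ℝ)))) :
    ∫⁻ x in Ioi (0 : ℝ), ENNReal.ofReal (x ^ r) * ‖kerFun K f x‖ₑ ≤
      ENNReal.ofReal C * ∫⁻ y in Ioi (0 : ℝ), ENNReal.ofReal (y ^ m) * ‖f y‖ₑ := by
  refine le_trans (lintegral_mono fun x => ?_) (h.lintegral_lintegral_le hf)
  dsimp only
  gcongr
  exact enorm_integral_le_lintegral_enorm _

theorem memLp (h : KernelBound r m C K) {f : ℝ → ℂ} (hf : MemLp f 1 (weight m)) :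
    MemLp (kerFun K f) 1 (weight r) := by
  obtain ⟨h1, h2⟩ := memLp_weight_iff.1 hf
  exact memLp_weight_iff.2 ⟨h.aestronglyMeasurable h1,
    (h.lintegral_kerFun_le h1).trans_lt (ENNReal.mul_lt_top ENNReal.ofReal_lt_top h2)⟩

theorem pair_kerFun (h : KernelBound r m C K) {f : ℝ → ℂ} (hf : MemLp f 1 (weight m))
    {w : ℝ → ℝ} {C' : ℝ} (hwm : Measurable w) (hw : ∀ x, 0 < x → |w x| ≤ C' * x ^ r) :
    pair w (kerFun K f) =
      ∫ y in Ioi (0 : ℝ), (∫ x in Ioi (0 : ℝ), w x • K x y) * f y := by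
  obtain ⟨h1, h2⟩ := memLp_weight_iff.1 hf
  have e : pair w (kerFun K f) =
      ∫ x in Ioi (0 : ℝ), ∫ y in Ioi (0 : ℝ), w x • (K x y * f y) := by
    simp only [pair, kerFun, integral_smul]
  rw [e, integral_integral_swap]
  · refine integral_congr_ae (Eventually.of_forall fun y => ?_)
    simp only [← smul_mul_assoc]
    exact integral_mul_const _ _
  · have hm : AEStronglyMeasurable (Function.uncurry fun x y => w x • (K x y * f y))
        ((volume.restrict (Ioi (0 : ℝ))).prod (volume.restrict (Ioi (0 : ℝ)))) :=
      ((hwm.comp measurable_fst).aestronglyMeasurable).smul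
        (h.meas.aestronglyMeasurable.mul h1.comp_snd)
    refine ⟨hm, ?_⟩
    rw [hasFiniteIntegral_iff_enorm, lintegral_prod _ hm.enorm]
    refine lt_of_le_of_lt ?_ (ENNReal.mul_lt_top (ENNReal.ofReal_lt_top (r := C'))
      ((h.lintegral_lintegral_le h1).trans_lt (ENNReal.mul_lt_top ENNReal.ofReal_lt_top h2)))
    rw [← lintegral_const_mul' _ _ ENNReal.ofReal_ne_top]
    refine setLIntegral_mono_ae' measurableSet_Ioi (Eventually.of_forall fun x (hx : 0 < x) => ?_)
    simp only [Function.uncurry_apply_pair, enorm_smul]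
    rw [lintegral_const_mul' _ _ enorm_ne_top, ← mul_assoc,
      ← ENNReal.ofReal_mul' (by positivity)]
    gcongr
    rw [← ofReal_norm]
    exact ENNReal.ofReal_le_ofReal (hw x hx)

end KernelBound

theorem kerFun_congr (K : ℝ → ℝ → ℂ) {f g : ℝ → ℂ} (h : f =ᵐ[volume.restrict (Ioi 0)] g) :
    kerFun K f = kerFun K g := by
  funext x
  exact integral_congr_ae (h.mono fun y hy => congrArg (K x y * ·) hy)

open scoped Classical in
/-- The integral operator on `X m` with kernel `K`, provided that `K` satisfies a kernel bound. -/
def kerOp (m : ℝ) (K : ℝ → ℝ → ℂ) : X m →L[ℂ] X m :=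
  if h : ∃ C : ℝ, 0 ≤ C ∧ KernelBound m m C K then
    LinearMap.mkContinuous
      { toFun := fun f => (h.choose_spec.2.memLp (Lp.memLp f)).toLp (kerFun K f)
        map_add' := fun f g => by
          refine X_ext ?_
          have hb := h.choose_spec.2
          have e := (restrict_ac_weight m)
          filter_upwards [e.ae_eq (MemLp.coeFn_toLp (hb.memLp (Lp.memLp (f + g)))),
            e.ae_eq (Lp.coeFn_add ((hb.memLp (Lp.memLp f)).toLp (kerFun K f))
              ((hb.memLp (Lp.memLp g)).toLp (kerFun K g))),
            e.ae_eq (MemLp.coeFn_toLp (hb.memLp (Lp.memLp f))),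
            e.ae_eq (MemLp.coeFn_toLp (hb.memLp (Lp.memLp g))),
            hb.ae_integrable (Lp.memLp f), hb.ae_integrable (Lp.memLp g)] with
            x h1 h2 h3 h4 h5 h6
          rw [h1, h2, Pi.add_apply, h3, h4, kerFun_congr K (e.ae_eq (Lp.coeFn_add f g))]
          simp only [kerFun, Pi.add_apply, mul_add]
          exact integral_add h5 h6
        map_smul' := fun c f => by
          refine X_ext ?_
          have hb := h.choose_spec.2
          have e := (restrict_ac_weight m)
          filter_upwards [e.ae_eq (MemLp.coeFn_toLp (hb.memLp (Lp.memLp (c • f)))),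
            e.ae_eq (Lp.coeFn_smul c ((hb.memLp (Lp.memLp f)).toLp (kerFun K f))),
            e.ae_eq (MemLp.coeFn_toLp (hb.memLp (Lp.memLp f)))] with x h1 h2 h3
          rw [h1, RingHom.id_apply, h2, Pi.smul_apply, h3,
            kerFun_congr K (e.ae_eq (Lp.coeFn_smul c f))]
          simp only [kerFun, Pi.smul_apply, mul_smul_comm]
          exact integral_smul _ _ }
      h.choose (fun f => by
        have hb := h.choose_spec.2
        have h1 : ‖(hb.memLp (Lp.memLp f)).toLp (kerFun K f)‖ₑ ≤
            ENNReal.ofReal h.choose * ‖f‖ₑ := by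
          rw [Lp.enorm_toLp, eLpNorm_weight, enorm_X]
          exact hb.lintegral_kerFun_le (memLp_weight_iff.1 (Lp.memLp f)).1
        rw [← ofReal_norm, ← ofReal_norm,
          ← ENNReal.ofReal_mul h.choose_spec.1] at h1
        exact (ENNReal.ofReal_le_ofReal_iff
          (mul_nonneg h.choose_spec.1 (norm_nonneg _))).1 h1)
  else 0

theorem KernelBound.kerOp_ae {m C : ℝ} {K : ℝ → ℝ → ℂ} (hC : 0 ≤ C) (h : KernelBound m m C K)
    (f : X m) : (kerOp m K f : ℝ → ℂ) =ᵐ[volume.restrict (Ioi 0)] kerFun K f := by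
  have h' : ∃ C : ℝ, 0 ≤ C ∧ KernelBound m m C K := ⟨C, hC, h⟩
  rw [kerOp, dif_pos h']
  exact (restrict_ac_weight m).ae_eq
    (MemLp.coeFn_toLp (h'.choose_spec.2.memLp (Lp.memLp f)))

theorem KernelBound.norm_kerOp_le {m C : ℝ} {K : ℝ → ℝ → ℂ} (hC : 0 ≤ C)
    (h : KernelBound m m C K) : ‖kerOp m K‖ ≤ C := by
  refine ContinuousLinearMap.opNorm_le_bound _ hC fun f => ?_
  have h1 : ‖kerOp m K f‖ₑ ≤ ENNReal.ofReal C * ‖f‖ₑ := by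
    rw [enorm_X, enorm_X]
    refine le_trans (le_of_eq (lintegral_congr_ae ?_))
      (h.lintegral_kerFun_le (memLp_weight_iff.1 (Lp.memLp f)).1)
    filter_upwards [h.kerOp_ae hC f] with x hx
    rw [hx]
  rw [← ofReal_norm, ← ofReal_norm, ← ENNReal.ofReal_mul hC] at h1
  exact (ENNReal.ofReal_le_ofReal_iff (by positivity)).1 h1

/-! ### Kernels with a radial profile -/

/-- The kernel `x ^ α y ∫ p (|x - y e^{iφ}|²) |sin φ| ^ α dφ`. -/
def profileKernel (α : ℝ) (p : ℝ → ℂ) (x y : ℝ) : ℂ :=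
  ((x ^ α * y : ℝ) : ℂ) * ∫ φ, p (distSq x y φ) ∂angMeasure α

theorem measurable_profileKernel (α : ℝ) {p : ℝ → ℂ} (hp : Measurable p) :
    Measurable (Function.uncurry (profileKernel α p)) := by
  have h : StronglyMeasurable fun q : ℝ × ℝ => ∫ φ, p (distSq q.1 q.2 φ) ∂angMeasure α := by
    refine StronglyMeasurable.integral_prod_right'
      (f := fun q : (ℝ × ℝ) × ℝ => p (distSq q.1.1 q.1.2 q.2)) ?_
    refine (hp.comp ?_).stronglyMeasurable
    unfold distSq; fun_prop
  refine Measurable.mul ?_ h.measurable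
  fun_prop

/-- Here b = 1 - m. For m = 1 the Gamma representation of the power is not available and
conservation of mass is used; b ≤ α means m ≥ 1 - α = κ and gives M = 1; the remaining range b < α +
2 gives some constant. In each case M does not depend on t. -/
theorem exists_moment_bound {α m : ℝ} (hα : 0 < α) (hm : -1 - α < m) (hm1 : m ≤ 1) :
    ∃ M : ℝ, 0 < M ∧ (1 - α < m → M = 1) ∧ ∀ t y : ℝ, 0 < t → 0 < y →
      ∫⁻ x in Ioi (0 : ℝ), ENNReal.ofReal (x ^ (α + m)) * heatAngle α t y x ≤
        ENNReal.ofReal (M * y ^ (m - 1)) := by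
  have e1 : α + m = α + 1 - (1 - m) := by ring
  have e2 : m - 1 = -(1 - m) := by ring
  rcases hm1.eq_or_lt with rfl | hlt
  · refine ⟨1, one_pos, fun _ => rfl, fun t y ht hy => ?_⟩
    have := lintegral_gaussian_heatAngle hα le_rfl ht y
    simp only [neg_zero, zero_mul, Real.exp_zero, mul_one, mul_zero, add_zero, Real.one_rpow,
      zero_div, ENNReal.ofReal_one] at this
    rw [this, sub_self, Real.rpow_zero, mul_one, ENNReal.ofReal_one]
  · rw [e1, e2]
    rcases le_or_gt (1 - m) α with h | h
    · refine ⟨1, one_pos, fun _ => rfl, fun t y ht hy => ?_⟩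
      rw [one_mul]
      exact lintegral_rpow_heatAngle_le hα (by linarith) h ht hy
    · obtain ⟨C, hC0, hC⟩ := exists_lintegral_rpow_heatAngle_le hα (b := 1 - m) (by linarith)
        (by linarith)
      exact ⟨C, hC0, fun h' => by linarith, hC⟩

theorem heatAngle_eq_ofReal {α t : ℝ} (hα : 0 < α) (ht : 0 < t) (x y : ℝ) :
    heatAngle α t x y =
      ENNReal.ofReal (∫ φ, heatProfile α t (distSq x y φ) ∂angMeasure α) := by
  have := isFiniteMeasure_angMeasure hα
  rw [heatAngle, ofReal_integral_eq_lintegral_ofReal]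
  · refine Integrable.of_bound (C := (heatConst α)⁻¹ * (4 * t) ^ (-halfDim α)) ?_ ?_
    · exact ((continuous_heatProfile α t).comp
        (by unfold distSq; fun_prop)).aestronglyMeasurable
    · refine Eventually.of_forall fun φ => ?_
      have h1 := heatConst_pos hα
      rw [Real.norm_of_nonneg (heatProfile_pos hα ht _).le, heatProfile]
      refine mul_le_of_le_one_right (by positivity) (Real.exp_le_one_iff.2 ?_)
      have := div_nonneg (distSq_nonneg x y φ) (by positivity : 0 ≤ 4 * t)
      linarith
  · exact Eventually.of_forall fun φ => (heatProfile_pos hα ht _).le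

theorem profileKernel_heatProfile {α t : ℝ} (hα : 0 < α) (ht : 0 < t) (x y : ℝ) :
    profileKernel α (fun s => (heatProfile α t s : ℂ)) x y =
      ((x ^ α * y * (heatAngle α t x y).toReal : ℝ) : ℂ) := by
  rw [profileKernel, integral_complex_ofReal, heatAngle_eq_ofReal hα ht, ENNReal.toReal_ofReal
    (integral_nonneg fun φ => (heatProfile_pos hα ht _).le), ← Complex.ofReal_mul]

theorem enorm_profileKernel_le {α t C : ℝ} (hα : 0 < α) (ht : 0 < t) {p : ℝ → ℂ}
    (hp : ∀ s, 0 ≤ s → ‖p s‖ ≤ C * heatProfile α t s) {x y : ℝ} (hx : 0 < x) (hy : 0 < y) :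
    ‖profileKernel α p x y‖ₑ ≤
      ENNReal.ofReal (C * y) * (ENNReal.ofReal (x ^ α) * heatAngle α t x y) := by
  rw [profileKernel, enorm_mul]
  have h1 : ‖((x ^ α * y : ℝ) : ℂ)‖ₑ = ENNReal.ofReal y * ENNReal.ofReal (x ^ α) := by
    rw [← ofReal_norm, Complex.norm_real, Real.norm_of_nonneg (by positivity), mul_comm,
      ENNReal.ofReal_mul hy.le]
  have h2 : ‖∫ φ, p (distSq x y φ) ∂angMeasure α‖ₑ ≤ ENNReal.ofReal C * heatAngle α t x y := by
    refine (enorm_integral_le_lintegral_enorm _).trans ?_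
    rw [heatAngle, ← lintegral_const_mul' _ _ ENNReal.ofReal_ne_top]
    refine lintegral_mono fun φ => ?_
    dsimp only
    rw [← ENNReal.ofReal_mul' (heatProfile_pos hα ht _).le, ← ofReal_norm]
    exact ENNReal.ofReal_le_ofReal (hp _ (distSq_nonneg x y φ))
  grw [h1, h2]
  rw [ENNReal.ofReal_mul' hy.le]
  refine le_of_eq ?_
  ring

/-- A profile need only be dominated by a real heat profile at some time t. As M is independent of
t, the operator bound C * M is too. It serves for complex times, for the derivative in z and for the
Taylor remainder alike. -/
theorem kernelBound_profileKernel {α t m C M : ℝ} (hα : 0 < α) (ht : 0 < t) (hC : 0 ≤ C)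
    (hM : ∀ t y : ℝ, 0 < t → 0 < y →
      ∫⁻ x in Ioi (0 : ℝ), ENNReal.ofReal (x ^ (α + m)) * heatAngle α t y x ≤
        ENNReal.ofReal (M * y ^ (m - 1)))
    {p : ℝ → ℂ} (hpm : Measurable p) (hp : ∀ s, 0 ≤ s → ‖p s‖ ≤ C * heatProfile α t s) :
    KernelBound m m (C * M) (profileKernel α p) := by
  refine ⟨measurable_profileKernel α hpm, fun y hy => ?_⟩
  have h : ∀ x ∈ Ioi (0 : ℝ), ENNReal.ofReal (x ^ m) * ‖profileKernel α p x y‖ₑ ≤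
      ENNReal.ofReal (C * y) * (ENNReal.ofReal (x ^ (α + m)) * heatAngle α t y x) := by
    intro x (hx : 0 < x)
    grw [enorm_profileKernel_le hα ht hp hx hy]
    rw [Real.rpow_add hx, ENNReal.ofReal_mul (p := x ^ α) (by positivity), heatAngle_comm]
    refine le_of_eq ?_
    ring
  grw [setLIntegral_mono' measurableSet_Ioi h]
  rw [lintegral_const_mul' _ _ ENNReal.ofReal_ne_top]
  grw [hM t y ht hy]
  rw [← ENNReal.ofReal_mul (by positivity), Real.rpow_sub_one hy.ne']
  refine ENNReal.ofReal_le_ofReal (le_of_eq ?_)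
  field_simp

/-! ### The Gaussian transform -/

/-- The weight `x exp (-a x²)`. -/
def gaussWeight (a x : ℝ) : ℝ := x * Real.exp (-a * x ^ 2)

/-- The pairing with `x exp (-a x²)`, a Laplace transform in the variable `x²`. -/
def gaussTransform (a : ℝ) (f : ℝ → ℂ) : ℂ := pair (gaussWeight a) f

@[fun_prop]
theorem measurable_gaussWeight (a : ℝ) : Measurable (gaussWeight a) := by
  unfold gaussWeight; fun_prop

theorem exists_rpow_mul_gaussian_le {p : ℝ} (hp : 0 ≤ p) :
    ∃ B : ℝ, 0 < B ∧ ∀ a x : ℝ, 0 < a → 0 < x →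
      x ^ p * Real.exp (-a * x ^ 2) ≤ B * a ^ (-(p / 2)) := by
  obtain ⟨B, hB0, hB⟩ := exists_rpow_mul_exp_neg_le (by linarith : 0 ≤ p / 2)
  refine ⟨B, hB0, fun a x ha hx => ?_⟩
  have h1 := hB (a * x ^ 2) (by positivity)
  have h2 : (a * x ^ 2) ^ (p / 2) = a ^ (p / 2) * x ^ p := by
    rw [Real.mul_rpow ha.le (by positivity), ← Real.rpow_natCast, ← Real.rpow_mul hx.le]
    congr 2
    push_cast; ring
  rw [Real.rpow_neg ha.le, ← div_eq_mul_inv, le_div_iff₀ (Real.rpow_pos_of_pos ha _),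
    neg_mul]
  rw [h2] at h1
  linarith

/-- Near zero the weight is of order x^{q+1}, which is dominated by x^m because m ≤ 1; this is where
the upper bound on m makes the Gaussian transform continuous on X_m. The power of a comes from
scaling. -/
theorem exists_abs_rpow_mul_gaussWeight_le {m q : ℝ} (hm : m ≤ 1) (hq : 0 ≤ q) :
    ∃ B : ℝ, 0 < B ∧ ∀ a x : ℝ, 0 < a → 0 < x →
      |x ^ q * gaussWeight a x| ≤ B * a ^ (-((1 - m + q) / 2)) * x ^ m := by
  obtain ⟨B, hB0, hB⟩ := exists_rpow_mul_gaussian_le (p := 1 - m + q) (by linarith)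
  refine ⟨B, hB0, fun a x ha hx => ?_⟩
  have h : x ^ q * gaussWeight a x = x ^ (1 - m + q) * Real.exp (-a * x ^ 2) * x ^ m := by
    rw [gaussWeight, mul_right_comm, ← Real.rpow_add hx, ← mul_assoc, ← Real.rpow_add_one hx.ne']
    congr 2; ring
  rw [h, abs_of_pos (by positivity)]
  have := hB a x ha hx
  gcongr

theorem exists_abs_gaussWeight_le {m : ℝ} (hm : m ≤ 1) :
    ∃ B : ℝ, 0 < B ∧ ∀ a x : ℝ, 0 < a → 0 < x →
      |gaussWeight a x| ≤ B * a ^ (-((1 - m) / 2)) * x ^ m := by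
  simpa using exists_abs_rpow_mul_gaussWeight_le hm le_rfl

/-- The factor x^α of the kernel completes x e^{-a x²} to x^{α+1} e^{-a x²}, the radial Gaussian in
dimension α + 2, so that `lintegral_gaussian_heatAngle` applies. -/
theorem integral_gaussWeight_heat {α a t y : ℝ} (hα : 0 < α) (ha : 0 ≤ a) (ht : 0 < t) :
    ∫ x in Ioi (0 : ℝ), gaussWeight a x •
        profileKernel α (fun s => (heatProfile α t s : ℂ)) x y =
      (((1 + 4 * a * t) ^ (-halfDim α) * gaussWeight (a / (1 + 4 * a * t)) y : ℝ) : ℂ) := by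
  have h1 : ∀ x ∈ Ioi (0 : ℝ), gaussWeight a x •
      profileKernel α (fun s => (heatProfile α t s : ℂ)) x y =
        ((y * (ENNReal.ofReal (x ^ (α + 1) * Real.exp (-a * x ^ 2)) *
          heatAngle α t y x).toReal : ℝ) : ℂ) := by
    intro x (hx : 0 < x)
    rw [profileKernel_heatProfile hα ht, ENNReal.toReal_mul,
      ENNReal.toReal_ofReal (by positivity), heatAngle_comm, Complex.real_smul,
      ← Complex.ofReal_mul, gaussWeight, Real.rpow_add_one hx.ne']
    congr 1
    ring
  rw [setIntegral_congr_fun measurableSet_Ioi h1, integral_complex_ofReal, integral_const_mul,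
    integral_toReal]
  · rw [lintegral_gaussian_heatAngle hα ha ht, ENNReal.toReal_ofReal (by positivity), gaussWeight]
    congr 1
    ring
  · refine Measurable.aemeasurable ?_
    have : Measurable fun x => heatAngle α t y x :=
      (measurable_heatAngle α).comp (by fun_prop : Measurable fun x : ℝ => (t, y, x))
    fun_prop
  · refine Eventually.of_forall fun x => ?_
    rw [heatAngle_eq_ofReal hα ht]
    exact ENNReal.mul_lt_top ENNReal.ofReal_lt_top ENNReal.ofReal_lt_top

/-! ### The heat operators -/

/-- The Gaussian profile of the heat kernel at complex time `z`. -/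
def heatProfileC (α : ℝ) (z : ℂ) (s : ℝ) : ℂ :=
  (heatConst α : ℂ)⁻¹ * (4 * z) ^ (-(halfDim α : ℂ)) * Complex.exp (-(s / (4 * z)))

theorem continuous_heatProfileC (α : ℝ) (z : ℂ) : Continuous (heatProfileC α z) := by
  unfold heatProfileC; fun_prop

theorem heatProfileC_ofReal {α t : ℝ} (ht : 0 < t) (s : ℝ) :
    heatProfileC α t s = (heatProfile α t s : ℂ) := by
  rw [heatProfileC, heatProfile]
  push_cast
  rw [Complex.ofReal_cpow (by positivity)]
  push_cast
  rfl

/-- Since Re(1/z) = Re z / |z|², the modulus of the Gaussian at time z is a Gaussian at the real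
time |z|²/Re z; the remaining factor compares the normalisations. -/
theorem norm_heatProfileC {α : ℝ} (hα : 0 < α) {z : ℂ} (hz : 0 < z.re) (s : ℝ) :
    ‖heatProfileC α z s‖ =
      (‖z‖ / z.re) ^ halfDim α * heatProfile α (‖z‖ ^ 2 / z.re) s := by
  have hz0 : z ≠ 0 := fun h => by simp [h] at hz
  have hn : 0 < ‖z‖ := norm_pos_iff.2 hz0
  have h1 : ‖(4 * z) ^ (-(halfDim α : ℂ))‖ = (4 * ‖z‖) ^ (-halfDim α) := by
    rw [← Complex.ofReal_neg, Complex.norm_cpow_of_ne_zero (by simpa using hz0)]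
    simp
  have h2 : ‖Complex.exp (-(s / (4 * z)))‖ = Real.exp (-(s / (4 * (‖z‖ ^ 2 / z.re)))) := by
    rw [Complex.norm_exp]
    congr 1
    have : ((s : ℂ) / (4 * z)).re = s / 4 * (z⁻¹).re := by
      rw [← Complex.re_ofReal_mul]
      congr 1
      push_cast
      field_simp
    rw [Complex.neg_re, this, Complex.inv_re, Complex.normSq_eq_norm_sq]
    field_simp
  have h3 := heatConst_pos hα
  rw [heatProfileC, norm_mul, norm_mul, h1, h2, heatProfile, norm_inv, Complex.norm_real,
    Real.norm_of_nonneg h3.le]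
  have h4 : 4 * (‖z‖ ^ 2 / z.re) = (4 * ‖z‖) * (‖z‖ / z.re) := by ring
  rw [show (4 * (‖z‖ ^ 2 / z.re)) ^ (-halfDim α) =
    (4 * ‖z‖) ^ (-halfDim α) * (‖z‖ / z.re) ^ (-halfDim α) by
      rw [h4, Real.mul_rpow (by positivity) (by positivity)],
    Real.rpow_neg (by positivity : 0 ≤ ‖z‖ / z.re)]
  have : (‖z‖ / z.re) ^ halfDim α ≠ 0 := (Real.rpow_pos_of_pos (by positivity) _).ne'
  field_simp

/-- The heat operators on `X m`, for complex times. -/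
def heatOp (α m : ℝ) (z : ℂ) : X m →L[ℂ] X m :=
  if z = 0 then ContinuousLinearMap.id ℂ (X m)
  else kerOp m (profileKernel α (heatProfileC α z))

theorem heatOp_zero (α m : ℝ) : heatOp α m 0 = ContinuousLinearMap.id ℂ (X m) := if_pos rfl

theorem heatOp_of_re_pos (α m : ℝ) {z : ℂ} (hz : 0 < z.re) :
    heatOp α m z = kerOp m (profileKernel α (heatProfileC α z)) :=
  if_neg fun h => by simp [h] at hz

theorem kernelBound_heat {α m M : ℝ} (hα : 0 < α)
    (hM : ∀ t y : ℝ, 0 < t → 0 < y →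
      ∫⁻ x in Ioi (0 : ℝ), ENNReal.ofReal (x ^ (α + m)) * heatAngle α t y x ≤
        ENNReal.ofReal (M * y ^ (m - 1))) {z : ℂ} (hz : 0 < z.re) :
    KernelBound m m ((‖z‖ / z.re) ^ halfDim α * M) (profileKernel α (heatProfileC α z)) := by
  have hn : 0 < ‖z‖ := norm_pos_iff.2 fun h => by simp [h] at hz
  exact kernelBound_profileKernel hα (t := ‖z‖ ^ 2 / z.re) (by positivity) (by positivity) hM
    (continuous_heatProfileC α z).measurable fun s _ => (norm_heatProfileC hα hz s).le

/-- Fubini moves the heat kernel onto the Gaussian weight. Under the transform the semigroup becomes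
transport along a ↦ a/(1+4at) with a scalar factor. -/
theorem gaussTransform_heatOp {α m : ℝ} (hα : 0 < α) (hm : -1 - α < m) (hm1 : m ≤ 1)
    {a t : ℝ} (ha : 0 < a) (ht : 0 ≤ t) (f : X m) :
    gaussTransform a (heatOp α m t f) =
      ((1 + 4 * a * t) ^ (-halfDim α) : ℝ) * gaussTransform (a / (1 + 4 * a * t)) f := by
  rcases ht.eq_or_lt with rfl | ht
  · simp [heatOp_zero]
  obtain ⟨M, hM0, -, hM⟩ := exists_moment_bound hα hm hm1
  have hz : 0 < (t : ℂ).re := ht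
  have hn : 0 < ‖(t : ℂ)‖ := norm_pos_iff.2 fun h => by simp [h] at hz
  have hb := kernelBound_heat hα hM hz
  obtain ⟨B, -, hB⟩ := exists_abs_gaussWeight_le hm1
  rw [heatOp_of_re_pos α m hz, gaussTransform, pair_congr (hb.kerOp_ae (by positivity) f),
    hb.pair_kerFun (Lp.memLp f) (measurable_gaussWeight a) (fun x hx => hB a x ha hx),
    gaussTransform, pair, ← integral_const_mul]
  refine integral_congr_ae (Eventually.of_forall fun y => ?_)
  have e : heatProfileC α (t : ℂ) = fun s => (heatProfile α t s : ℂ) :=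
    funext fun s => heatProfileC_ofReal ht s
  simp only [e]
  rw [integral_gaussWeight_heat hα ha.le ht, Complex.real_smul]
  push_cast
  ring

/-! ### Injectivity of the Gaussian transform -/

theorem exists_pos_forall_lt_notMem {φ : ℝ → ℝ} (hc : HasCompactSupport φ)
    (hs : tsupport φ ⊆ Ioi 0) :
    ∃ a b : ℝ, 0 < a ∧ a < b ∧ tsupport φ ⊆ Icc a b := by
  rcases (tsupport φ).eq_empty_or_nonempty with h | h
  · exact ⟨1, 2, one_pos, one_lt_two, by simp [h]⟩
  · obtain ⟨a, ha, hal⟩ := hc.exists_isLeast h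
    obtain ⟨b, hb, hbl⟩ := hc.exists_isGreatest h
    exact ⟨a, b + 1, hs ha, by linarith [hal hb], fun x hx => ⟨hal hx, by linarith [hbl hx]⟩⟩

/-- Weierstrass approximation in the variable u = e^{-x²} ∈ [0, 1]. The error is relative to the
weight x e^{-x²}, so it can be integrated against f. -/
theorem exists_polynomial_gaussWeight_near {φ : ℝ → ℝ} (hφ : Continuous φ)
    (hc : HasCompactSupport φ) (hs : tsupport φ ⊆ Ioi 0) {ε : ℝ} (hε : 0 < ε) :
    ∃ P : Polynomial ℝ, ∀ x, 0 < x →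
      |gaussWeight 1 x * P.eval (Real.exp (-x ^ 2)) - φ x| ≤ ε * gaussWeight 1 x := by
  obtain ⟨a, b, ha, hab, hsub⟩ := exists_pos_forall_lt_notMem hc hs
  have h0 : ∀ x, x ∉ Icc a b → φ x = 0 := fun x hx =>
    image_eq_zero_of_notMem_tsupport fun h => hx (hsub h)
  -- This is φ divided by `gaussWeight 1`; the denominator max x a equals x on the support and keeps
  -- ψ continuous on the whole line.
  set ψ : ℝ → ℝ := fun x => φ x * Real.exp (x ^ 2) / max x a with hψ
  have hψc : Continuous ψ :=
    (hφ.mul (by fun_prop)).div (by fun_prop) fun x => (lt_max_of_lt_right ha).ne'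
  have hcont : ContinuousOn (fun u => ψ (Real.sqrt (-Real.log u))) (Icc 0 1) := by
    intro u hu
    rcases hu.1.eq_or_lt with rfl | hu0
    · have e : (fun u => ψ (Real.sqrt (-Real.log u))) =ᶠ[𝓝[Icc 0 1] 0] fun _ => 0 := by
        have : Iio (Real.exp (-b ^ 2)) ∈ 𝓝[Icc (0 : ℝ) 1] 0 :=
          mem_nhdsWithin_of_mem_nhds (Iio_mem_nhds (Real.exp_pos _))
        filter_upwards [this, self_mem_nhdsWithin] with u hu hu'
        rcases hu'.1.eq_or_lt with rfl | hu0
        -- As `Real.log 0 = 0`, the value at u = 0 is ψ(0) and not a limit at infinity; it vanishes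
        -- because the support of φ lies to the right of a > 0.
        · simp only [Real.log_zero, neg_zero, Real.sqrt_zero, hψ]
          rw [h0 0 (fun h => absurd h.1 (not_le.2 ha))]
          simp
        · have h1 : Real.log u < -b ^ 2 := (Real.log_lt_iff_lt_exp hu0).2 hu
          have h2 : b < Real.sqrt (-Real.log u) :=
            Real.lt_sqrt_of_sq_lt (by linarith)
          simp only [hψ]
          rw [h0 _ (fun h => absurd h.2 (not_le.2 h2))]
          simp
      refine ContinuousWithinAt.congr_of_eventuallyEq continuousWithinAt_const e ?_
      exact e.self_of_nhdsWithin (by simp)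
    · exact (hψc.continuousAt.comp (Real.continuous_sqrt.continuousAt.comp
        (Real.continuousAt_log hu0.ne').neg)).continuousWithinAt
  obtain ⟨P, hP⟩ := exists_polynomial_near_of_continuousOn 0 1 _ hcont ε hε
  refine ⟨P, fun x hx => ?_⟩
  have h1 := (hP (Real.exp (-x ^ 2)) ⟨(Real.exp_pos _).le,
    Real.exp_le_one_iff.2 (by nlinarith)⟩).le
  rw [Real.log_exp, neg_neg, Real.sqrt_sq hx.le] at h1
  have hg : 0 < gaussWeight 1 x := mul_pos hx (Real.exp_pos _)
  have h2 : φ x = gaussWeight 1 x * ψ x := by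
    by_cases hx' : x ∈ Icc a b
    · simp only [hψ, gaussWeight, max_eq_left hx'.1]
      rw [neg_one_mul, Real.exp_neg]
      field_simp
    · simp only [hψ]
      rw [h0 x hx']
      simp
  rw [h2, ← mul_sub, abs_mul, abs_of_pos hg, mul_comm]
  gcongr

/-- The weight x e^{-x²} times a polynomial in e^{-x²} is a combination of the weights `gaussWeight
(1 + i)`, against which f integrates to zero; these combinations approximate φ. -/
theorem pair_eq_zero_of_gaussTransform_eq_zero {m : ℝ} (hm : m ≤ 1) {f : ℝ → ℂ}
    (hf : MemLp f 1 (weight m)) (h : ∀ a, 0 < a → gaussTransform a f = 0)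
    {φ : ℝ → ℝ} (hφ : Continuous φ) (hc : HasCompactSupport φ) (hs : tsupport φ ⊆ Ioi 0)
    (hφi : Integrable (fun x => φ x • f x) (volume.restrict (Ioi 0))) :
    pair φ f = 0 := by
  obtain ⟨B, -, hB⟩ := exists_abs_gaussWeight_le hm
  have hi : ∀ a, 0 < a → Integrable (fun x => gaussWeight a x • f x) (volume.restrict (Ioi 0)) :=
    fun a ha => integrable_pair (measurable_gaussWeight a) (fun x hx => hB a x ha hx) hf
  have hP : ∀ P : Polynomial ℝ,
      Integrable (fun x => (gaussWeight 1 x * P.eval (Real.exp (-x ^ 2))) • f x)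
        (volume.restrict (Ioi 0)) ∧
      ∫ x in Ioi (0 : ℝ), (gaussWeight 1 x * P.eval (Real.exp (-x ^ 2))) • f x = 0 := by
    intro P
    have e : (fun x => (gaussWeight 1 x * P.eval (Real.exp (-x ^ 2))) • f x) =
        fun x => ∑ i ∈ Finset.range (P.natDegree + 1),
          P.coeff i • (gaussWeight (1 + i) x • f x) := by
      funext x
      rw [Polynomial.eval_eq_sum_range, Finset.mul_sum, Finset.sum_smul]
      refine Finset.sum_congr rfl fun i _ => ?_
      rw [smul_smul, ← Real.exp_nat_mul, gaussWeight, gaussWeight]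
      congr 1
      rw [show -(1 + (i : ℝ)) * x ^ 2 = -1 * x ^ 2 + i * -x ^ 2 by ring, Real.exp_add]
      ring
    rw [e]
    have hi' : ∀ i ∈ Finset.range (P.natDegree + 1), Integrable
        (fun x => P.coeff i • (gaussWeight (1 + i) x • f x)) (volume.restrict (Ioi 0)) :=
      fun i _ => (hi (1 + i) (by positivity)).fun_smul _
    refine ⟨integrable_finsetSum _ hi', ?_⟩
    rw [integral_finsetSum _ hi']
    refine Finset.sum_eq_zero fun i _ => ?_
    rw [integral_smul]
    have := h (1 + i) (by positivity)
    rw [gaussTransform, pair] at this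
    rw [this, smul_zero]
  set I : ℝ := ∫ x in Ioi (0 : ℝ), ‖gaussWeight 1 x • f x‖ with hI
  have hI0 : 0 ≤ I := integral_nonneg fun x => norm_nonneg _
  have key : ∀ ε : ℝ, 0 < ε → ‖pair φ f‖ ≤ ε * I := by
    intro ε hε
    obtain ⟨P, hPn⟩ := exists_polynomial_gaussWeight_near hφ hc hs hε
    have e : pair φ f = -∫ x in Ioi (0 : ℝ),
        (gaussWeight 1 x * P.eval (Real.exp (-x ^ 2)) - φ x) • f x := by
      simp only [sub_smul]
      rw [integral_sub (hP P).1 hφi, (hP P).2, pair]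
      ring
    rw [e, norm_neg, hI, ← integral_const_mul]
    refine (norm_integral_le_integral_norm _).trans ?_
    refine integral_mono_of_nonneg (Eventually.of_forall fun x => norm_nonneg _)
      ((hi 1 one_pos).norm.const_mul ε) ?_
    filter_upwards [ae_restrict_mem measurableSet_Ioi] with x (hx : 0 < x)
    have hg : 0 < gaussWeight 1 x := mul_pos hx (Real.exp_pos _)
    rw [norm_smul, norm_smul, Real.norm_of_nonneg hg.le, ← mul_assoc]
    gcongr
    exact hPn x hx
  rw [← norm_le_zero_iff]
  refine le_of_forall_pos_le_add fun δ hδ => ?_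
  refine (key (δ / (I + 1)) (by positivity)).trans ?_
  rw [zero_add, div_mul_eq_mul_div, div_le_iff₀ (by positivity)]
  nlinarith

theorem locallyIntegrableOn_of_memLp_weight {m : ℝ} {f : ℝ → ℂ} (hf : MemLp f 1 (weight m)) :
    LocallyIntegrableOn f (Ioi 0) := by
  have h := locallyIntegrableOn_X (hf.toLp f)
  rw [locallyIntegrableOn_iff isOpen_Ioi.isLocallyClosed] at h ⊢
  intro K hK hKc
  exact (h K hK hKc).congr (ae_restrict_of_ae_restrict_of_subset hK
    ((restrict_ac_weight m).ae_eq hf.coeFn_toLp))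

theorem ae_eq_of_pair_eq {m : ℝ} {f g : ℝ → ℂ} (hf : MemLp f 1 (weight m))
    (hg : MemLp g 1 (weight m))
    (h : ∀ φ : ℝ → ℝ, ContDiff ℝ ∞ φ → HasCompactSupport φ → tsupport φ ⊆ Ioi 0 →
      pair φ (f - g) = 0) :
    f =ᵐ[volume.restrict (Ioi 0)] g := by
  have hl := locallyIntegrableOn_of_memLp_weight (hf.sub hg)
  have h0 := isOpen_Ioi.ae_eq_zero_of_integral_contDiff_smul_eq_zero hl (by
    intro φ h1 h2 h3
    have hs : ∀ x, x ∉ Ioi (0 : ℝ) → φ x • (f - g) x = 0 := fun x hx => by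
      simp [image_eq_zero_of_notMem_tsupport (fun hn => hx (h3 hn))]
    rw [← setIntegral_eq_integral_of_forall_compl_eq_zero hs]
    exact h φ h1 h2 h3)
  refine (ae_restrict_iff' measurableSet_Ioi).2 ?_
  filter_upwards [h0] with x hx hx0
  exact sub_eq_zero.1 (hx hx0)

theorem integrable_gaussWeight_smul {m a : ℝ} (hm : m ≤ 1) (ha : 0 < a) {f : ℝ → ℂ}
    (hf : MemLp f 1 (weight m)) :
    Integrable (fun x => gaussWeight a x • f x) (volume.restrict (Ioi 0)) := by
  obtain ⟨B, -, hB⟩ := exists_abs_gaussWeight_le hm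
  exact integrable_pair (measurable_gaussWeight a) (fun x hx => hB a x ha hx) hf

theorem gaussTransform_sub {m a : ℝ} (hm : m ≤ 1) (ha : 0 < a) {f g : ℝ → ℂ}
    (hf : MemLp f 1 (weight m)) (hg : MemLp g 1 (weight m)) :
    gaussTransform a (f - g) = gaussTransform a f - gaussTransform a g := by
  simp only [gaussTransform, pair, Pi.sub_apply, smul_sub]
  exact integral_sub (integrable_gaussWeight_smul hm ha hf) (integrable_gaussWeight_smul hm ha hg)

theorem ae_eq_of_gaussTransform_eq {m : ℝ} (hm : m ≤ 1) {f g : ℝ → ℂ}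
    (hf : MemLp f 1 (weight m)) (hg : MemLp g 1 (weight m))
    (h : ∀ a, 0 < a → gaussTransform a f = gaussTransform a g) :
    f =ᵐ[volume.restrict (Ioi 0)] g := by
  refine ae_eq_of_pair_eq hf hg fun φ h1 h2 h3 => ?_
  refine pair_eq_zero_of_gaussTransform_eq_zero hm (hf.sub hg) (fun a ha => ?_) h1.continuous h2 h3
    (integrable_test_right (locallyIntegrableOn_of_memLp_weight (hf.sub hg)) h1 h2 h3)
  rw [gaussTransform_sub hm ha hf hg, h a ha, sub_self]

theorem X_ext_gaussTransform {m : ℝ} (hm : m ≤ 1) {f g : X m}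
    (h : ∀ a, 0 < a → gaussTransform a f = gaussTransform a g) : f = g :=
  X_ext (ae_eq_of_gaussTransform_eq hm (Lp.memLp f) (Lp.memLp g) h)

theorem exists_gaussTransform_clm {m a : ℝ} (hm : m ≤ 1) (ha : 0 < a) :
    ∃ L : X m →L[ℂ] ℂ, ∀ f : X m, L f = gaussTransform a f := by
  obtain ⟨B, hB0, hB⟩ := exists_abs_gaussWeight_le hm
  exact exists_pair_clm (measurable_gaussWeight a) (C := B * a ^ (-((1 - m) / 2)))
    (by positivity) (fun x hx => hB a x ha hx)

/-! ### The semigroup law for real times -/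

/-- The maps a ↦ a/(1+4at) compose additively in t, since 1/a is shifted by 4t, and the prefactors
multiply accordingly. Injectivity of the transform does the rest. -/
theorem heatOp_add_ofReal {α m : ℝ} (hα : 0 < α) (hm : -1 - α < m) (hm1 : m ≤ 1)
    {s t : ℝ} (hs : 0 ≤ s) (ht : 0 ≤ t) :
    heatOp α m ((s : ℂ) + t) = (heatOp α m s).comp (heatOp α m t) := by
  ext1 f
  refine X_ext_gaussTransform hm1 fun a ha => ?_
  have h1 : 0 < 1 + 4 * a * s := by positivity
  have h2 : 0 < 1 + 4 * a * (s + t) := by positivity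
  rw [← Complex.ofReal_add, gaussTransform_heatOp hα hm hm1 ha (by positivity),
    ContinuousLinearMap.comp_apply, gaussTransform_heatOp hα hm hm1 ha hs,
    gaussTransform_heatOp hα hm hm1 (by positivity) ht, ← mul_assoc, ← Complex.ofReal_mul]
  have e : 1 + 4 * (a / (1 + 4 * a * s)) * t = (1 + 4 * a * (s + t)) / (1 + 4 * a * s) := by
    field_simp; ring
  have e2 : a / (1 + 4 * a * s) / ((1 + 4 * a * (s + t)) / (1 + 4 * a * s)) =
      a / (1 + 4 * a * (s + t)) := by field_simp
  rw [e, e2, ← Real.mul_rpow h1.le (by positivity), mul_div_cancel₀ _ h1.ne']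

/-! ### Analyticity -/

/-- A second order Taylor estimate for bounded holomorphic functions on a ball. -/
theorem norm_sub_sub_deriv_le {f : ℂ → ℂ} {c : ℂ} {R M : ℝ}
    (hf : DifferentiableOn ℂ f (Metric.ball c R)) (hR : 0 < R)
    (hM : ∀ z ∈ Metric.ball c R, ‖f z‖ ≤ M) :
    ‖deriv f c‖ ≤ 2 * M / R ∧ ∀ z ∈ Metric.ball c R,
      ‖f z - f c - (z - c) * deriv f c‖ ≤ 4 * M / R / R * ‖z - c‖ ^ 2 := by
  have hc : c ∈ Metric.ball c R := Metric.mem_ball_self hR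
  have h1 : MapsTo f (Metric.ball c R) (Metric.closedBall (f c) (2 * M)) := fun z hz => by
    rw [Metric.mem_closedBall, dist_eq_norm]
    linarith [norm_sub_le (f z) (f c), hM z hz, hM c hc]
  have h2 : ∀ z ∈ Metric.ball c R, ‖dslope f c z‖ ≤ 2 * M / R := fun z hz =>
    Complex.norm_dslope_le_div_of_mapsTo_ball hf h1 hz
  have hd := h2 c hc
  rw [dslope_same] at hd
  refine ⟨hd, fun z hz => ?_⟩
  have h3 : DifferentiableOn ℂ (dslope f c) (Metric.ball c R) :=
    (Complex.differentiableOn_dslope (Metric.ball_mem_nhds c hR)).2 hf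
  have h4 : MapsTo (dslope f c) (Metric.ball c R)
      (Metric.closedBall (dslope f c c) (4 * M / R)) := fun w hw => by
    rw [Metric.mem_closedBall, dist_eq_norm]
    have : 4 * M / R = 2 * M / R + 2 * M / R := by ring
    linarith [norm_sub_le (dslope f c w) (dslope f c c), h2 w hw, h2 c hc]
  have h5 := Complex.dist_le_div_mul_dist_of_mapsTo_ball h3 h4 hz
  rw [dist_eq_norm, dist_eq_norm, dslope_same] at h5
  have h6 : f z - f c - (z - c) * deriv f c = (z - c) * (dslope f c z - deriv f c) := by
    rw [mul_sub, ← smul_eq_mul (z - c) (dslope f c z), sub_smul_dslope]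
  rw [h6, norm_mul]
  calc _ ≤ ‖z - c‖ * (4 * M / R / R * ‖z - c‖) := by gcongr
    _ = _ := by ring

/-- Enlarging the time only increases the exponential, so the comparison costs no more than the
ratio of the normalisations. -/
theorem heatProfile_le {α t τ s : ℝ} (hα : 0 < α) (ht : 0 < t) (htτ : t ≤ τ) (hs : 0 ≤ s) :
    heatProfile α t s ≤ (τ / t) ^ halfDim α * heatProfile α τ s := by
  have hC := heatConst_pos hα
  have hτ : 0 < τ := ht.trans_le htτ
  have e : (4 * t) ^ (-halfDim α) = (τ / t) ^ halfDim α * (4 * τ) ^ (-halfDim α) := by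
    have : 4 * τ = τ / t * (4 * t) := by field_simp
    rw [this, Real.mul_rpow (x := τ / t) (by positivity) (by positivity), ← mul_assoc,
      ← Real.rpow_add (by positivity), add_neg_cancel, Real.rpow_zero, one_mul]
  rw [heatProfile, heatProfile, e]
  have h1 : Real.exp (-(s / (4 * t))) ≤ Real.exp (-(s / (4 * τ))) := by
    refine Real.exp_le_exp.2 (neg_le_neg ?_)
    gcongr
  calc _ ≤ (heatConst α)⁻¹ * ((τ / t) ^ halfDim α * (4 * τ) ^ (-halfDim α)) *
        Real.exp (-(s / (4 * τ))) := by gcongr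
    _ = _ := by ring

/-- A single real time τ dominates all complex times near c, as needed for Cauchy-type estimates
that are uniform in s. -/
theorem exists_norm_heatProfileC_le {α : ℝ} (hα : 0 < α) {c : ℂ} (hc : 0 < c.re) :
    ∃ C τ : ℝ, 0 < C ∧ 0 < τ ∧ ∀ z ∈ Metric.ball c (c.re / 2), 0 < z.re ∧
      ∀ s, 0 ≤ s → ‖heatProfileC α z s‖ ≤ C * heatProfile α τ s := by
  have hn : 0 < ‖c‖ := norm_pos_iff.2 fun h => by simp [h] at hc
  -- On the ball ‖z‖ ≤ 2‖c‖ and Re z > Re c / 2, hence ‖z‖²/Re z ≤ 8‖c‖²/Re c, which is the choice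
  -- of τ.
  refine ⟨(2 * (8 * ‖c‖ ^ 2 / c.re) / c.re) ^ halfDim α, 8 * ‖c‖ ^ 2 / c.re, by positivity,
    by positivity, fun z hz => ?_⟩
  set τ := 8 * ‖c‖ ^ 2 / c.re with hτ
  have hτ0 : 0 < τ := by positivity
  rw [Metric.mem_ball, dist_eq_norm] at hz
  have h1 : c.re / 2 < z.re := by
    have := (Complex.abs_re_le_norm (z - c)).trans_lt hz
    rw [Complex.sub_re, abs_lt] at this
    linarith
  have hz0 : 0 < z.re := by linarith
  have h2 : z.re ≤ ‖z‖ := (le_abs_self _).trans (Complex.abs_re_le_norm z)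
  have h3 : ‖z‖ ≤ 2 * ‖c‖ := by
    have h := norm_add_le (z - c) c
    rw [sub_add_cancel] at h
    have : c.re ≤ ‖c‖ := (le_abs_self _).trans (Complex.abs_re_le_norm c)
    linarith
  have hzn : 0 < ‖z‖ := by linarith
  have h4 : ‖z‖ ^ 2 / z.re ≤ τ := by
    have h5 : ‖z‖ ^ 2 ≤ (2 * ‖c‖) ^ 2 := by gcongr
    rw [hτ, div_le_div_iff₀ hz0 hc]
    nlinarith [sq_nonneg ‖c‖]
  refine ⟨hz0, fun s hs => ?_⟩
  rw [norm_heatProfileC hα hz0]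
  grw [heatProfile_le hα (by positivity) h4 hs]
  rw [← mul_assoc, ← Real.mul_rpow (by positivity) (by positivity)]
  have h6 := (heatProfile_pos hα hτ0 s).le
  gcongr ?_ * _
  refine Real.rpow_le_rpow (by positivity) ?_ (by unfold halfDim; positivity)
  have : ‖z‖ / z.re * (τ / (‖z‖ ^ 2 / z.re)) = τ / ‖z‖ := by field_simp
  rw [this, div_le_div_iff₀ hzn hc]
  nlinarith

theorem exists_hasDerivAt_heatProfileC (α : ℝ) {c : ℂ} (hc : 0 < c.re) :
    ∃ p : ℝ → ℂ, Measurable p ∧ ∀ s, HasDerivAt (fun z => heatProfileC α z s) (p s) c := by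
  have hc0 : c ≠ 0 := fun h => by simp [h] at hc
  have h4 : HasDerivAt (fun z : ℂ => 4 * z) 4 c := by
    simpa using (hasDerivAt_id c).const_mul 4
  have h1 := (h4.cpow_const (c := -(halfDim α : ℂ)) (Or.inl (by simpa using hc))).const_mul
    ((heatConst α : ℂ)⁻¹)
  have h2 : ∀ s : ℝ, HasDerivAt (fun z : ℂ => Complex.exp (-(s / (4 * z))))
      (Complex.exp (-(s / (4 * c))) * (s * 4 / (4 * c) ^ 2)) c := by
    intro s
    refine HasDerivAt.cexp ?_
    refine ((h4.inv (by simpa using hc0)).const_mul (s : ℂ)).neg.congr_deriv ?_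
    ring
  exact ⟨_, by fun_prop, fun s => h1.mul (h2 s)⟩

theorem differentiableAt_heatProfileC (α : ℝ) {c : ℂ} (hc : 0 < c.re) (s : ℝ) :
    DifferentiableAt ℂ (fun z => heatProfileC α z s) c := by
  obtain ⟨p, -, hp⟩ := exists_hasDerivAt_heatProfileC α hc
  exact (hp s).differentiableAt

theorem integrable_profile {α τ C : ℝ} (hα : 0 < α) (hτ : 0 < τ) (hC : 0 ≤ C) {p : ℝ → ℂ}
    (hpm : Measurable p) (hp : ∀ s, 0 ≤ s → ‖p s‖ ≤ C * heatProfile α τ s) (x y : ℝ) :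
    Integrable (fun φ => p (distSq x y φ)) (angMeasure α) := by
  have := isFiniteMeasure_angMeasure hα
  refine Integrable.of_bound (C := C * heatProfile α τ 0) ?_ (Eventually.of_forall fun φ => ?_)
  · exact (hpm.comp (by unfold distSq; fun_prop)).aestronglyMeasurable
  · refine (hp _ (distSq_nonneg x y φ)).trans ?_
    have h1 := heatConst_pos hα
    unfold heatProfile
    gcongr
    exact distSq_nonneg x y φ

theorem kerOp_sub_sub_smul {m C₁ C₂ C₃ C₄ : ℝ} {K₁ K₂ K₃ K₄ : ℝ → ℝ → ℂ}
    (hC₁ : 0 ≤ C₁) (hC₂ : 0 ≤ C₂) (hC₃ : 0 ≤ C₃) (hC₄ : 0 ≤ C₄)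
    (h₁ : KernelBound m m C₁ K₁) (h₂ : KernelBound m m C₂ K₂) (h₃ : KernelBound m m C₃ K₃)
    (h₄ : KernelBound m m C₄ K₄) (c : ℂ)
    (h : ∀ x y, K₄ x y = K₁ x y - K₂ x y - c * K₃ x y) :
    kerOp m K₄ = kerOp m K₁ - kerOp m K₂ - c • kerOp m K₃ := by
  ext1 f
  refine X_ext ?_
  have e := restrict_ac_weight m
  rw [sub_apply, sub_apply,
    smul_apply]
  filter_upwards [e.ae_eq (Lp.coeFn_sub (kerOp m K₁ f - kerOp m K₂ f) (c • kerOp m K₃ f)),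
    e.ae_eq (Lp.coeFn_sub (kerOp m K₁ f) (kerOp m K₂ f)), e.ae_eq (Lp.coeFn_smul c (kerOp m K₃ f)),
    h₁.kerOp_ae hC₁ f, h₂.kerOp_ae hC₂ f, h₃.kerOp_ae hC₃ f, h₄.kerOp_ae hC₄ f,
    h₁.ae_integrable (Lp.memLp f), h₂.ae_integrable (Lp.memLp f),
    h₃.ae_integrable (Lp.memLp f)] with x e1 e2 e3 k1 k2 k3 k4 i1 i2 i3
  rw [e1, Pi.sub_apply, e2, e3, Pi.sub_apply, Pi.smul_apply, k1, k2, k3, k4]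
  simp only [kerFun, smul_eq_mul]
  have i12 : Integrable (fun y => K₁ x y * f y - K₂ x y * f y) (volume.restrict (Ioi 0)) :=
    i1.sub i2
  rw [← integral_sub i1 i2, ← integral_const_mul, ← integral_sub i12 (i3.const_mul c)]
  refine integral_congr_ae (Eventually.of_forall fun y => ?_)
  simp only [h]
  ring

/-- For each s the profile is holomorphic in z and bounded near c by C times the heat profile at τ,
so its second-order Taylor remainder is at most a multiple of ‖z - c‖² times that same profile. The
kernel bound converts this into an operator-norm estimate. -/
theorem differentiableAt_heatOp {α m : ℝ} (hα : 0 < α) (hm : -1 - α < m) (hm1 : m ≤ 1) {c : ℂ}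
    (hc : 0 < c.re) : DifferentiableAt ℂ (heatOp α m) c := by
  obtain ⟨M, hM0, -, hM⟩ := exists_moment_bound hα hm hm1
  obtain ⟨C, τ, hC, hτ, hCτ⟩ := exists_norm_heatProfileC_le hα hc
  obtain ⟨p, hpm, hp⟩ := exists_hasDerivAt_heatProfileC α hc
  set R := c.re / 2 with hR
  have hR0 : 0 < R := by positivity
  have hcb : c ∈ Metric.ball c R := Metric.mem_ball_self hR0
  have htaylor : ∀ s, 0 ≤ s → ‖p s‖ ≤ 2 * C / R * heatProfile α τ s ∧
      ∀ z ∈ Metric.ball c R, ‖heatProfileC α z s - heatProfileC α c s - (z - c) * p s‖ ≤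
        4 * C / R / R * ‖z - c‖ ^ 2 * heatProfile α τ s := by
    intro s hs
    have h := norm_sub_sub_deriv_le (f := fun z => heatProfileC α z s) (c := c)
      (fun z hz => (differentiableAt_heatProfileC α (hCτ z hz).1 s).differentiableWithinAt) hR0
      (fun z hz => (hCτ z hz).2 s hs)
    rw [(hp s).deriv] at h
    refine ⟨h.1.trans_eq (by ring), fun z hz => (h.2 z hz).trans_eq (by ring)⟩
  have hpb := fun s hs => (htaylor s hs).1
  refine HasDerivAt.differentiableAt (f' := kerOp m (profileKernel α p)) ?_
  rw [hasDerivAt_iff_isLittleO]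
  refine Asymptotics.IsBigO.trans_isLittleO (g := fun z => ‖z - c‖ ^ 2) ?_ ?_
  · refine Asymptotics.IsBigO.of_bound (4 * C / R / R * M) ?_
    filter_upwards [Metric.ball_mem_nhds c hR0] with z hz
    have b1 := kernelBound_profileKernel hα hτ hC.le hM
      (continuous_heatProfileC α z).measurable (hCτ z hz).2
    have b2 := kernelBound_profileKernel hα hτ hC.le hM
      (continuous_heatProfileC α c).measurable (hCτ c hcb).2
    have b3 := kernelBound_profileKernel hα hτ (by positivity : 0 ≤ 2 * C / R) hM hpm hpb
    have b4 := kernelBound_profileKernel hα hτ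
      (by positivity : 0 ≤ 4 * C / R / R * ‖z - c‖ ^ 2) hM
      (p := fun s => heatProfileC α z s - heatProfileC α c s - (z - c) * p s)
      (((continuous_heatProfileC α z).measurable.sub
        (continuous_heatProfileC α c).measurable).sub (hpm.const_mul _))
      (fun s hs => (htaylor s hs).2 z hz)
    rw [heatOp_of_re_pos α m (hCτ z hz).1, heatOp_of_re_pos α m hc,
      ← kerOp_sub_sub_smul (by positivity) (by positivity) (by positivity) (by positivity)
        b1 b2 b3 b4 (z - c)]
    · refine (b4.norm_kerOp_le (by positivity)).trans_eq ?_
      rw [norm_pow, norm_norm]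
      ring
    · intro x y
      have i1 := integrable_profile hα hτ hC.le (continuous_heatProfileC α z).measurable
        (hCτ z hz).2 x y
      have i2 := integrable_profile hα hτ hC.le (continuous_heatProfileC α c).measurable
        (hCτ c hcb).2 x y
      have i3 := integrable_profile hα hτ (by positivity : 0 ≤ 2 * C / R) hpm hpb x y
      have i12 : Integrable (fun φ => heatProfileC α z (distSq x y φ) -
          heatProfileC α c (distSq x y φ)) (angMeasure α) := i1.sub i2
      simp only [profileKernel]
      rw [integral_sub i12 (i3.const_mul _), integral_sub i1 i2, integral_const_mul]
      ring
  · have h1 : (fun z : ℂ => ‖z - c‖ ^ 2) =o[𝓝 c] fun z => z - c := by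
      have h2 : Tendsto (fun z : ℂ => z - c) (𝓝 c) (𝓝 0) := by
        have : Continuous fun z : ℂ => z - c := by fun_prop
        simpa using this.tendsto c
      have h3 := (Asymptotics.isLittleO_norm_pow_id (E' := ℂ) one_lt_two).comp_tendsto h2
      simpa [Function.comp_def] using h3
    exact h1

/-! ### The right half-plane and unique continuation from real to complex times -/

theorem mem_openSector_pi_div_two {z : ℂ} : z ∈ openSector (Real.pi / 2) ↔ 0 < z.re := by
  rw [openSector, mem_ofPred_eq, Complex.abs_arg_lt_pi_div_two_iff]
  constructor
  · rintro ⟨h0, h | h⟩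
    · exact h
    · exact absurd h h0
  · exact fun h => ⟨fun h0 => by simp [h0] at h, Or.inl h⟩

theorem eqOn_re_pos_of_eq_ofReal {F : Type*} [NormedAddCommGroup F] [NormedSpace ℂ F]
    [CompleteSpace F] {f g : ℂ → F} (hf : ∀ z : ℂ, 0 < z.re → DifferentiableAt ℂ f z)
    (hg : ∀ z : ℂ, 0 < z.re → DifferentiableAt ℂ g z) (h : ∀ t : ℝ, 0 < t → f t = g t)
    {z : ℂ} (hz : 0 < z.re) : f z = g z := by
  have ho : IsOpen {z : ℂ | 0 < z.re} := isOpen_lt continuous_const Complex.continuous_re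
  have hc : IsPreconnected {z : ℂ | 0 < z.re} := (convex_halfSpace_re_gt 0).isPreconnected
  have h1 : AnalyticOnNhd ℂ f {z : ℂ | 0 < z.re} := DifferentiableOn.analyticOnNhd
    (fun z hz => (hf z hz).differentiableWithinAt) ho
  have h2 : AnalyticOnNhd ℂ g {z : ℂ | 0 < z.re} := DifferentiableOn.analyticOnNhd
    (fun z hz => (hg z hz).differentiableWithinAt) ho
  refine h1.eqOn_of_preconnected_of_frequently_eq h2 hc (z₀ := 1) (by simp) ?_ hz
  have ht : Tendsto (fun t : ℝ => (t : ℂ)) (𝓝[>] 1) (𝓝[≠] 1) := by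
    refine tendsto_nhdsWithin_iff.2 ⟨?_, ?_⟩
    · have := (Complex.continuous_ofReal.tendsto 1).mono_left
        (nhdsWithin_le_nhds (s := Ioi (1 : ℝ)))
      simpa using this
    · filter_upwards [self_mem_nhdsWithin] with t (ht : 1 < t)
      simp only [mem_compl_iff, mem_singleton_iff]
      norm_cast
      exact ht.ne'
  refine ht.frequently (Eventually.frequently ?_)
  filter_upwards [self_mem_nhdsWithin] with t (ht : 1 < t)
  exact h t (by linarith)

/-- The identity theorem is used twice: first in the second time with the first one real, then in
the first time with the second one complex. -/
theorem heatOp_add {α m : ℝ} (hα : 0 < α) (hm : -1 - α < m) (hm1 : m ≤ 1) {z w : ℂ}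
    (hz : 0 < z.re) (hw : 0 < w.re) :
    heatOp α m (z + w) = (heatOp α m z).comp (heatOp α m w) := by
  have hd : ∀ z : ℂ, 0 < z.re → DifferentiableAt ℂ (heatOp α m) z := fun z hz =>
    differentiableAt_heatOp hα hm hm1 hz
  have h1 : ∀ t : ℝ, 0 < t → ∀ z : ℂ, 0 < z.re →
      heatOp α m (t + z) = (heatOp α m t).comp (heatOp α m z) := by
    intro t ht z hz
    refine eqOn_re_pos_of_eq_ofReal (f := fun z => heatOp α m (t + z))
      (g := fun z => (heatOp α m t).comp (heatOp α m z)) ?_ ?_ ?_ hz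
    · intro z hz
      refine DifferentiableAt.comp z (hd _ ?_) (by fun_prop)
      simpa using add_pos ht hz
    · intro z hz
      exact (differentiableAt_const _).clm_comp (hd z hz)
    · intro s hs
      exact heatOp_add_ofReal hα hm hm1 ht.le hs.le
  refine eqOn_re_pos_of_eq_ofReal (f := fun z => heatOp α m (z + w))
      (g := fun z => (heatOp α m z).comp (heatOp α m w)) ?_ ?_ ?_ hz
  · intro z hz
    refine DifferentiableAt.comp z (hd _ ?_) (by fun_prop)
    simpa using add_pos hz hw
  · intro z hz
    exact (hd z hz).clm_comp (differentiableAt_const _)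
  · exact fun t ht => h1 t ht w hw

/-! ### Boundedness, contractivity and positivity -/

theorem exists_norm_heatOp_le {α m : ℝ} (hα : 0 < α) (hm : -1 - α < m) (hm1 : m ≤ 1) :
    ∃ M : ℝ, 0 < M ∧ (1 - α < m → M = 1) ∧ ∀ z : ℂ, 0 < z.re →
      ‖heatOp α m z‖ ≤ (‖z‖ / z.re) ^ halfDim α * M := by
  obtain ⟨M, hM0, hM1, hM⟩ := exists_moment_bound hα hm hm1
  refine ⟨M, hM0, hM1, fun z hz => ?_⟩
  rw [heatOp_of_re_pos α m hz]
  exact (kernelBound_heat hα hM hz).norm_kerOp_le (by positivity)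

theorem exists_norm_heatOp_ofReal_le {α m : ℝ} (hα : 0 < α) (hm : -1 - α < m) (hm1 : m ≤ 1) :
    ∃ M : ℝ, 0 < M ∧ (1 - α < m → M = 1) ∧ ∀ t : ℝ, 0 < t → ‖heatOp α m t‖ ≤ M := by
  obtain ⟨M, hM0, hM1, hM⟩ := exists_norm_heatOp_le hα hm hm1
  refine ⟨M, hM0, hM1, fun t ht => ?_⟩
  have := hM t (by simpa using ht)
  rwa [Complex.norm_real, Real.norm_of_nonneg ht.le, Complex.ofReal_re, div_self ht.ne',
    Real.one_rpow, one_mul] at this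

/-- The ratio ‖z‖/Re z equals 1/cos(arg z), which is at most 1/cos θ on the sector. -/
theorem exists_norm_heatOp_sector_le {α m : ℝ} (hα : 0 < α) (hm : -1 - α < m) (hm1 : m ≤ 1)
    {θ : ℝ} (hθ : θ ∈ Ioo 0 (Real.pi / 2)) :
    ∃ C : ℝ, ∀ z ∈ openSector θ, ‖heatOp α m z‖ ≤ C := by
  obtain ⟨M, hM0, -, hM⟩ := exists_norm_heatOp_le hα hm hm1
  refine ⟨(1 / Real.cos θ) ^ halfDim α * M, fun z hz => ?_⟩
  have hcos : 0 < Real.cos θ := Real.cos_pos_of_mem_Ioo ⟨by linarith [hθ.1, Real.pi_pos], hθ.2⟩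
  have hn : 0 < ‖z‖ := norm_pos_iff.2 hz.1
  have h1 : Real.cos θ ≤ Real.cos z.arg := by
    rw [← Real.cos_abs z.arg]
    exact Real.cos_le_cos_of_nonneg_of_le_pi (abs_nonneg _) (by linarith [hθ.2, Real.pi_pos])
      hz.2.le
  have h2 : z.re = ‖z‖ * Real.cos z.arg := (Complex.norm_mul_cos_arg z).symm
  have hre : 0 < z.re := by rw [h2]; exact mul_pos hn (hcos.trans_le h1)
  refine (hM z hre).trans ?_
  gcongr ?_ * _
  refine Real.rpow_le_rpow (by positivity) ?_ (by unfold halfDim; positivity)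
  rw [div_le_div_iff₀ hre hcos, h2, one_mul]
  gcongr

theorem isPositiveSemigroup_heatOp {α m : ℝ} (hα : 0 < α) (hm : -1 - α < m) (hm1 : m ≤ 1) :
    IsPositiveSemigroup (heatOp α m) := by
  intro t ht f hf
  rcases ht.eq_or_lt with rfl | ht
  · simpa [heatOp_zero] using hf
  obtain ⟨M, hM0, -, hM⟩ := exists_moment_bound hα hm hm1
  have hz : 0 < (t : ℂ).re := ht
  have hn : 0 < ‖(t : ℂ)‖ := norm_pos_iff.2 fun h => by simp [h] at hz
  have hb := kernelBound_heat hα hM hz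
  have hf' := (restrict_ac_weight m).ae_le hf
  refine (weight_ac_restrict m).ae_le ?_
  rw [heatOp_of_re_pos α m hz]
  filter_upwards [hb.kerOp_ae (by positivity) f, ae_restrict_mem measurableSet_Ioi] with
    x hx (hx0 : 0 < x)
  rw [hx, kerFun]
  refine integral_nonneg_of_ae ?_
  filter_upwards [hf', ae_restrict_mem measurableSet_Ioi] with y hy (hy0 : 0 < y)
  have e : heatProfileC α (t : ℂ) = fun s => (heatProfile α t s : ℂ) :=
    funext fun s => heatProfileC_ofReal ht s
  rw [e, profileKernel_heatProfile hα ht]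
  refine mul_nonneg ?_ hy
  exact Complex.zero_le_real.2 (by positivity)

/-! ### The transformed equation -/

/-- The Bessel equation `f'' + (κ / x) f' = g` with the Dirichlet condition at zero, expressed by
the Gaussian transforms of `f` and `g`. -/
def GaussODE (α : ℝ) (f g : ℝ → ℂ) : Prop :=
  ∀ a : ℝ, 0 < a → ∃ D : ℂ, HasDerivAt (fun b => gaussTransform b f) D a ∧
    gaussTransform a g = -(4 * a * halfDim α : ℝ) * gaussTransform a f - (4 * a ^ 2 : ℝ) * D

theorem abs_sq_mul_gaussWeight_le {m : ℝ} (hm : m ≤ 1) {a : ℝ} (ha : 0 < a) :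
    ∃ C : ℝ, 0 < C ∧ ∀ x, 0 < x → |x ^ 2 * gaussWeight a x| ≤ C * x ^ m := by
  obtain ⟨B, hB0, hB⟩ := exists_abs_rpow_mul_gaussWeight_le hm zero_le_two
  refine ⟨B * a ^ (-((1 - m + 2) / 2)), by positivity, fun x hx => ?_⟩
  simpa using hB a x ha hx

theorem hasDerivAt_gaussTransform {m : ℝ} (hm : m ≤ 1) {f : ℝ → ℂ} (hf : MemLp f 1 (weight m))
    {a : ℝ} (ha : 0 < a) :
    HasDerivAt (fun b => gaussTransform b f)
      (pair (fun x => -(x ^ 2 * gaussWeight a x)) f) a := by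
  obtain ⟨C, hC0, hC⟩ := abs_sq_mul_gaussWeight_le hm (half_pos ha)
  have hfm := (memLp_weight_iff.1 hf).1
  refine (hasDerivAt_integral_of_dominated_loc_of_deriv_le (s := Ioi (a / 2))
    (bound := fun x => ‖(x ^ 2 * gaussWeight (a / 2) x) • f x‖)
    (F := fun b x => gaussWeight b x • f x)
    (F' := fun b x => (-(x ^ 2 * gaussWeight b x)) • f x) (Ioi_mem_nhds (by linarith)) ?_ ?_ ?_ ?_
    ?_ ?_).2
  · exact Eventually.of_forall fun b => (measurable_gaussWeight b).aestronglyMeasurable.smul hfm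
  · exact integrable_gaussWeight_smul hm ha hf
  · have : Measurable fun x => -(x ^ 2 * gaussWeight a x) := by fun_prop
    exact this.aestronglyMeasurable.smul hfm
  · filter_upwards [ae_restrict_mem measurableSet_Ioi] with x (hx : 0 < x) b (hb : a / 2 < b)
    have h1 : 0 < gaussWeight b x := mul_pos hx (Real.exp_pos _)
    have h2 : gaussWeight b x ≤ gaussWeight (a / 2) x := by
      unfold gaussWeight
      gcongr
    rw [norm_smul, norm_smul, norm_neg, Real.norm_of_nonneg (by positivity),
      Real.norm_of_nonneg (mul_nonneg (by positivity) (h1.le.trans h2))]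
    gcongr
  · exact (integrable_pair (by fun_prop) hC hf).norm
  · refine Eventually.of_forall fun x b _ => ?_
    refine HasDerivAt.smul_const ?_ (f x)
    have h1 : HasDerivAt (fun b : ℝ => -b * x ^ 2) (-1 * x ^ 2) b :=
      (hasDerivAt_id b).neg.mul_const _
    refine (h1.exp.const_mul x).congr_deriv ?_
    rw [gaussWeight]; ring

/-- The curve b(s) = a/(1+4as) solves b' = -4b², and the prefactor has logarithmic derivative -4bδ.
The right side of `GaussODE` is therefore the time derivative of the transport. -/
theorem hasDerivAt_transport {δ a t : ℝ} {F : ℝ → ℂ} {D : ℂ} (h : 0 < 1 + 4 * a * t)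
    (hF : HasDerivAt F D (a / (1 + 4 * a * t))) :
    HasDerivAt (fun s : ℝ => (((1 + 4 * a * s) ^ (-δ) : ℝ) : ℂ) * F (a / (1 + 4 * a * s)))
      (((1 + 4 * a * t) ^ (-δ) : ℝ) *
        (-(4 * (a / (1 + 4 * a * t)) * δ : ℝ) * F (a / (1 + 4 * a * t)) -
          (4 * (a / (1 + 4 * a * t)) ^ 2 : ℝ) * D)) t := by
  have h1 : HasDerivAt (fun s : ℝ => 1 + 4 * a * s) (4 * a) t := by
    simpa using ((hasDerivAt_id t).const_mul (4 * a)).const_add 1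
  have h2 : HasDerivAt (fun s : ℝ => a / (1 + 4 * a * s))
      (-(4 * (a / (1 + 4 * a * t)) ^ 2)) t := by
    have := (hasDerivAt_const t a).div h1 h.ne'
    refine this.congr_deriv ?_
    field_simp
    ring
  have h3 := (h1.rpow_const (p := -δ) (Or.inl h.ne')).ofReal_comp
  refine (h3.mul (hF.scomp t h2)).congr_deriv ?_
  rw [Real.rpow_sub_one h.ne', Complex.real_smul, Function.comp_apply]
  push_cast
  have : (1 + 4 * (a : ℂ) * t) ≠ 0 := by exact_mod_cast h.ne'
  field_simp
  ring

theorem GaussODE.hasDerivAt {α : ℝ} {f g : ℝ → ℂ} (h : GaussODE α f g) {a t : ℝ} (ha : 0 < a)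
    (ht : 0 < 1 + 4 * a * t) :
    HasDerivAt (fun s : ℝ => (((1 + 4 * a * s) ^ (-halfDim α) : ℝ) : ℂ) *
        gaussTransform (a / (1 + 4 * a * s)) f)
      (((1 + 4 * a * t) ^ (-halfDim α) : ℝ) * gaussTransform (a / (1 + 4 * a * t)) g) t := by
  obtain ⟨D, hD, e⟩ := h (a / (1 + 4 * a * t)) (by positivity)
  rw [e]
  exact hasDerivAt_transport ht hD

theorem continuousOn_transport {α m : ℝ} (hm : m ≤ 1) {f : ℝ → ℂ} (hf : MemLp f 1 (weight m))
    {a : ℝ} (ha : 0 < a) :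
    ContinuousOn (fun s : ℝ => (((1 + 4 * a * s) ^ (-halfDim α) : ℝ) : ℂ) *
        gaussTransform (a / (1 + 4 * a * s)) f) (Ici 0) := fun s (hs : 0 ≤ s) =>
  (hasDerivAt_transport (by positivity)
    (hasDerivAt_gaussTransform hm hf (by positivity))).continuousAt.continuousWithinAt

/-! ### Orbits of the semigroup -/

section

variable {α m : ℝ}

theorem continuousOn_heatOp_apply (hα : 0 < α) (hm : -1 - α < m) (hm1 : m ≤ 1) (g : X m) :
    ContinuousOn (fun s : ℝ => heatOp α m s g) (Ioi 0) := by
  intro s (hs : 0 < s)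
  have h1 : ContinuousAt (heatOp α m) (s : ℂ) :=
    (differentiableAt_heatOp hα hm hm1 (by simpa using hs)).continuousAt
  have h2 : ContinuousAt (fun s : ℝ => heatOp α m (s : ℂ)) s :=
    ContinuousAt.comp (g := heatOp α m) h1 Complex.continuous_ofReal.continuousAt
  exact (h2.clm_apply continuousAt_const).continuousWithinAt

theorem intervalIntegrable_heatOp_apply (hα : 0 < α) (hm : -1 - α < m) (hm1 : m ≤ 1) (g : X m)
    {t : ℝ} (ht : 0 ≤ t) :
    IntervalIntegrable (fun s : ℝ => heatOp α m s g) volume 0 t := by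
  obtain ⟨M, hM0, -, hM⟩ := exists_norm_heatOp_ofReal_le hα hm hm1
  rw [intervalIntegrable_iff_integrableOn_Ioc_of_le ht]
  refine Integrable.of_bound (C := M * ‖g‖) ?_ ?_
  · exact ((continuousOn_heatOp_apply hα hm hm1 g).mono fun s hs => hs.1).aestronglyMeasurable
      measurableSet_Ioc
  · filter_upwards [ae_restrict_mem measurableSet_Ioc] with s hs
    exact (ContinuousLinearMap.le_opNorm _ _).trans (by gcongr; exact hM s hs.1)

/-- After the transform this is the fundamental theorem of calculus: by `GaussODE` the transported
transform of f has the transported transform of g as its derivative in time. -/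
theorem heatOp_sub_eq_integral (hα : 0 < α) (hm : -1 - α < m) (hm1 : m ≤ 1) {f g : X m}
    (h : GaussODE α f g) {t : ℝ} (ht : 0 ≤ t) :
    heatOp α m t f - f = ∫ s in (0 : ℝ)..t, heatOp α m s g := by
  refine X_ext_gaussTransform hm1 fun a ha => ?_
  obtain ⟨L, hL⟩ := exists_gaussTransform_clm hm1 ha
  rw [← hL, ← hL, ← L.intervalIntegral_comp_comm (intervalIntegrable_heatOp_apply hα hm hm1 g ht),
    map_sub, hL, hL]
  have hp : ∀ s ∈ uIcc 0 t, 0 ≤ s := fun s hs => by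
    rw [uIcc_of_le ht] at hs; exact hs.1
  have e : ∀ s ∈ uIcc 0 t, L (heatOp α m s g) = ((1 + 4 * a * s) ^ (-halfDim α) : ℝ) *
      gaussTransform (a / (1 + 4 * a * s)) g := fun s hs => by
    rw [hL, gaussTransform_heatOp hα hm hm1 ha (hp s hs)]
  rw [intervalIntegral.integral_congr e,
    intervalIntegral.integral_eq_sub_of_hasDerivAt
      (fun s hs => h.hasDerivAt ha (by have := hp s hs; positivity)),
    gaussTransform_heatOp hα hm hm1 ha ht]
  · simp
  · refine ContinuousOn.intervalIntegrable ?_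
    exact (continuousOn_transport hm1 (Lp.memLp g) ha).mono hp

theorem tendsto_heatOp_of_gaussODE (hα : 0 < α) (hm : -1 - α < m) (hm1 : m ≤ 1) {f g : X m}
    (h : GaussODE α f g) :
    Tendsto (fun t : ℝ => heatOp α m t f) (𝓝[>] 0) (𝓝 f) := by
  obtain ⟨M, hM0, -, hM⟩ := exists_norm_heatOp_ofReal_le hα hm hm1
  rw [tendsto_iff_norm_sub_tendsto_zero]
  have h0 : Tendsto (fun t : ℝ => M * ‖g‖ * t) (𝓝[>] 0) (𝓝 0) := by
    have : Continuous fun t : ℝ => M * ‖g‖ * t := by fun_prop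
    simpa using (this.tendsto 0).mono_left (nhdsWithin_le_nhds (s := Ioi (0 : ℝ)))
  refine squeeze_zero' (Eventually.of_forall fun _ => norm_nonneg _) ?_ h0
  filter_upwards [self_mem_nhdsWithin] with t (ht : 0 < t)
  rw [heatOp_sub_eq_integral hα hm hm1 h ht.le]
  have := intervalIntegral.norm_integral_le_of_norm_le_const (a := 0) (b := t)
    (f := fun s : ℝ => heatOp α m s g) (C := M * ‖g‖) (fun s hs => by
      rw [uIoc_of_le ht.le] at hs
      exact (ContinuousLinearMap.le_opNorm _ _).trans (by gcongr; exact hM s hs.1))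
  rwa [sub_zero, abs_of_pos ht] at this

/-- Strong continuity at zero along the positive reals and uniform boundedness give strong
continuity in every sector of angle less than `π / 2`. -/
theorem tendsto_heatOp_sector (hα : 0 < α) (hm : -1 - α < m) (hm1 : m ≤ 1)
    (h : ∀ f : X m, Tendsto (fun t : ℝ => heatOp α m t f) (𝓝[>] 0) (𝓝 f)) {θ : ℝ}
    (hθ : θ ∈ Ioo 0 (Real.pi / 2)) (f : X m) :
    Tendsto (fun z => heatOp α m z f) (𝓝[openSector θ] 0) (𝓝 f) := by
  obtain ⟨C, hC⟩ := exists_norm_heatOp_sector_le hα hm hm1 hθ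
  have hre : ∀ z ∈ openSector θ, 0 < z.re := fun z hz =>
    mem_openSector_pi_div_two.1 ⟨hz.1, hz.2.trans hθ.2⟩
  rw [Metric.tendsto_nhds]
  intro ε hε
  set η := ε / (2 * (|C| + 2)) with hη
  have hη0 : 0 < η := by positivity
  -- With u = T(t)f, write T(z)f - f as T(z)(f - u) + (T(z + t)f - u) + (u - f). The first and last
  -- terms are small by the choice of t, the middle one by continuity at t > 0.
  obtain ⟨t, ht, ht0⟩ := (((Metric.tendsto_nhds.1 (h f)) η hη0).and self_mem_nhdsWithin).exists
  have ht0 : 0 < t := ht0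
  have h1 : Tendsto (fun z : ℂ => heatOp α m (z + t) f) (𝓝[openSector θ] 0)
      (𝓝 (heatOp α m t f)) := by
    have h2 : ContinuousAt (heatOp α m) (t : ℂ) :=
      (differentiableAt_heatOp hα hm hm1 (by simpa using ht0)).continuousAt
    have h3 : Tendsto (fun z : ℂ => z + t) (𝓝[openSector θ] 0) (𝓝 (t : ℂ)) := by
      have : Continuous fun z : ℂ => z + t := by fun_prop
      simpa using (this.tendsto 0).mono_left (nhdsWithin_le_nhds (s := openSector θ))
    have h4 : Tendsto (fun z : ℂ => heatOp α m (z + t)) (𝓝[openSector θ] 0)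
        (𝓝 (heatOp α m t)) := h2.tendsto.comp h3
    exact ((ContinuousLinearMap.apply ℂ (X m) f).continuous.tendsto _).comp h4
  filter_upwards [Metric.tendsto_nhds.1 h1 η hη0, self_mem_nhdsWithin] with z hz hzs
  rw [heatOp_add hα hm hm1 (hre z hzs) (by simpa using ht0),
    ContinuousLinearMap.comp_apply] at hz
  set u := heatOp α m t f with hu
  have h4 : dist (heatOp α m z f) (heatOp α m z u) ≤ |C| * η := by
    rw [dist_eq_norm, ← map_sub]
    refine (ContinuousLinearMap.le_opNorm _ _).trans ?_
    have h5 : ‖f - u‖ ≤ η := by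
      rw [norm_sub_rev, ← dist_eq_norm]; exact ht.le
    have h6 := (hC z hzs).trans (le_abs_self C)
    gcongr
  have h7 : |C| * η + η + η ≤ ε / 2 := by
    rw [hη]
    have : |C| * (ε / (2 * (|C| + 2))) + ε / (2 * (|C| + 2)) + ε / (2 * (|C| + 2)) = ε / 2 := by
      have : |C| + 2 ≠ 0 := by positivity
      field_simp
      ring
    exact this.le
  linarith [dist_triangle4 (heatOp α m z f) (heatOp α m z u) u f]

/-! ### The generator -/

theorem tendsto_quotient_of_gaussODE (hα : 0 < α) (hm : -1 - α < m) (hm1 : m ≤ 1)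
    (hc : ∀ f : X m, Tendsto (fun t : ℝ => heatOp α m t f) (𝓝[>] 0) (𝓝 f)) {f g : X m}
    (h : GaussODE α f g) :
    Tendsto (fun t : ℝ => (t : ℂ)⁻¹ • (heatOp α m t f - f)) (𝓝[>] 0) (𝓝 g) := by
  rw [Metric.tendsto_nhds]
  intro ε hε
  obtain ⟨δ, hδ, hδ'⟩ := mem_nhdsGT_iff_exists_Ioo_subset.1
    (Metric.tendsto_nhds.1 (hc g) (ε / 2) (half_pos hε))
  filter_upwards [Ioo_mem_nhdsGT (hδ : (0 : ℝ) < δ)] with t ht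
  have h1 := intervalIntegral.norm_integral_le_of_norm_le_const (a := 0) (b := t)
    (f := fun s : ℝ => heatOp α m s g - g) (C := ε / 2) (fun s hs => by
      rw [uIoc_of_le ht.1.le] at hs
      have : dist (heatOp α m s g) g < ε / 2 := hδ' ⟨hs.1, hs.2.trans_lt ht.2⟩
      rw [← dist_eq_norm]
      exact this.le)
  rw [intervalIntegral.integral_sub (intervalIntegrable_heatOp_apply hα hm hm1 g ht.1.le)
    intervalIntegrable_const, ← heatOp_sub_eq_integral hα hm hm1 h ht.1.le,
    intervalIntegral.integral_const, sub_zero, abs_of_pos ht.1] at h1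
  have ht0 : (t : ℂ) ≠ 0 := by exact_mod_cast ht.1.ne'
  have e : (t : ℂ)⁻¹ • (heatOp α m t f - f) - g =
      (t : ℂ)⁻¹ • (heatOp α m t f - f - t • g) := by
    rw [smul_sub (t : ℂ)⁻¹ _ (t • g), ← algebraMap_smul ℂ t g, smul_smul,
      Complex.coe_algebraMap, inv_mul_cancel₀ ht0, one_smul]
  rw [dist_eq_norm, e, norm_smul, norm_inv, Complex.norm_real, Real.norm_of_nonneg ht.1.le,
    inv_mul_lt_iff₀ ht.1]
  nlinarith [ht.1]

/-- The transform is a continuous functional, so it can be applied to the difference quotient; the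
limit is the derivative of the transport at time 0. -/
theorem gaussODE_of_tendsto_quotient (hα : 0 < α) (hm : -1 - α < m) (hm1 : m ≤ 1) {f g : X m}
    (h : Tendsto (fun t : ℝ => (t : ℂ)⁻¹ • (heatOp α m t f - f)) (𝓝[>] 0) (𝓝 g)) :
    GaussODE α f g := by
  intro a ha
  have hD := hasDerivAt_gaussTransform hm1 (Lp.memLp f) ha
  refine ⟨_, hD, ?_⟩
  obtain ⟨L, hL⟩ := exists_gaussTransform_clm hm1 ha
  have h1 : Tendsto (fun t : ℝ => L ((t : ℂ)⁻¹ • (heatOp α m t f - f))) (𝓝[>] 0) (𝓝 (L g)) :=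
    (L.continuous.tendsto g).comp h
  have h2 := hasDerivAt_transport (δ := halfDim α) (a := a) (t := 0)
    (F := fun b => gaussTransform b f) (by simp) (by simpa using hD)
  have h3 := h2.tendsto_slope_zero_right
  rw [← hL g]
  refine tendsto_nhds_unique h1 ?_
  simp only [mul_zero, add_zero, Real.one_rpow, div_one, Complex.ofReal_one, one_mul] at h3
  refine h3.congr' ?_
  filter_upwards [self_mem_nhdsWithin] with t (ht : 0 < t)
  rw [map_smul, map_sub, hL, hL, gaussTransform_heatOp hα hm hm1 ha ht.le, zero_add]
  rw [← Complex.coe_smul, Complex.ofReal_inv]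

end

/-! ### Integration by parts against test functions -/

theorem continuousOn_besselAdjoint (κ : ℝ) {φ : ℝ → ℝ} (hφ : ContDiff ℝ ∞ φ) :
    ContinuousOn (besselAdjoint κ φ) (Ioi 0) := by
  have hd : ContDiff ℝ ∞ (deriv φ) := (contDiff_infty_iff_deriv.1 hφ).2
  have hdd : Continuous (deriv (deriv φ)) := (contDiff_infty_iff_deriv.1 hd).2.continuous
  have hx : ∀ x ∈ Ioi (0 : ℝ), x ≠ 0 := fun x hx => ne_of_gt hx
  have hx2 : ∀ x ∈ Ioi (0 : ℝ), x ^ 2 ≠ 0 := fun x h => pow_ne_zero 2 (hx x h)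
  exact (hdd.continuousOn.sub ((continuousOn_const.div continuousOn_id hx).mul
    hd.continuous.continuousOn)).add
    ((continuousOn_const.div (continuousOn_id.pow 2) hx2).mul hφ.continuous.continuousOn)

theorem besselAdjoint_eq_zero (κ : ℝ) {φ : ℝ → ℝ} {x : ℝ} (hx : x ∉ tsupport φ) :
    besselAdjoint κ φ x = 0 := by
  have h1 : φ =ᶠ[𝓝 x] 0 := notMem_tsupport_iff_eventuallyEq.1 hx
  have h2 : deriv φ =ᶠ[𝓝 x] 0 := by simpa using h1.deriv
  have h3 : deriv (deriv φ) =ᶠ[𝓝 x] 0 := by simpa using h2.deriv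
  simp [besselAdjoint, h1.eq_of_nhds, h2.eq_of_nhds, h3.eq_of_nhds]

theorem isBessel_of_hasDerivAt (κ : ℝ) {f f' f'' : ℝ → ℂ}
    (hf : ∀ x, 0 < x → HasDerivAt f (f' x) x) (hf' : ∀ x, 0 < x → HasDerivAt f' (f'' x) x)
    (hc : ContinuousOn f'' (Ioi 0)) :
    IsBessel κ f (fun x => f'' x + (κ / x) • f' x) := by
  intro φ h1 h2 h3
  have hd : ContDiff ℝ ∞ (deriv φ) := (contDiff_infty_iff_deriv.1 h1).2
  have hφd : ∀ x, HasDerivAt φ (deriv φ x) x := fun x =>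
    ((contDiff_infty_iff_deriv.1 h1).1 x).hasDerivAt
  have hφdd : ∀ x, HasDerivAt (deriv φ) (deriv (deriv φ) x) x := fun x =>
    ((contDiff_infty_iff_deriv.1 hd).1 x).hasDerivAt
  have hcf : ContinuousOn f (Ioi 0) := fun x hx => (hf x hx).continuousAt.continuousWithinAt
  have hcf' : ContinuousOn f' (Ioi 0) := fun x hx => (hf' x hx).continuousAt.continuousWithinAt
  have hκ : ContinuousOn (fun x : ℝ => κ / x) (Ioi 0) :=
    continuousOn_const.div continuousOn_id fun x hx => ne_of_gt hx
  have hcg : ContinuousOn (fun x => f'' x + (κ / x) • f' x) (Ioi 0) := hc.add (hκ.smul hcf')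
  have i1 := integrable_test_left (hcf.locallyIntegrableOn measurableSet_Ioi) κ h1 h2 h3
  have i2 := integrable_test_right (hcg.locallyIntegrableOn measurableSet_Ioi) h1 h2 h3
  -- The bilinear concomitant of the Bessel operator and its adjoint: its derivative is the
  -- difference of the two integrands, and it vanishes off the support of φ.
  set W : ℝ → ℂ := fun x => deriv φ x • f x - φ x • f' x - (κ / x * φ x) • f x with hW
  have hW0 : ∀ x, x ∉ tsupport φ → W x = 0 := by
    intro x hx
    have e1 : φ =ᶠ[𝓝 x] 0 := notMem_tsupport_iff_eventuallyEq.1 hx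
    have e2 : deriv φ =ᶠ[𝓝 x] 0 := by simpa using e1.deriv
    simp [hW, e1.eq_of_nhds, e2.eq_of_nhds]
  have h0 : (0 : ℝ) ∉ tsupport φ := fun h => lt_irrefl (0:ℝ) (h3 h : (0:ℝ) < 0)
  have hWd : ∀ x ∈ Ioi (0 : ℝ), HasDerivAt W
      (besselAdjoint κ φ x • f x - φ x • (f'' x + (κ / x) • f' x)) x := by
    intro x (hx : 0 < x)
    have d1 : HasDerivAt (fun x : ℝ => κ / x * φ x) (-κ / x ^ 2 * φ x + κ / x * deriv φ x) x := by
      have := (hasDerivAt_const x κ).div (hasDerivAt_id x) hx.ne'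
      refine (this.mul (hφd x)).congr_deriv ?_
      simp
    refine ((((hφdd x).smul (hf x hx)).sub ((hφd x).smul (hf' x hx))).sub
      (d1.smul (hf x hx))).congr_deriv ?_
    simp only [besselAdjoint, Complex.real_smul]
    push_cast
    have : (x : ℂ) ≠ 0 := by exact_mod_cast hx.ne'
    field_simp
    ring
  have key := integral_Ioi_of_hasDerivAt_of_tendsto (a := 0) (f := W) (m := 0) ?_ hWd (i1.sub i2) ?_
  · rw [integral_sub i1 i2, hW0 0 h0, sub_zero] at key
    exact sub_eq_zero.1 key
  · have : W =ᶠ[𝓝 0] fun _ => 0 := by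
      filter_upwards [(isClosed_tsupport φ).isOpen_compl.mem_nhds h0] with x hx using hW0 x hx
    exact (continuousAt_const.congr this.symm).continuousWithinAt
  · refine tendsto_const_nhds.congr' ?_
    have := h2.isCompact.compl_mem_cocompact
    filter_upwards [atTop_le_cocompact this] with x hx
    exact (hW0 x hx).symm

/-- The Bessel operator applied to `x ^ α exp (-a x²)`. -/
theorem isBessel_gaussian (α a : ℝ) :
    IsBessel (1 - α) (fun x => ((x ^ α * Real.exp (-a * x ^ 2) : ℝ) : ℂ))
      (fun x => (((-(4 * a * halfDim α) + 4 * a ^ 2 * x ^ 2) *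
        (x ^ α * Real.exp (-a * x ^ 2)) : ℝ) : ℂ)) := by
  have he : ∀ x : ℝ, HasDerivAt (fun x : ℝ => Real.exp (-a * x ^ 2))
      (Real.exp (-a * x ^ 2) * (-a * (2 * x))) x := fun x => by
    have := ((hasDerivAt_pow 2 x).const_mul (-a)).exp
    simpa using this
  have hp : ∀ (p x : ℝ), 0 < x → HasDerivAt (fun x : ℝ => x ^ p) (p * x ^ (p - 1)) x :=
    fun p x hx => Real.hasDerivAt_rpow_const (Or.inl hx.ne')
  have h := isBessel_of_hasDerivAt (1 - α)
    (f := fun x => ((x ^ α * Real.exp (-a * x ^ 2) : ℝ) : ℂ))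
    (f' := fun x => (((α * x ^ (α - 1) - 2 * a * x ^ (α + 1)) * Real.exp (-a * x ^ 2) : ℝ) : ℂ))
    (f'' := fun x => (((α * (α - 1) * x ^ (α - 2) - 2 * a * (2 * α + 1) * x ^ α +
      4 * a ^ 2 * x ^ (α + 2)) * Real.exp (-a * x ^ 2) : ℝ) : ℂ)) ?_ ?_ ?_
  · refine IsBessel.congr h (Eventually.of_forall fun _ => rfl) ?_
    filter_upwards [ae_restrict_mem measurableSet_Ioi] with x (hx : 0 < x)
    rw [Complex.real_smul, ← Complex.ofReal_mul, ← Complex.ofReal_add]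
    congr 1
    rw [Real.rpow_sub_one hx.ne', Real.rpow_add_one hx.ne', Real.rpow_sub hx, Real.rpow_add hx,
      Real.rpow_two, halfDim]
    field_simp
    ring
  · intro x hx
    refine ((hp α x hx).mul (he x)).ofReal_comp.congr_deriv ?_
    congr 1
    rw [Real.rpow_add_one hx.ne']
    ring
  · intro x hx
    refine (((((hp (α - 1) x hx).const_mul α).sub ((hp (α + 1) x hx).const_mul (2 * a))).mul
      (he x)).ofReal_comp).congr_deriv ?_
    congr 1
    simp only [Pi.sub_apply]
    rw [show α - 1 - 1 = α - 2 by ring, show α + 1 - 1 = α by ring,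
      Real.rpow_sub_one hx.ne', Real.rpow_sub hx, Real.rpow_add_one hx.ne',
      Real.rpow_add hx α 2, Real.rpow_two]
    field_simp
    ring
  · refine Complex.continuous_ofReal.comp_continuousOn ?_
    have hr : ∀ p : ℝ, ContinuousOn (fun x : ℝ => x ^ p) (Ioi 0) := fun p x hx =>
      (Real.continuousAt_rpow_const x p (Or.inl (ne_of_gt hx))).continuousWithinAt
    exact ((((hr _).const_mul _).sub ((hr _).const_mul _)).add ((hr _).const_mul _)).mul
      (by fun_prop)

/-! ### Test functions in the weighted spaces -/

theorem memLp_test (r : ℝ) {φ ψ : ℝ → ℝ} (hφc : HasCompactSupport φ) (hφs : tsupport φ ⊆ Ioi 0)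
    (hψ : ContinuousOn ψ (Ioi 0)) (h0 : ∀ x, x ∉ tsupport φ → ψ x = 0) :
    MemLp (fun x => (ψ x : ℂ)) 1 (weight r) := by
  refine memLp_weight_iff.2 ⟨(Complex.continuous_ofReal.comp_continuousOn hψ).aestronglyMeasurable
    measurableSet_Ioi, ?_⟩
  have h1 : LocallyIntegrableOn (fun _ : ℝ => (1 : ℂ)) (Ioi 0) :=
    continuousOn_const.locallyIntegrableOn measurableSet_Ioi
  have h2 := integrable_test h1 hφc hφs (ψ := fun x => x ^ r * ψ x)
    (ContinuousOn.mul (fun x hx =>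
      (Real.continuousAt_rpow_const x r (Or.inl (ne_of_gt hx))).continuousWithinAt) hψ)
    (fun x hx => by rw [h0 x hx, mul_zero])
  refine lt_of_eq_of_lt (setLIntegral_congr_fun measurableSet_Ioi fun x (hx : 0 < x) => ?_) h2.2
  simp only
  rw [enorm_smul, enorm_mul, enorm_one, mul_one, Real.enorm_eq_ofReal (by positivity),
    ← ofReal_norm, ← ofReal_norm, Complex.norm_real]

/-- The function `x ^ (α - 1) φ`, which corresponds to `φ` under the duality that makes the heat
kernel symmetric. -/
def testLift (α : ℝ) (φ : ℝ → ℝ) (x : ℝ) : ℂ := ((x ^ (α - 1) * φ x : ℝ) : ℂ)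

theorem memLp_testLift (α r : ℝ) {φ ψ : ℝ → ℝ} (hφc : HasCompactSupport φ)
    (hφs : tsupport φ ⊆ Ioi 0) (hψ : ContinuousOn ψ (Ioi 0))
    (h0 : ∀ x, x ∉ tsupport φ → ψ x = 0) : MemLp (testLift α ψ) 1 (weight r) :=
  memLp_test r hφc hφs (ψ := fun x => x ^ (α - 1) * ψ x) (ContinuousOn.mul (fun x hx =>
    (Real.continuousAt_rpow_const x _ (Or.inl (ne_of_gt hx))).continuousWithinAt) hψ)
    (fun x hx => by rw [h0 x hx, mul_zero])

/-- Conjugation by x^{α-1} carries the adjoint operator to the Bessel operator. Under the transform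
x · x^{α-1} = x^α, so the claim is `isBessel_gaussian` tested against φ. -/
theorem gaussODE_testLift {α : ℝ} {φ : ℝ → ℝ} (h1 : ContDiff ℝ ∞ φ)
    (h2 : HasCompactSupport φ) (h3 : tsupport φ ⊆ Ioi 0) :
    GaussODE α (testLift α φ) (testLift α (besselAdjoint (1 - α) φ)) := by
  intro a ha
  have hm := memLp_testLift α 0 h2 h3 h1.continuous.continuousOn
    (fun x hx => image_eq_zero_of_notMem_tsupport hx)
  refine ⟨_, hasDerivAt_gaussTransform zero_le_one hm ha, ?_⟩
  have h := isBessel_gaussian α a φ h1 h2 h3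
  obtain ⟨C, -, hC⟩ := abs_sq_mul_gaussWeight_le zero_le_one ha
  have e1 : gaussTransform a (testLift α (besselAdjoint (1 - α) φ)) =
      ∫ x in Ioi (0 : ℝ), besselAdjoint (1 - α) φ x •
        ((x ^ α * Real.exp (-a * x ^ 2) : ℝ) : ℂ) := by
    refine setIntegral_congr_fun measurableSet_Ioi fun x (hx : 0 < x) => ?_
    simp only [testLift, gaussWeight, Complex.real_smul, ← Complex.ofReal_mul]
    congr 1
    rw [Real.rpow_sub_one hx.ne']
    field_simp
  rw [e1, h, gaussTransform, pair, pair, ← integral_const_mul, ← integral_const_mul,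
    ← integral_sub]
  · refine setIntegral_congr_fun measurableSet_Ioi fun x (hx : 0 < x) => ?_
    simp only [testLift, gaussWeight, Complex.real_smul, ← Complex.ofReal_mul,
      ← Complex.ofReal_sub, ← Complex.ofReal_neg]
    congr 1
    rw [Real.rpow_sub_one hx.ne']
    field_simp
    ring
  · exact (integrable_gaussWeight_smul zero_le_one ha hm).const_mul _
  · exact (integrable_pair (by fun_prop) (fun x hx => by rw [abs_neg]; exact hC x hx)
      hm).const_mul _

/-! ### Density of test functions -/

theorem exists_truncation {m : ℝ} (f : X m) {ε : ℝ≥0∞} (hε : 0 < ε) :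
    ∃ a b : ℝ, 0 < a ∧ a < b ∧ ∫⁻ x in Ioi (0 : ℝ), ENNReal.ofReal (x ^ m) *
      ‖(f : ℝ → ℂ) x - (Icc a b).indicator (f : ℝ → ℂ) x‖ₑ < ε := by
  have hf := memLp_weight_iff.1 (Lp.memLp f)
  have h : Tendsto (fun n : ℕ => ∫⁻ x in Ioi (0 : ℝ), ENNReal.ofReal (x ^ m) *
      ‖(f : ℝ → ℂ) x - (Icc (1 / ((n : ℝ) + 2)) ((n : ℝ) + 2)).indicator (f : ℝ → ℂ) x‖ₑ) atTop
      (𝓝 (∫⁻ x in Ioi (0 : ℝ), 0)) := by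
    refine tendsto_lintegral_of_dominated_convergence'
      (fun x => ENNReal.ofReal (x ^ m) * ‖(f : ℝ → ℂ) x‖ₑ) ?_ ?_ hf.2.ne ?_
    · intro n
      exact AEMeasurable.mul (by fun_prop) (hf.1.sub (hf.1.indicator measurableSet_Icc)).enorm
    · intro n
      refine Eventually.of_forall fun x => ?_
      dsimp only
      gcongr
      by_cases hx : x ∈ Icc (1 / ((n : ℝ) + 2)) ((n : ℝ) + 2)
      · rw [indicator_of_mem hx, sub_self]
        simp
      · rw [indicator_of_notMem hx, sub_zero]
    · filter_upwards [ae_restrict_mem measurableSet_Ioi] with x (hx : 0 < x)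
      refine tendsto_const_nhds.congr' ?_
      obtain ⟨N, hN⟩ := exists_nat_ge (max x (1 / x))
      filter_upwards [eventually_ge_atTop N] with n hn
      have hn' : (N : ℝ) ≤ n := by exact_mod_cast hn
      have hx1 : x ≤ n := (le_max_left _ _).trans (hN.trans hn')
      have hx2 : 1 / x ≤ n := (le_max_right _ _).trans (hN.trans hn')
      have hx3 : x ∈ Icc (1 / ((n : ℝ) + 2)) ((n : ℝ) + 2) := by
        refine ⟨?_, by linarith⟩
        rw [div_le_iff₀ (by positivity)]
        rw [div_le_iff₀ hx] at hx2
        nlinarith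
      rw [indicator_of_mem hx3, sub_self, enorm_zero, mul_zero]
  rw [lintegral_zero] at h
  obtain ⟨n, hn⟩ := ((tendsto_order.1 h).2 ε hε).exists
  refine ⟨_, _, by positivity, ?_, hn⟩
  rw [div_lt_iff₀ (by positivity)]
  have : (0 : ℝ) ≤ n := by positivity
  nlinarith

theorem exists_cutoff {a b : ℝ} (ha : 0 < a) (hab : a < b) :
    ∃ (χ : ℝ → ℝ) (c d : ℝ), ContDiff ℝ ∞ χ ∧ HasCompactSupport χ ∧ 0 < c ∧
      tsupport χ ⊆ Icc c d ∧ (∀ x, χ x ∈ Icc 0 1) ∧ ∀ x ∈ Icc a b, χ x = 1 := by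
  let χ : ContDiffBump ((a + b) / 2) := ⟨(b - a) / 2, (b - a) / 2 + a / 2, by linarith, by linarith⟩
  refine ⟨χ, (a + b) / 2 - ((b - a) / 2 + a / 2), (a + b) / 2 + ((b - a) / 2 + a / 2),
    χ.contDiff, χ.hasCompactSupport, by linarith, ?_, fun x => ⟨χ.nonneg, χ.le_one⟩, ?_⟩
  · rw [χ.tsupport_eq, Real.closedBall_eq_Icc]
  · intro x hx
    refine χ.one_of_mem_closedBall ?_
    rw [Real.closedBall_eq_Icc]
    exact ⟨by simp only [χ]; linarith [hx.1], by simp only [χ]; linarith [hx.2]⟩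

/-- Density of the test functions. Truncation to [a, b] leaves a function that is integrable for
Lebesgue measure and can be approximated there by a smooth g; a cutoff restores the support. Real
and imaginary parts are handled separately because the test functions are real. -/
theorem eq_top_of_test_mem {m : ℝ} (V : Submodule ℂ (X m)) (hV : IsClosed (V : Set (X m)))
    (h : ∀ φ : ℝ → ℝ, ContDiff ℝ ∞ φ → HasCompactSupport φ → tsupport φ ⊆ Ioi 0 → ∀ f : X m,
      (f : ℝ → ℂ) =ᵐ[volume.restrict (Ioi 0)] (fun x => (φ x : ℂ)) → f ∈ V) : V = ⊤ := by
  refine eq_top_iff.2 fun f _ => ?_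
  rw [← SetLike.mem_coe, ← hV.closure_eq]
  refine EMetric.mem_closure_iff.2 fun ε hε => ?_
  have hε2 : 0 < ε / 2 := ENNReal.half_pos hε.ne'
  obtain ⟨a, b, ha, hab, htr⟩ := exists_truncation f hε2
  obtain ⟨χ, c, d, hχ, hχc, hc, hχs, hχ01, hχ1⟩ := exists_cutoff ha hab
  set F : ℝ → ℂ := (Icc a b).indicator f with hF
  -- B bounds x^m on the support of the cutoff, so a Lebesgue error η costs at most |B| η in X_m.
  obtain ⟨B, hB⟩ := (isCompact_Icc (a := c) (b := d)).exists_bound_of_continuousOn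
    (f := fun x : ℝ => x ^ m) (fun x hx => (Real.continuousAt_rpow_const x m
      (Or.inl (by linarith [hx.1]))).continuousWithinAt)
  have hFi : MemLp F 1 volume := by
    rw [memLp_one_iff_integrable, hF, integrable_indicator_iff measurableSet_Icc]
    exact (locallyIntegrableOn_X f).integrableOn_compact_subset
      (fun x hx => ha.trans_le hx.1) isCompact_Icc
  obtain ⟨η, hη, hηε⟩ : ∃ η : ℝ, 0 < η ∧ ENNReal.ofReal |B| * ENNReal.ofReal η < ε / 2 := by
    obtain ⟨δ, hδ, hδε⟩ := ENNReal.lt_iff_exists_real_btwn.1 hε2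
    refine ⟨δ / (|B| + 1), ?_, ?_⟩
    · have : 0 < δ := ENNReal.ofReal_pos.1 hδε.1
      positivity
    · refine lt_of_le_of_lt ?_ hδε.2
      rw [← ENNReal.ofReal_mul (abs_nonneg B)]
      refine ENNReal.ofReal_le_ofReal ?_
      rw [mul_div_assoc', div_le_iff₀ (by positivity)]
      nlinarith [abs_nonneg B]
  obtain ⟨g, hgc, hg, hFg⟩ := hFi.exist_eLpNorm_sub_le ENNReal.one_ne_top le_rfl hη
  have hχ0 : ∀ x, x ∉ Icc c d → χ x = 0 := fun x hx =>
    image_eq_zero_of_notMem_tsupport fun h => hx (hχs h)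
  have hpos : tsupport χ ⊆ Ioi 0 := fun x hx => hc.trans_le (hχs hx).1
  have htest : ∀ u : ℝ → ℝ, ContDiff ℝ ∞ u → ∃ p : X m, p ∈ V ∧
      (p : ℝ → ℂ) =ᵐ[volume.restrict (Ioi 0)] (fun x => ((χ x * u x : ℝ) : ℂ)) := by
    intro u hu
    have hs : tsupport (fun x => χ x * u x) ⊆ tsupport χ := tsupport_mul_subset_left
    have hm : MemLp (fun x => ((χ x * u x : ℝ) : ℂ)) 1 (weight m) :=
      memLp_test m hχc hpos (hχ.mul hu).continuous.continuousOn
        (fun x hx => by rw [image_eq_zero_of_notMem_tsupport hx, zero_mul])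
    refine ⟨hm.toLp _, ?_, (restrict_ac_weight m).ae_eq hm.coeFn_toLp⟩
    exact h (fun x => χ x * u x) (hχ.mul hu) hχc.mul_right (hs.trans hpos) _
      ((restrict_ac_weight m).ae_eq hm.coeFn_toLp)
  obtain ⟨p, hpV, hp⟩ := htest (fun x => (g x).re) (Complex.reCLM.contDiff.comp hg)
  obtain ⟨q, hqV, hq⟩ := htest (fun x => (g x).im) (Complex.imCLM.contDiff.comp hg)
  refine ⟨p + Complex.I • q, V.add_mem hpV (V.smul_mem _ hqV), ?_⟩
  have hpq : ((p + Complex.I • q : X m) : ℝ → ℂ) =ᵐ[volume.restrict (Ioi 0)]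
      fun x => χ x • g x := by
    filter_upwards [hp, hq, (restrict_ac_weight m).ae_eq (Lp.coeFn_add p (Complex.I • q)),
      (restrict_ac_weight m).ae_eq (Lp.coeFn_smul Complex.I q)] with x e1 e2 e3 e4
    rw [e3, Pi.add_apply, e4, Pi.smul_apply, e1, e2, Complex.real_smul]
    conv_rhs => rw [← Complex.re_add_im (g x)]
    push_cast
    rw [smul_eq_mul]
    ring
  rw [edist_eq_enorm_sub, enorm_X]
  have hfm := (memLp_weight_iff.1 (Lp.memLp f)).1
  calc ∫⁻ x in Ioi (0 : ℝ), ENNReal.ofReal (x ^ m) * ‖(f - (p + Complex.I • q) : X m) x‖ₑ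
      ≤ ∫⁻ x in Ioi (0 : ℝ), (ENNReal.ofReal (x ^ m) * ‖(f : ℝ → ℂ) x - F x‖ₑ +
          ENNReal.ofReal |B| * ‖(F - g) x‖ₑ) := by
        refine lintegral_mono_ae ?_
        filter_upwards [hpq, (restrict_ac_weight m).ae_eq (Lp.coeFn_sub f (p + Complex.I • q)),
          ae_restrict_mem measurableSet_Ioi] with x e1 e2 (hx : 0 < x)
        rw [e2, Pi.sub_apply, e1]
        have e3 : (f : ℝ → ℂ) x - χ x • g x = ((f : ℝ → ℂ) x - F x) + (F x - χ x • g x) := by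
          ring
        rw [e3]
        grw [enorm_add_le, mul_add]
        refine add_le_add le_rfl ?_
        by_cases hxc : x ∈ Icc c d
        · have e4 : F x - χ x • g x = χ x • (F - g) x := by
            rw [Pi.sub_apply, smul_sub]
            congr 1
            by_cases hxa : x ∈ Icc a b
            · rw [hχ1 x hxa, one_smul]
            · rw [hF, indicator_of_notMem hxa, smul_zero]
          rw [e4]
          gcongr
          · have := hB x hxc
            exact (le_abs_self _).trans (this.trans (le_abs_self _))
          · rw [enorm_smul]
            refine mul_le_of_le_one_left' ?_
            rw [Real.enorm_eq_ofReal (hχ01 x).1]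
            exact ENNReal.ofReal_le_one.2 (hχ01 x).2
        · have hxa : x ∉ Icc a b := fun hxa => by
            have := hχ1 x hxa
            rw [hχ0 x hxc] at this
            exact zero_ne_one this
          rw [hχ0 x hxc, hF, indicator_of_notMem hxa]
          simp
    _ = (∫⁻ x in Ioi (0 : ℝ), ENNReal.ofReal (x ^ m) * ‖(f : ℝ → ℂ) x - F x‖ₑ) +
          ENNReal.ofReal |B| * ∫⁻ x in Ioi (0 : ℝ), ‖(F - g) x‖ₑ := by
        rw [lintegral_add_left', lintegral_const_mul' _ _ ENNReal.ofReal_ne_top]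
        exact AEMeasurable.mul (by fun_prop) (hfm.sub (hfm.indicator measurableSet_Icc)).enorm
    _ ≤ (∫⁻ x in Ioi (0 : ℝ), ENNReal.ofReal (x ^ m) * ‖(f : ℝ → ℂ) x - F x‖ₑ) +
          ENNReal.ofReal |B| * ENNReal.ofReal η := by
        gcongr
        rw [eLpNorm_one_eq_lintegral_enorm] at hFg
        exact (setLIntegral_le_lintegral _ _).trans hFg
    _ < ε / 2 + ε / 2 := ENNReal.add_lt_add htr hηε
    _ = ε := ENNReal.add_halves ε

/-! ### Strong continuity -/

theorem GaussODE.congr {α : ℝ} {f f' g g' : ℝ → ℂ} (h : GaussODE α f g)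
    (hf : f =ᵐ[volume.restrict (Ioi 0)] f') (hg : g =ᵐ[volume.restrict (Ioi 0)] g') :
    GaussODE α f' g' := by
  intro a ha
  have e : ∀ b, gaussTransform b f' = gaussTransform b f := fun b => pair_congr hf.symm
  have e' : gaussTransform a g' = gaussTransform a g := pair_congr hg.symm
  simp only [e, e']
  exact h a ha

/-- By uniform boundedness the vectors with continuous orbits at 0 form a closed subspace. It
contains the test functions, since these belong to pairs satisfying `GaussODE` and the integral
formula controls their orbits. -/
theorem tendsto_heatOp {α m : ℝ} (hα : 0 < α) (hm : -1 - α < m) (hm1 : m ≤ 1) (f : X m) :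
    Tendsto (fun t : ℝ => heatOp α m t f) (𝓝[>] 0) (𝓝 f) := by
  obtain ⟨M, hM0, -, hM⟩ := exists_norm_heatOp_ofReal_le hα hm hm1
  let V : Submodule ℂ (X m) :=
    { carrier := {f | Tendsto (fun t : ℝ => heatOp α m t f) (𝓝[>] 0) (𝓝 f)}
      zero_mem' := by simp
      add_mem' := fun {f g} hf hg => by
        have : Tendsto (fun t : ℝ => heatOp α m t f + heatOp α m t g) (𝓝[>] 0) (𝓝 (f + g)) :=
          Tendsto.add hf hg
        simpa using this
      smul_mem' := fun c f hf => by
        have : Tendsto (fun t : ℝ => c • heatOp α m t f) (𝓝[>] 0) (𝓝 (c • f)) :=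
          Tendsto.const_smul hf c
        simpa using this }
  suffices h : V = ⊤ by
    have : f ∈ V := h ▸ Submodule.mem_top
    exact this
  refine eq_top_of_test_mem V ?_ ?_
  · refine isClosed_of_closure_subset fun f hf => ?_
    refine Metric.tendsto_nhds.2 fun ε hε => ?_
    obtain ⟨g, hg, hfg⟩ := Metric.mem_closure_iff.1 hf (ε / (M + 2)) (by positivity)
    filter_upwards [Metric.tendsto_nhds.1 (show Tendsto (fun t : ℝ => heatOp α m t g) (𝓝[>] 0)
      (𝓝 g) from hg) (ε / (M + 2)) (by positivity), self_mem_nhdsWithin] with t ht (ht0 : 0 < t)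
    have h1 : dist (heatOp α m t f) (heatOp α m t g) ≤ M * (ε / (M + 2)) := by
      rw [dist_eq_norm, ← map_sub]
      refine (ContinuousLinearMap.le_opNorm _ _).trans ?_
      rw [dist_eq_norm] at hfg
      have := hM t ht0
      gcongr
    have h2 : M * (ε / (M + 2)) + ε / (M + 2) + ε / (M + 2) = ε := by field_simp; ring
    rw [dist_comm] at hfg
    linarith [dist_triangle4 (heatOp α m t f) (heatOp α m t g) g f]
  · intro φ h1 h2 h3 f hf
    -- The power is chosen so that `testLift α ψ` is φ itself.
    set ψ : ℝ → ℝ := fun x => x ^ (1 - α) * φ x with hψ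
    have hs : tsupport ψ ⊆ tsupport φ := tsupport_mul_subset_right
    have hψ1 : ContDiff ℝ ∞ ψ := by
      rw [contDiff_iff_contDiffAt]
      intro x
      by_cases hx : x ∈ tsupport φ
      · exact (contDiffAt_id.rpow_const_of_ne (ne_of_gt (h3 hx))).mul h1.contDiffAt
      · have : ψ =ᶠ[𝓝 x] fun _ => 0 := by
          filter_upwards [(isClosed_tsupport φ).isOpen_compl.mem_nhds hx] with y hy
          simp only [hψ, image_eq_zero_of_notMem_tsupport hy, mul_zero]
        exact contDiffAt_const.congr_of_eventuallyEq this
    have hψ2 : HasCompactSupport ψ := h2.mul_left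
    have hg := memLp_testLift α m hψ2 (hs.trans h3) (continuousOn_besselAdjoint (1 - α) hψ1)
      (fun x hx => besselAdjoint_eq_zero (1 - α) hx)
    refine tendsto_heatOp_of_gaussODE hα hm hm1 (g := hg.toLp _)
      ((gaussODE_testLift hψ1 hψ2 (hs.trans h3)).congr ?_
        ((restrict_ac_weight m).ae_eq hg.coeFn_toLp.symm))
    filter_upwards [hf, ae_restrict_mem measurableSet_Ioi] with x hx (hx0 : 0 < x)
    rw [hx, testLift]
    simp only [hψ]
    rw [← mul_assoc, ← Real.rpow_add hx0]
    simp

/-! ### From the distributional equation to the transformed one -/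

theorem exists_transition : ∃ (u u' u'' : ℝ → ℝ) (C : ℝ), ContDiff ℝ ∞ u ∧ 0 < C ∧
    (∀ x, HasDerivAt u (u' x) x) ∧ (∀ x, HasDerivAt u' (u'' x) x) ∧ (∀ x, u x ∈ Icc 0 1) ∧
    (∀ x ≤ 1, u x = 0) ∧ (∀ x, 2 ≤ x → u x = 1) ∧
    (∀ x, |u' x| ≤ C) ∧ (∀ x, |u'' x| ≤ C) ∧ (∀ x ∉ Icc (1 : ℝ) 2, u' x = 0) ∧
    ∀ x ∉ Icc (1 : ℝ) 2, u'' x = 0 := by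
  set u : ℝ → ℝ := fun x => Real.smoothTransition (x - 1) with hu
  have h1 : ContDiff ℝ ∞ u := Real.smoothTransition.contDiff.comp (contDiff_id.sub contDiff_const)
  have hd : ContDiff ℝ ∞ (deriv u) := (contDiff_infty_iff_deriv.1 h1).2
  have hdd : Continuous (deriv (deriv u)) := (contDiff_infty_iff_deriv.1 hd).2.continuous
  have z1 : ∀ x ≤ 1, u x = 0 := fun x hx =>
    Real.smoothTransition.zero_of_nonpos (by linarith)
  have z2 : ∀ x, 2 ≤ x → u x = 1 := fun x hx => Real.smoothTransition.one_of_one_le (by linarith)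
  have e0 : ∀ x ∉ Icc (1 : ℝ) 2, deriv u =ᶠ[𝓝 x] fun _ => 0 := by
    intro x hx
    by_cases hx1 : x < 1
    · filter_upwards [Iio_mem_nhds hx1] with y hy
      have : u =ᶠ[𝓝 y] fun _ => 0 := by
        filter_upwards [Iio_mem_nhds hy] with z hz using z1 z (le_of_lt hz)
      rw [this.deriv_eq, deriv_const]
    · have hx2 : 2 < x := by
        by_contra h
        exact hx ⟨not_lt.1 hx1, not_lt.1 h⟩
      filter_upwards [Ioi_mem_nhds hx2] with y hy
      have : u =ᶠ[𝓝 y] fun _ => 1 := by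
        filter_upwards [Ioi_mem_nhds hy] with z hz using z2 z (le_of_lt hz)
      rw [this.deriv_eq, deriv_const]
  have e1 : ∀ x ∉ Icc (1 : ℝ) 2, deriv u x = 0 := fun x hx => (e0 x hx).eq_of_nhds
  have e2 : ∀ x ∉ Icc (1 : ℝ) 2, deriv (deriv u) x = 0 := fun x hx => by
    rw [(e0 x hx).deriv_eq, deriv_const]
  obtain ⟨C1, h3⟩ := hd.continuous.bounded_above_of_compact_support
    (HasCompactSupport.intro isCompact_Icc e1)
  obtain ⟨C2, h4⟩ := hdd.bounded_above_of_compact_support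
    (HasCompactSupport.intro isCompact_Icc e2)
  refine ⟨u, deriv u, deriv (deriv u), max 1 (max C1 C2), h1, by positivity,
    fun x => ((contDiff_infty_iff_deriv.1 h1).1 x).hasDerivAt,
    fun x => ((contDiff_infty_iff_deriv.1 hd).1 x).hasDerivAt,
    fun x => ⟨Real.smoothTransition.nonneg _, Real.smoothTransition.le_one _⟩, z1, z2,
    fun x => (h3 x).trans ((le_max_left _ _).trans (le_max_right _ _)),
    fun x => (h4 x).trans ((le_max_right _ _).trans (le_max_right _ _)), e1, e2⟩

theorem besselAdjoint_eq_of_hasDerivAt (κ : ℝ) {φ φ' φ'' : ℝ → ℝ}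
    (h : ∀ x, HasDerivAt φ (φ' x) x) (h' : ∀ x, HasDerivAt φ' (φ'' x) x) (x : ℝ) :
    besselAdjoint κ φ x = φ'' x - κ / x * φ' x + κ / x ^ 2 * φ x := by
  have e : deriv φ = φ' := funext fun x => (h x).deriv
  rw [besselAdjoint, e, (h' x).deriv]

/-- The formal adjoint of the Bessel operator, applied to a Gaussian weight. -/
def gaussAdjoint (α a x : ℝ) : ℝ :=
  -(4 * a * halfDim α) * gaussWeight a x + 4 * a ^ 2 * (x ^ 2 * gaussWeight a x)

set_option maxHeartbeats 1000000 in
/-- The cut-off Gaussian weights: smooth functions with compact support in `(0, ∞)` which approach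
the Gaussian weight, with control of the adjoint Bessel operator. -/
theorem exists_gaussWeight_cutoff (α : ℝ) {a : ℝ} (ha : 0 < a) :
    ∃ (χ E : ℕ → ℝ → ℝ) (C : ℝ), 0 < C ∧ ∀ n : ℕ, 1 ≤ n →
      ContDiff ℝ ∞ (fun x => χ n x * gaussWeight a x) ∧
      HasCompactSupport (fun x => χ n x * gaussWeight a x) ∧
      tsupport (fun x => χ n x * gaussWeight a x) ⊆ Ioi 0 ∧
      Measurable (χ n) ∧ Measurable (E n) ∧
      (∀ x, |χ n x| ≤ 1) ∧ (∀ x ∈ Icc (2 / (n : ℝ)) n, χ n x = 1) ∧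
      (∀ x, 0 < x → besselAdjoint (1 - α) (fun x => χ n x * gaussWeight a x) x =
        χ n x * gaussAdjoint α a x + E n x) ∧
      ∀ x, 0 < x → |E n x| ≤ C * ((Icc (1 / (n : ℝ)) (2 / n)).indicator (fun _ => (n : ℝ)) x +
        (Ici (n : ℝ)).indicator (fun x => (1 + x ^ 2) * gaussWeight a x) x) := by
  obtain ⟨u, u', u'', C, hu, hC, hd, hd', h01, hz, ho, hb, hb', hs, hs'⟩ := exists_transition
  set κ := 1 - α with hκ
  set ψ' : ℝ → ℝ := fun x => (1 - 2 * a * x ^ 2) * Real.exp (-a * x ^ 2) with hψ'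
  have hexp : ∀ x : ℝ, HasDerivAt (fun x : ℝ => Real.exp (-a * x ^ 2))
      (Real.exp (-a * x ^ 2) * (-a * (2 * x))) x := fun x => by
    have := ((hasDerivAt_pow 2 x).const_mul (-a)).exp
    simpa using this
  have hψd : ∀ x, HasDerivAt (gaussWeight a) (ψ' x) x := fun x => by
    refine ((hasDerivAt_id x).mul (hexp x)).congr_deriv ?_
    simp only [hψ', id]; ring
  have hψdd : ∀ x, HasDerivAt ψ' ((-6 * a + 4 * a ^ 2 * x ^ 2) * gaussWeight a x) x := fun x => by
    have h1 : HasDerivAt (fun x : ℝ => 1 - 2 * a * x ^ 2) (-(2 * a * (2 * x))) x := by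
      simpa using ((hasDerivAt_pow 2 x).const_mul (2 * a)).const_sub 1
    refine (h1.mul (hexp x)).congr_deriv ?_
    rw [gaussWeight]; ring
  have hu'm : Measurable u' := by
    have : u' = deriv u := funext fun x => (hd x).deriv.symm
    rw [this]; exact measurable_deriv u
  have hu''m : Measurable u'' := by
    have : u'' = deriv u' := funext fun x => (hd' x).deriv.symm
    rw [this]; exact measurable_deriv u'
  have hum : Measurable u := hu.continuous.measurable
  have hψm : Measurable (gaussWeight a) := measurable_gaussWeight a
  have hψs : ContDiff ℝ ∞ (gaussWeight a) := by
    unfold gaussWeight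
    fun_prop
  -- The cutoff rises from 0 to 1 on [1/n, 2/n] and falls back to 0 on [n, 2n].
  set χ : ℕ → ℝ → ℝ := fun n x => u (n * x) * (1 - u (x / n)) with hχ
  set χ' : ℕ → ℝ → ℝ := fun n x =>
    n * u' (n * x) * (1 - u (x / n)) - u (n * x) * (u' (x / n) / n) with hχ'
  set χ'' : ℕ → ℝ → ℝ := fun n x => n ^ 2 * u'' (n * x) * (1 - u (x / n)) -
    2 * (u' (n * x) * u' (x / n)) - u (n * x) * (u'' (x / n) / n ^ 2) with hχ''
  -- The terms of the adjoint in which the cutoff is differentiated.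
  set E : ℕ → ℝ → ℝ := fun n x => 2 * χ' n x * ψ' x + χ'' n x * gaussWeight a x -
    κ / x * χ' n x * gaussWeight a x with hE
  -- The constant is P + Q, where P (the first three summands) controls the error near zero and Q
  -- (the rest) the error near infinity.
  refine ⟨χ, E, 2 * C * (1 + 8 * a) + 2 * C + |κ| * C + (2 * C * (1 + 2 * a) +
    (2 * C * C + C) + |κ| * C), by positivity, fun n hn => ?_⟩
  have hn1 : (1 : ℝ) ≤ n := by exact_mod_cast hn
  have hn0 : (0 : ℝ) < n := by linarith
  have hl : ∀ x : ℝ, HasDerivAt (fun x : ℝ => (n : ℝ) * x) n x := fun x => by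
    simpa using (hasDerivAt_id x).const_mul (n : ℝ)
  have hr : ∀ x : ℝ, HasDerivAt (fun x : ℝ => x / (n : ℝ)) (1 / n) x := fun x =>
    (hasDerivAt_id x).div_const (n : ℝ)
  have hχd : ∀ x, HasDerivAt (χ n) (χ' n x) x := fun x => by
    refine (((hd _).comp x (hl x)).mul (((hd _).comp x (hr x)).const_sub 1)).congr_deriv ?_
    simp only [hχ', Function.comp_apply]; ring
  have hχdd : ∀ x, HasDerivAt (χ' n) (χ'' n x) x := fun x => by
    refine (((((hd' _).comp x (hl x)).const_mul (n : ℝ)).mul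
      (((hd _).comp x (hr x)).const_sub 1)).sub (((hd _).comp x (hl x)).mul
      (((hd' _).comp x (hr x)).div_const (n : ℝ)))).congr_deriv ?_
    simp only [hχ'', Function.comp_apply]; field_simp; ring
  have hχs : Function.support (fun x => χ n x * gaussWeight a x) ⊆ Icc (1 / n) (2 * n) := by
    intro x hx
    by_contra hx'
    refine hx ?_
    simp only [hχ]
    by_cases hx1 : 1 / (n : ℝ) ≤ x
    · have hx2 : 2 * (n : ℝ) < x := by
        by_contra h
        exact hx' ⟨hx1, not_lt.1 h⟩
      rw [ho (x / n) (by rw [le_div_iff₀ hn0]; linarith)]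
      ring
    · rw [hz (n * x)]
      · ring
      · rw [not_le, lt_div_iff₀ hn0] at hx1
        linarith
  have hts : tsupport (fun x => χ n x * gaussWeight a x) ⊆ Icc (1 / n) (2 * n) :=
    closure_minimal hχs isClosed_Icc
  refine ⟨?_, ?_, ?_, by fun_prop, ?_, ?_, ?_, ?_, ?_⟩
  · refine ContDiff.mul (ContDiff.mul (hu.comp (by fun_prop)) ?_) hψs
    exact contDiff_const.sub (hu.comp (by fun_prop))
  · exact HasCompactSupport.intro isCompact_Icc fun x hx => Function.notMem_support.1
      fun h => hx (hχs h)
  · exact fun x hx => lt_of_lt_of_le (by positivity) (hts hx).1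
  · simp only [hE, hχ', hχ'', hψ']
    fun_prop
  · intro x
    have h1 := h01 (n * x)
    have h2 := h01 (x / n)
    rw [abs_of_nonneg (mul_nonneg h1.1 (by linarith [h2.2]))]
    exact mul_le_one₀ h1.2 (by linarith [h2.2]) (by linarith [h2.1])
  · rintro x ⟨h1, h2⟩
    rw [div_le_iff₀ hn0] at h1
    simp only [hχ]
    rw [ho _ (by linarith), hz _ (by rw [div_le_iff₀ hn0]; linarith)]
    ring
  · intro x hx
    rw [besselAdjoint_eq_of_hasDerivAt κ (φ := fun x => χ n x * gaussWeight a x) (φ' := fun x => χ' n x * gaussWeight a x + χ n x * ψ' x)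
      (φ'' := fun x => χ'' n x * gaussWeight a x + χ' n x * ψ' x + (χ' n x * ψ' x +
        χ n x * ((-6 * a + 4 * a ^ 2 * x ^ 2) * gaussWeight a x)))
      (fun x => (hχd x).mul (hψd x))
      (fun x => ((hχdd x).mul (hψd x)).add ((hχd x).mul (hψdd x)))]
    simp only [hE, gaussAdjoint, halfDim, hψ', gaussWeight]
    rw [show α = 1 - κ by rw [hκ]; ring]
    field_simp
    ring
  · intro x hx
    set i : ℝ := (Icc (1 / (n : ℝ)) (2 / n)).indicator (fun _ => (1 : ℝ)) x with hi
    set j : ℝ := (Ici (n : ℝ)).indicator (fun _ => (1 : ℝ)) x with hj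
    have hψ0 : 0 < gaussWeight a x := mul_pos hx (Real.exp_pos _)
    have he1 : Real.exp (-a * x ^ 2) ≤ 1 := Real.exp_le_one_iff.2 (by nlinarith [sq_nonneg x])
    have hψx : gaussWeight a x ≤ x := by
      rw [gaussWeight]; nlinarith
    have hψ'1 : |ψ' x| ≤ (1 + 2 * a * x ^ 2) * Real.exp (-a * x ^ 2) := by
      rw [hψ', abs_mul, abs_of_pos (Real.exp_pos _)]
      gcongr
      rw [abs_le]
      constructor <;> nlinarith [mul_pos ha (pow_pos hx 2)]
    have hIi : ∀ v : ℝ → ℝ, (∀ x, |v x| ≤ C) → (∀ x ∉ Icc (1 : ℝ) 2, v x = 0) →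
        |v (n * x)| ≤ C * i := by
      intro v hv hv0
      by_cases hx1 : x ∈ Icc (1 / (n : ℝ)) (2 / n)
      · rw [hi, indicator_of_mem hx1, mul_one]
        exact hv _
      · rw [hi, indicator_of_notMem hx1, hv0, abs_zero, mul_zero]
        rintro ⟨h1, h2⟩
        refine hx1 ⟨?_, ?_⟩
        · rw [div_le_iff₀ hn0]; linarith
        · rw [le_div_iff₀ hn0]; linarith
    have hIj : ∀ v : ℝ → ℝ, (∀ x, |v x| ≤ C) → (∀ x ∉ Icc (1 : ℝ) 2, v x = 0) →
        |v (x / n)| ≤ C * j := by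
      intro v hv hv0
      by_cases hx1 : x ∈ Ici (n : ℝ)
      · rw [hj, indicator_of_mem hx1, mul_one]
        exact hv _
      · rw [hj, indicator_of_notMem hx1, hv0, abs_zero, mul_zero]
        rintro ⟨h1, h2⟩
        refine hx1 ?_
        rw [le_div_iff₀ hn0] at h1
        exact mem_Ici.2 (by linarith)
    have hi0 : 0 ≤ i := indicator_nonneg (fun _ _ => zero_le_one) _
    have hj0 : 0 ≤ j := indicator_nonneg (fun _ _ => zero_le_one) _
    have hi1 : i ≤ 1 := indicator_le' (fun _ _ => le_rfl) (fun _ _ => zero_le_one) _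
    have hU : |1 - u (x / n)| ≤ 1 := by
      rw [abs_of_nonneg (by linarith [(h01 (x / n)).2])]; linarith [(h01 (x / n)).1]
    have hU' : |u (n * x)| ≤ 1 := by
      rw [abs_of_nonneg (h01 _).1]; exact (h01 _).2
    have hχ1 : |χ' n x| ≤ n * (C * i) + C * j := by
      have h1 : |n * u' (n * x) * (1 - u (x / n))| ≤ n * (C * i) := by
        rw [abs_mul, abs_mul, abs_of_pos hn0]
        have := hIi u' hb hs
        calc (n : ℝ) * |u' (n * x)| * |1 - u (x / n)| ≤ n * (C * i) * 1 := by gcongr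
          _ = _ := mul_one _
      have h2 : |u (n * x) * (u' (x / n) / n)| ≤ C * j := by
        rw [abs_mul, abs_div, abs_of_pos hn0]
        have := hIj u' hb hs
        calc |u (n * x)| * (|u' (x / n)| / n) ≤ 1 * (C * j / 1) := by gcongr
          _ = _ := by ring
      exact (abs_sub _ _).trans (add_le_add h1 h2)
    have hχ2 : |χ'' n x| ≤ n ^ 2 * (C * i) + (2 * C * C + C) * j := by
      have h1 : |n ^ 2 * u'' (n * x) * (1 - u (x / n))| ≤ n ^ 2 * (C * i) := by
        rw [abs_mul, abs_mul, abs_of_pos (pow_pos hn0 2)]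
        have := hIi u'' hb' hs'
        calc (n : ℝ) ^ 2 * |u'' (n * x)| * |1 - u (x / n)| ≤ n ^ 2 * (C * i) * 1 := by gcongr
          _ = _ := mul_one _
      have h2 : |u (n * x) * (u'' (x / n) / n ^ 2)| ≤ C * j := by
        rw [abs_mul, abs_div, abs_of_pos (pow_pos hn0 2)]
        have := hIj u'' hb' hs'
        calc |u (n * x)| * (|u'' (x / n)| / n ^ 2) ≤ 1 * (C * j / 1) := by
              gcongr; exact one_le_pow₀ hn1
          _ = _ := by ring
      have h3 : |2 * (u' (n * x) * u' (x / n))| ≤ 2 * C * C * j := by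
        rw [abs_mul, abs_mul, abs_two]
        have := hIj u' hb hs
        calc 2 * (|u' (n * x)| * |u' (x / n)|) ≤ 2 * (C * (C * j)) := by
              gcongr; exact hb _
          _ = _ := by ring
      calc |χ'' n x| ≤ n ^ 2 * (C * i) + 2 * C * C * j + C * j :=
            (abs_sub _ _).trans (add_le_add ((abs_sub _ _).trans (add_le_add h1 h3)) h2)
        _ = _ := by ring
    have hA : |E n x| ≤ 2 * |χ' n x| * |ψ' x| + |χ'' n x| * gaussWeight a x +
        |κ| * |χ' n x| * Real.exp (-a * x ^ 2) := by
      have e : κ / x * χ' n x * gaussWeight a x = κ * χ' n x * Real.exp (-a * x ^ 2) := by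
        rw [gaussWeight]; field_simp
      simp only [hE]
      rw [e]
      refine (abs_sub _ _).trans (add_le_add ((abs_add_le _ _).trans ?_) ?_)
      · rw [abs_mul (2 * χ' n x), abs_mul 2, abs_two, abs_mul (χ'' n x), abs_of_pos hψ0]
      · rw [abs_mul, abs_mul, abs_of_pos (Real.exp_pos _)]
    -- On [1/n, 2/n] the weight is at most x ≤ 2/n, which reduces the n² coming from χ'' to n;
    -- likewise the factor x of the weight has absorbed the singular coefficient κ/x.
    have hB : 2 * (n * (C * i)) * |ψ' x| + n ^ 2 * (C * i) * gaussWeight a x +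
        |κ| * (n * (C * i)) * Real.exp (-a * x ^ 2) ≤
        (2 * C * (1 + 8 * a) + 2 * C + |κ| * C) * (n * i) := by
      by_cases hx1 : x ∈ Icc (1 / (n : ℝ)) (2 / n)
      · have h2 : n * x ≤ 2 := by
          have := hx1.2
          rw [le_div_iff₀ hn0] at this
          linarith
        have h3 : x ≤ 2 := by nlinarith
        have h4 : |ψ' x| ≤ 1 + 8 * a := by
          refine hψ'1.trans ?_
          calc (1 + 2 * a * x ^ 2) * Real.exp (-a * x ^ 2) ≤ (1 + 2 * a * 2 ^ 2) * 1 := by gcongr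
            _ = _ := by ring
        have h5 : n * gaussWeight a x ≤ 2 := by nlinarith
        calc _ = C * (n * i) * (2 * |ψ' x| + n * gaussWeight a x +
              |κ| * Real.exp (-a * x ^ 2)) := by ring
          _ ≤ C * (n * i) * (2 * (1 + 8 * a) + 2 + |κ| * 1) := by gcongr
          _ = _ := by ring
      · have : i = 0 := by rw [hi, indicator_of_notMem hx1]
        rw [this]; simp
    have hD : 2 * (C * j) * |ψ' x| + (2 * C * C + C) * j * gaussWeight a x +
        |κ| * (C * j) * Real.exp (-a * x ^ 2) ≤
        (2 * C * (1 + 2 * a) + (2 * C * C + C) + |κ| * C) *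
          (j * ((1 + x ^ 2) * gaussWeight a x)) := by
      by_cases hx1 : x ∈ Ici (n : ℝ)
      · have h2 : 1 ≤ x := hn1.trans hx1
        have h3 : Real.exp (-a * x ^ 2) ≤ gaussWeight a x := by
          rw [gaussWeight]; nlinarith [Real.exp_pos (-a * x ^ 2)]
        have h6 : gaussWeight a x ≤ (1 + x ^ 2) * gaussWeight a x := by nlinarith [sq_nonneg x]
        have h4 : |ψ' x| ≤ (1 + 2 * a) * ((1 + x ^ 2) * gaussWeight a x) := by
          refine hψ'1.trans ?_
          rw [← mul_assoc]
          refine mul_le_mul ?_ h3 (Real.exp_pos _).le (by positivity)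
          nlinarith [sq_nonneg x]
        calc _ = j * (2 * C * |ψ' x| + (2 * C * C + C) * gaussWeight a x +
              |κ| * C * Real.exp (-a * x ^ 2)) := by ring
          _ ≤ j * (2 * C * ((1 + 2 * a) * ((1 + x ^ 2) * gaussWeight a x)) +
              (2 * C * C + C) * ((1 + x ^ 2) * gaussWeight a x) +
              |κ| * C * ((1 + x ^ 2) * gaussWeight a x)) := by
                gcongr
                exact h3.trans h6
          _ = _ := by ring
      · have : j = 0 := by rw [hj, indicator_of_notMem hx1]
        rw [this]; simp
    have hi' : (Icc (1 / (n : ℝ)) (2 / n)).indicator (fun _ => (n : ℝ)) x = n * i := by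
      rw [hi, ← indicator_const_mul]; simp
    have hj' : (Ici (n : ℝ)).indicator (fun x => (1 + x ^ 2) * gaussWeight a x) x =
        j * ((1 + x ^ 2) * gaussWeight a x) := by
      rw [hj]
      by_cases hx1 : x ∈ Ici (n : ℝ)
      · rw [indicator_of_mem hx1, indicator_of_mem hx1, one_mul]
      · rw [indicator_of_notMem hx1, indicator_of_notMem hx1, zero_mul]
    rw [hi', hj']
    set P := 2 * C * (1 + 8 * a) + 2 * C + |κ| * C with hP
    set Q := 2 * C * (1 + 2 * a) + (2 * C * C + C) + |κ| * C with hQ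
    have hP0 : 0 ≤ P := by positivity
    have hQ0 : 0 ≤ Q := by positivity
    have hw : 0 ≤ j * ((1 + x ^ 2) * gaussWeight a x) := by positivity
    have hv : 0 ≤ n * i := by positivity
    calc |E n x| ≤ 2 * (n * (C * i) + C * j) * |ψ' x| +
          (n ^ 2 * (C * i) + (2 * C * C + C) * j) * gaussWeight a x +
          |κ| * (n * (C * i) + C * j) * Real.exp (-a * x ^ 2) := by
            refine hA.trans ?_
            gcongr
      _ ≤ P * (n * i) + Q * (j * ((1 + x ^ 2) * gaussWeight a x)) := by linarith [hB, hD]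
      _ ≤ _ := by nlinarith

/-! ### Removal of the cutoff -/

theorem tendsto_integral_cutoff {w : ℝ → ℝ} {f : ℝ → ℂ} {χ : ℕ → ℝ → ℝ}
    (hi : Integrable (fun x => w x • f x) (volume.restrict (Ioi 0)))
    (hm : ∀ n, 1 ≤ n → Measurable (χ n)) (hb : ∀ n, 1 ≤ n → ∀ x, |χ n x| ≤ 1)
    (h1 : ∀ n : ℕ, 1 ≤ n → ∀ x ∈ Icc (2 / (n : ℝ)) n, χ n x = 1) :
    Tendsto (fun n => ∫ x in Ioi (0 : ℝ), (χ n x * w x) • f x) atTop (𝓝 (pair w f)) := by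
  refine tendsto_integral_filter_of_dominated_convergence (fun x => ‖w x • f x‖) ?_ ?_ hi.norm ?_
  · filter_upwards [eventually_ge_atTop 1] with n hn
    simp_rw [mul_smul]
    exact (hm n hn).aestronglyMeasurable.smul hi.1
  · filter_upwards [eventually_ge_atTop 1] with n hn
    refine Eventually.of_forall fun x => ?_
    rw [mul_smul, norm_smul]
    exact mul_le_of_le_one_left (norm_nonneg _) (hb n hn x)
  · filter_upwards [ae_restrict_mem measurableSet_Ioi] with x (hx : 0 < x)
    refine tendsto_const_nhds.congr' ?_
    obtain ⟨N, hN⟩ := exists_nat_ge (max x (2 / x))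
    filter_upwards [eventually_ge_atTop (max N 1)] with n hn
    have hn1 : 1 ≤ n := (le_max_right _ _).trans hn
    have hn' : (N : ℝ) ≤ n := by exact_mod_cast (le_max_left _ _).trans hn
    have hn0 : (0 : ℝ) < n := by exact_mod_cast hn1
    have hx1 : x ≤ n := (le_max_left _ _).trans (hN.trans hn')
    have hx2 : 2 / x ≤ n := (le_max_right _ _).trans (hN.trans hn')
    rw [h1 n hn1 x ⟨?_, hx1⟩, one_mul]
    rw [div_le_iff₀ hx] at hx2
    rw [div_le_iff₀ hn0]
    linarith

theorem tendsto_setLIntegral_Ici {h : ℝ → ℝ≥0∞} (hm : AEMeasurable h (volume.restrict (Ioi 0)))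
    (hfin : ∫⁻ x in Ioi (0 : ℝ), h x ≠ ⊤) :
    Tendsto (fun n : ℕ => ∫⁻ x in Ioi (0 : ℝ), (Ici (n : ℝ)).indicator h x) atTop (𝓝 0) := by
  have : Tendsto (fun n : ℕ => ∫⁻ x in Ioi (0 : ℝ), (Ici (n : ℝ)).indicator h x) atTop
      (𝓝 (∫⁻ _ in Ioi (0 : ℝ), 0)) := by
    refine tendsto_lintegral_of_dominated_convergence' h
      (fun n => hm.indicator measurableSet_Ici)
      (fun n => Eventually.of_forall fun x => indicator_le_self _ _ _) hfin
      (Eventually.of_forall fun x => ?_)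
    refine tendsto_const_nhds.congr' ?_
    obtain ⟨N, hN⟩ := exists_nat_gt x
    filter_upwards [eventually_ge_atTop N] with n hn
    have hn' : (N : ℝ) ≤ n := by exact_mod_cast hn
    rw [indicator_of_notMem]
    exact fun h => absurd (mem_Ici.1 h) (not_le.2 (hN.trans_le hn'))
  simpa using this

/-- The cut-off Gaussian weight is an admissible test function, and the adjoint of the full weight
is `gaussAdjoint`, of the same type without a singularity at zero. In the limit only the cutoff
error matters: at infinity it is the tail of a convergent integral, at zero it is a multiple of n
∫_{1/n}^{2/n} |f|, which vanishes by `h0`. -/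
theorem gaussODE_of_isBessel {α m : ℝ} (hm1 : m ≤ 1) {f g : ℝ → ℂ} (hf : MemLp f 1 (weight m))
    (hg : MemLp g 1 (weight m)) (h : IsBessel (1 - α) f g)
    (h0 : Tendsto (fun n : ℕ => (n : ℝ≥0∞) * ∫⁻ x in Icc (1 / (n : ℝ)) (2 / n), ‖f x‖ₑ) atTop
      (𝓝 0)) : GaussODE α f g := by
  intro a ha
  refine ⟨_, hasDerivAt_gaussTransform hm1 hf ha, ?_⟩
  obtain ⟨χ, E, C, hC, hχ⟩ := exists_gaussWeight_cutoff α ha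
  obtain ⟨B, hB0, hB⟩ := abs_sq_mul_gaussWeight_le hm1 ha
  have iψ := integrable_gaussWeight_smul hm1 ha hf
  have isq := integrable_pair (by fun_prop) hB hf
  have iG : Integrable (fun x => gaussAdjoint α a x • f x) (volume.restrict (Ioi 0)) := by
    refine ((iψ.smul (-(4 * a * halfDim α))).add (isq.smul (4 * a ^ 2))).congr
      (Eventually.of_forall fun x => ?_)
    simp only [Pi.add_apply, Pi.smul_apply, gaussAdjoint, add_smul, mul_smul]
  suffices key : pair (gaussWeight a) g = pair (gaussAdjoint α a) f by
    rw [gaussTransform, key, gaussTransform, pair, pair, pair, ← integral_const_mul,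
      ← integral_const_mul, ← integral_sub]
    · refine setIntegral_congr_fun measurableSet_Ioi fun x _ => ?_
      simp only [gaussAdjoint, Complex.real_smul]
      push_cast
      ring
    · exact iψ.const_mul _
    · refine Integrable.const_mul ?_ _
      simpa using isq.neg
  have T1 := tendsto_integral_cutoff (integrable_gaussWeight_smul hm1 ha hg)
    (fun n hn => (hχ n hn).2.2.2.1) (fun n hn => (hχ n hn).2.2.2.2.2.1)
    (fun n hn => (hχ n hn).2.2.2.2.2.2.1)
  have T2 := tendsto_integral_cutoff iG
    (fun n hn => (hχ n hn).2.2.2.1) (fun n hn => (hχ n hn).2.2.2.2.2.1)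
    (fun n hn => (hχ n hn).2.2.2.2.2.2.1)
  have T3 : Tendsto (fun n => ∫ x in Ioi (0 : ℝ), E n x • f x) atTop (𝓝 0) := by
    set H : ℝ → ℝ≥0∞ := fun x => ‖((1 + x ^ 2) * gaussWeight a x) • f x‖ₑ with hH
    have iH : Integrable (fun x => ((1 + x ^ 2) * gaussWeight a x) • f x)
        (volume.restrict (Ioi 0)) := by
      refine (iψ.add isq).congr (Eventually.of_forall fun x => ?_)
      simp only [Pi.add_apply, ← add_smul]
      congr 1
      ring
    have T4 := tendsto_setLIntegral_Ici iH.1.enorm iH.2.ne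
    have T5 := (ENNReal.Tendsto.const_mul (h0.add T4) (Or.inr (ENNReal.ofReal_ne_top (r := C))))
    rw [add_zero, mul_zero] at T5
    rw [tendsto_zero_iff_enorm_tendsto_zero]
    refine tendsto_of_tendsto_of_tendsto_of_le_of_le' tendsto_const_nhds T5
      (Eventually.of_forall fun _ => zero_le) ?_
    filter_upwards [eventually_ge_atTop 1] with n hn
    refine (enorm_integral_le_lintegral_enorm _).trans ?_
    have hEb := (hχ n hn).2.2.2.2.2.2.2.2
    have hn0 : (0 : ℝ) < n := by exact_mod_cast hn
    have hsub : Icc (1 / (n : ℝ)) (2 / n) ⊆ Ioi 0 := fun x hx =>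
      lt_of_lt_of_le (by positivity) hx.1
    have e1 : (n : ℝ≥0∞) * ∫⁻ x in Icc (1 / (n : ℝ)) (2 / n), ‖f x‖ₑ =
        ∫⁻ x in Ioi (0 : ℝ), (Icc (1 / (n : ℝ)) (2 / n)).indicator (fun x => n * ‖f x‖ₑ) x := by
      rw [lintegral_indicator measurableSet_Icc, Measure.restrict_restrict measurableSet_Icc,
        inter_eq_left.2 hsub, lintegral_const_mul' _ _ (ENNReal.natCast_ne_top n)]
    rw [e1, ← lintegral_add_right' _ (iH.1.enorm.indicator measurableSet_Ici),
      ← lintegral_const_mul' _ _ ENNReal.ofReal_ne_top]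
    refine setLIntegral_mono' measurableSet_Ioi fun x (hx : 0 < x) => ?_
    have hψ0 : 0 < gaussWeight a x := mul_pos hx (Real.exp_pos _)
    rw [enorm_smul]
    calc ‖E n x‖ₑ * ‖f x‖ₑ ≤ ENNReal.ofReal (C *
          ((Icc (1 / (n : ℝ)) (2 / n)).indicator (fun _ => (n : ℝ)) x +
          (Ici (n : ℝ)).indicator (fun x => (1 + x ^ 2) * gaussWeight a x) x)) * ‖f x‖ₑ := by
          gcongr
          rw [← ofReal_norm]
          exact ENNReal.ofReal_le_ofReal (hEb x hx)
      _ = _ := by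
          rw [ENNReal.ofReal_mul hC.le, mul_assoc]
          congr 1
          rw [ENNReal.ofReal_add, add_mul]
          · congr 1
            · by_cases hx1 : x ∈ Icc (1 / (n : ℝ)) (2 / n)
              · rw [indicator_of_mem hx1, indicator_of_mem hx1, ENNReal.ofReal_natCast]
              · rw [indicator_of_notMem hx1, indicator_of_notMem hx1, ENNReal.ofReal_zero, zero_mul]
            · by_cases hx1 : x ∈ Ici (n : ℝ)
              · rw [indicator_of_mem hx1, indicator_of_mem hx1, enorm_smul,
                  Real.enorm_eq_ofReal (by positivity)]
              · rw [indicator_of_notMem hx1, indicator_of_notMem hx1, ENNReal.ofReal_zero, zero_mul]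
          · exact indicator_nonneg (fun _ _ => hn0.le) _
          · refine indicator_apply_nonneg fun _ => by positivity
  refine tendsto_nhds_unique T1 ?_
  have T6 := T2.add T3
  rw [add_zero] at T6
  refine T6.congr' ?_
  filter_upwards [eventually_ge_atTop 1] with n hn
  obtain ⟨c1, c2, c3, c4, c5, c6, c7, c8, c9⟩ := hχ n hn
  have i1 := integrable_test_left (locallyIntegrableOn_of_memLp_weight hf) (1 - α) c1 c2 c3
  have i2 : Integrable (fun x => (χ n x * gaussAdjoint α a x) • f x)
      (volume.restrict (Ioi 0)) := by
    refine Integrable.mono iG ?_ (Eventually.of_forall fun x => ?_)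
    · simp_rw [mul_smul]
      exact c4.aestronglyMeasurable.smul iG.1
    · rw [mul_smul, norm_smul]
      exact mul_le_of_le_one_left (norm_nonneg _) (c6 x)
  have e : ∫ x in Ioi (0 : ℝ), E n x • f x = ∫ x in Ioi (0 : ℝ),
      (besselAdjoint (1 - α) (fun x => χ n x * gaussWeight a x) x • f x -
        (χ n x * gaussAdjoint α a x) • f x) := by
    refine setIntegral_congr_fun measurableSet_Ioi fun x hx => ?_
    rw [c8 x hx, ← sub_smul, add_sub_cancel_left]
  rw [e, integral_sub i1 i2, h _ c1 c2 c3, add_sub_cancel]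

/-- Integrability against `x ^ r` near zero for some `r ≤ -1` gives the averaged decay at zero. -/
theorem tendsto_average_of_memLp {r : ℝ} (hr : r ≤ -1) {f : ℝ → ℂ} (hf : MemLp f 1 (weight r)) :
    Tendsto (fun n : ℕ => (n : ℝ≥0∞) * ∫⁻ x in Icc (1 / (n : ℝ)) (2 / n), ‖f x‖ₑ) atTop
      (𝓝 0) := by
  obtain ⟨h1, h2⟩ := memLp_weight_iff.1 hf
  set H : ℝ → ℝ≥0∞ := fun x => ENNReal.ofReal (x ^ r) * ‖f x‖ₑ with hH
  have hHm : AEMeasurable H (volume.restrict (Ioi 0)) :=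
    AEMeasurable.mul (by fun_prop) h1.enorm
  have T : Tendsto (fun n : ℕ => 2 * ∫⁻ x in Ioi (0 : ℝ),
      (Icc (1 / (n : ℝ)) (2 / n)).indicator H x) atTop (𝓝 (2 * ∫⁻ _ in Ioi (0 : ℝ), 0)) := by
    refine ENNReal.Tendsto.const_mul ?_ (Or.inr (by simp))
    refine tendsto_lintegral_of_dominated_convergence' H
      (fun n => hHm.indicator measurableSet_Icc)
      (fun n => Eventually.of_forall fun x => indicator_le_self _ _ _) h2.ne ?_
    filter_upwards [ae_restrict_mem measurableSet_Ioi] with x (hx : 0 < x)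
    refine tendsto_const_nhds.congr' ?_
    obtain ⟨N, hN⟩ := exists_nat_gt (2 / x)
    filter_upwards [eventually_ge_atTop N] with n hn
    have hn' : (N : ℝ) ≤ n := by exact_mod_cast hn
    rw [indicator_of_notMem]
    intro h
    have h3 : 2 / x < n := hN.trans_le hn'
    have h4 : (0 : ℝ) < n := lt_trans (by positivity) h3
    have h5 := h.2
    rw [le_div_iff₀ h4] at h5
    rw [div_lt_iff₀ hx] at h3
    linarith
  rw [lintegral_zero, mul_zero] at T
  refine tendsto_of_tendsto_of_tendsto_of_le_of_le' tendsto_const_nhds T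
    (Eventually.of_forall fun _ => zero_le) ?_
  filter_upwards [eventually_ge_atTop 2] with n hn
  have hn2 : (2 : ℝ) ≤ n := by exact_mod_cast hn
  have hn0 : (0 : ℝ) < n := by linarith
  have hsub : Icc (1 / (n : ℝ)) (2 / n) ⊆ Ioi 0 := fun x hx =>
    lt_of_lt_of_le (by positivity) hx.1
  rw [lintegral_indicator measurableSet_Icc, Measure.restrict_restrict measurableSet_Icc,
    inter_eq_left.2 hsub, ← lintegral_const_mul' _ _ (ENNReal.natCast_ne_top n),
    ← lintegral_const_mul' _ _ (by simp)]
  refine setLIntegral_mono' measurableSet_Icc fun x hx => ?_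
  have hx0 : 0 < x := hsub hx
  simp only [hH]
  rw [← mul_assoc]
  gcongr
  rw [← ENNReal.ofReal_natCast, ← ENNReal.ofReal_ofNat, ← ENNReal.ofReal_mul (by norm_num)]
  refine ENNReal.ofReal_le_ofReal ?_
  have hx2 := hx.2
  have hx1 : x ≤ 1 := hx2.trans (by rw [div_le_one hn0]; exact hn2)
  rw [le_div_iff₀ hn0] at hx2
  -- On the interval n x ≤ 2; moreover x ≤ 1 because n ≥ 2, so x⁻¹ ≤ x^r for r ≤ -1.
  calc (n : ℝ) ≤ 2 * x⁻¹ := by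
        rw [← div_eq_mul_inv, le_div_iff₀ hx0]; linarith
    _ = 2 * x ^ (-1 : ℝ) := by rw [Real.rpow_neg_one]
    _ ≤ 2 * x ^ r := by
        gcongr 2 * ?_
        exact Real.rpow_le_rpow_of_exponent_ge hx0 hx1 hr

/-- The Dirichlet condition gives the averaged decay at zero. -/
theorem DirichletAtZero.tendsto_average {f : ℝ → ℂ} (hf : DirichletAtZero f) :
    Tendsto (fun n : ℕ => (n : ℝ≥0∞) * ∫⁻ x in Icc (1 / (n : ℝ)) (2 / n), ‖f x‖ₑ) atTop
      (𝓝 0) := by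
  obtain ⟨h, -, hfh, h0⟩ := hf
  refine ENNReal.tendsto_nhds_zero.2 fun ε hε => ?_
  rw [tendsto_zero_iff_enorm_tendsto_zero] at h0
  obtain ⟨δ, hδ, hδh⟩ := mem_nhdsGT_iff_exists_Ioo_subset.1 (ENNReal.tendsto_nhds_zero.1 h0 ε hε)
  obtain ⟨N, hN⟩ := exists_nat_gt (2 / δ)
  filter_upwards [eventually_ge_atTop N] with n hn
  have hδ' : (0 : ℝ) < δ := hδ
  have hn' : 2 / δ < n := hN.trans_le (by exact_mod_cast hn)
  have hn0 : (0 : ℝ) < n := lt_trans (by positivity) hn'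
  have hsub : Icc (1 / (n : ℝ)) (2 / n) ⊆ Ioi 0 := fun x hx =>
    lt_of_lt_of_le (by positivity) hx.1
  have hb : ∫⁻ x in Icc (1 / (n : ℝ)) (2 / n), ‖f x‖ₑ ≤
      ∫⁻ _ in Icc (1 / (n : ℝ)) (2 / n), ε := by
    refine lintegral_mono_ae ?_
    filter_upwards [ae_restrict_of_ae_restrict_of_subset hsub hfh,
      ae_restrict_mem measurableSet_Icc] with x hx hx1
    rw [hx]
    refine hδh ⟨hsub hx1, hx1.2.trans_lt ?_⟩
    rw [div_lt_iff₀ hn0]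
    rw [div_lt_iff₀ hδ'] at hn'
    linarith
  calc (n : ℝ≥0∞) * ∫⁻ x in Icc (1 / (n : ℝ)) (2 / n), ‖f x‖ₑ
      ≤ n * ∫⁻ _ in Icc (1 / (n : ℝ)) (2 / n), ε := by gcongr
    _ = ε * ENNReal.ofReal (n * (2 / n - 1 / n)) := by
        rw [setLIntegral_const, Real.volume_Icc, ENNReal.ofReal_mul hn0.le,
          ENNReal.ofReal_natCast]
        ring
    _ = ε := by
        rw [show (n : ℝ) * (2 / n - 1 / n) = 1 by field_simp; ring, ENNReal.ofReal_one, mul_one]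

/-! ### The resolvent kernel -/

/-- The profile `∫ exp (-t) heatProfile α t s dt` of the resolvent at `1`. -/
def resProfile (α s : ℝ) : ℝ :=
  (∫⁻ t in Ioi (0 : ℝ), ENNReal.ofReal (Real.exp (-t)) * ENNReal.ofReal (heatProfile α t s)).toReal

/-- The angular integral of the profile of the resolvent. -/
def resAngle (α x y : ℝ) : ℝ≥0∞ :=
  ∫⁻ t in Ioi (0 : ℝ), ENNReal.ofReal (Real.exp (-t)) * heatAngle α t x y

/-- The kernel of the resolvent at `1`. -/
def resKernel (α : ℝ) : ℝ → ℝ → ℂ := profileKernel α fun s => (resProfile α s : ℂ)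

theorem resAngle_comm (α x y : ℝ) : resAngle α x y = resAngle α y x := by
  simp only [resAngle, heatAngle_comm α _ x y]

theorem measurable_resProfile (α : ℝ) : Measurable (resProfile α) := by
  refine Measurable.ennreal_toReal (Measurable.lintegral_prod_right' (f := fun p : ℝ × ℝ =>
    ENNReal.ofReal (Real.exp (-p.2)) * ENNReal.ofReal (heatProfile α p.2 p.1)) ?_)
  unfold heatProfile; fun_prop

theorem measurable_heatAngle_time (α x y : ℝ) : Measurable fun t => heatAngle α t x y := by
  refine Measurable.lintegral_prod_right' (f := fun q : ℝ × ℝ =>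
    ENNReal.ofReal (heatProfile α q.1 (distSq x y q.2))) ?_
  unfold heatProfile distSq
  fun_prop

theorem lintegral_mul_resAngle (α y : ℝ) {W : ℝ → ℝ≥0∞} (hW : Measurable W) :
    ∫⁻ x in Ioi (0 : ℝ), W x * resAngle α y x =
      ∫⁻ t in Ioi (0 : ℝ), ENNReal.ofReal (Real.exp (-t)) *
        ∫⁻ x in Ioi (0 : ℝ), W x * heatAngle α t y x := by
  have hm : Measurable fun p : ℝ × ℝ => heatAngle α p.2 y p.1 :=
    (measurable_heatAngle α).comp (by fun_prop : Measurable fun p : ℝ × ℝ => (p.2, y, p.1))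
  have e1 : ∀ x, W x * resAngle α y x = ∫⁻ t in Ioi (0 : ℝ),
      W x * (ENNReal.ofReal (Real.exp (-t)) * heatAngle α t y x) := fun x => by
    have hm2 := measurable_heatAngle_time α y x
    have hm3 : Measurable fun t : ℝ => ENNReal.ofReal (Real.exp (-t)) := by fun_prop
    exact (lintegral_const_mul (W x) (hm3.mul hm2)).symm
  simp_rw [e1]
  rw [lintegral_lintegral_swap]
  · refine lintegral_congr fun t => ?_
    rw [← lintegral_const_mul' _ _ ENNReal.ofReal_ne_top]
    exact lintegral_congr fun x => by ring
  · refine Measurable.aemeasurable ?_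
    have hm3 : Measurable fun p : ℝ × ℝ => ENNReal.ofReal (Real.exp (-p.2)) := by fun_prop
    exact (hW.comp measurable_fst).mul (hm3.mul hm)

/-- The Green function of dimension d = α + 2 has size |distance|^{-(d-2)} = σ^{-α/2}. The time
integral is split at t = σ: below it the exponential compensates the factor t^{-d/2}, above it that
factor is integrable. -/
theorem exists_lintegral_heatProfile_le {α : ℝ} (hα : 0 < α) :
    ∃ C : ℝ, 0 < C ∧ ∀ σ : ℝ, 0 < σ →
      ∫⁻ t in Ioi (0 : ℝ), ENNReal.ofReal (Real.exp (-t)) * ENNReal.ofReal (heatProfile α t σ) ≤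
        ENNReal.ofReal (C * σ ^ (-(α / 2))) := by
  have hc := heatConst_pos hα
  have hδ : halfDim α = α / 2 + 1 := rfl
  obtain ⟨B, hB0, hB⟩ := exists_rpow_mul_exp_neg_le (c := halfDim α) (by rw [hδ]; linarith)
  refine ⟨(heatConst α)⁻¹ * B + (heatConst α)⁻¹ * (4 ^ (-halfDim α) * (2 / α)), by positivity,
    fun σ hσ => ?_⟩
  have h1 : ∀ t ∈ Ioi (0 : ℝ), ENNReal.ofReal (Real.exp (-t)) * ENNReal.ofReal (heatProfile α t σ) ≤
      ENNReal.ofReal (heatProfile α t σ) := fun t (ht : 0 < t) =>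
    mul_le_of_le_one_left' (ENNReal.ofReal_le_one.2 (Real.exp_le_one_iff.2 (by linarith)))
  refine (setLIntegral_mono' measurableSet_Ioi h1).trans ?_
  rw [← Ioc_union_Ioi_eq_Ioi hσ.le, lintegral_union measurableSet_Ioi
    (Set.disjoint_left.2 fun x hx hx' => not_lt.2 hx.2 hx'), add_mul,
    ENNReal.ofReal_add (by positivity) (by positivity)]
  refine add_le_add ?_ ?_
  · have h2 : ∀ t ∈ Ioc 0 σ, ENNReal.ofReal (heatProfile α t σ) ≤
        ENNReal.ofReal ((heatConst α)⁻¹ * B * σ ^ (-halfDim α)) := by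
      rintro t ⟨ht, -⟩
      refine ENNReal.ofReal_le_ofReal ?_
      have h3 := hB (σ / (4 * t)) (by positivity)
      rw [Real.div_rpow hσ.le (by positivity), div_mul_eq_mul_div,
        div_le_iff₀ (by positivity)] at h3
      rw [heatProfile, Real.rpow_neg (by positivity), Real.rpow_neg hσ.le, mul_assoc, mul_assoc]
      refine mul_le_mul_of_nonneg_left ?_ (by positivity)
      rw [inv_mul_eq_div, div_le_iff₀ (by positivity), ← div_eq_mul_inv, div_mul_eq_mul_div,
        le_div_iff₀ (by positivity)]
      linarith
    refine (setLIntegral_mono' measurableSet_Ioc h2).trans ?_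
    rw [setLIntegral_const, Real.volume_Ioc, sub_zero, ← ENNReal.ofReal_mul (by positivity)]
    refine ENNReal.ofReal_le_ofReal (le_of_eq ?_)
    rw [mul_assoc, ← Real.rpow_add_one hσ.ne', hδ]
    congr 2; ring
  · have h2 : ∀ t ∈ Ioi σ, ENNReal.ofReal (heatProfile α t σ) ≤
        ENNReal.ofReal ((heatConst α)⁻¹ * 4 ^ (-halfDim α) * t ^ (-halfDim α)) := by
      intro t (ht : σ < t)
      have ht0 : 0 < t := hσ.trans ht
      refine ENNReal.ofReal_le_ofReal ?_
      rw [heatProfile, mul_assoc ((heatConst α)⁻¹) (4 ^ _), ← Real.mul_rpow (by norm_num) ht0.le]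
      refine mul_le_of_le_one_right (by positivity) (Real.exp_le_one_iff.2 ?_)
      rw [Left.neg_nonpos_iff]
      positivity
    refine (setLIntegral_mono' measurableSet_Ioi h2).trans ?_
    have hd1 : -halfDim α < -1 := by rw [hδ]; linarith
    rw [← ofReal_integral_eq_lintegral_ofReal
      ((integrableOn_Ioi_rpow_of_lt hd1 hσ).const_mul _)
      (by filter_upwards [ae_restrict_mem measurableSet_Ioi] with t (ht : σ < t)
          have := hσ.trans ht
          positivity), integral_const_mul, integral_Ioi_rpow_of_lt hd1 hσ]
    refine ENNReal.ofReal_le_ofReal (le_of_eq ?_)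
    rw [show -halfDim α + 1 = -(α / 2) by rw [hδ]; ring]
    field_simp

theorem lintegral_heatProfile_ne_top {α : ℝ} (hα : 0 < α) {σ : ℝ} (hσ : 0 < σ) :
    ∫⁻ t in Ioi (0 : ℝ), ENNReal.ofReal (Real.exp (-t)) * ENNReal.ofReal (heatProfile α t σ) ≠ ⊤ := by
  obtain ⟨C, -, hC⟩ := exists_lintegral_heatProfile_le hα
  exact ne_top_of_le_ne_top ENNReal.ofReal_ne_top (hC σ hσ)

theorem continuousAt_resProfile {α : ℝ} (hα : 0 < α) {σ : ℝ} (hσ : 0 < σ) :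
    ContinuousAt (resProfile α) σ := by
  refine (ENNReal.tendsto_toReal (lintegral_heatProfile_ne_top hα hσ)).comp ?_
  refine tendsto_lintegral_filter_of_dominated_convergence (fun t =>
    ENNReal.ofReal (Real.exp (-t)) * ENNReal.ofReal (heatProfile α t (σ / 2))) ?_ ?_
    (lintegral_heatProfile_ne_top hα (half_pos hσ)) ?_
  · refine Eventually.of_forall fun s => Measurable.mul (by fun_prop) (Measurable.ennreal_ofReal ?_)
    exact (measurable_heatProfile α).comp (by fun_prop : Measurable fun t : ℝ => (t, s))
  · filter_upwards [Ioi_mem_nhds (half_lt_self hσ)] with s (hs : σ / 2 < s)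
    filter_upwards [ae_restrict_mem measurableSet_Ioi] with t (ht : 0 < t)
    have := heatConst_pos hα
    refine mul_le_mul_right (ENNReal.ofReal_le_ofReal ?_) _
    rw [heatProfile, heatProfile]
    gcongr
  · refine Eventually.of_forall fun t => ?_
    refine ENNReal.Tendsto.const_mul ?_ (Or.inr ENNReal.ofReal_ne_top)
    exact ENNReal.tendsto_ofReal ((continuous_heatProfile α t).tendsto σ)

theorem ae_sin_ne_zero {α : ℝ} : ∀ᵐ φ ∂angMeasure α, Real.sin φ ≠ 0 := by
  refine (withDensity_absolutelyContinuous _ _).ae_le ?_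
  have h0 : ∀ᵐ φ : ℝ ∂volume.restrict (Ioo (-Real.pi) Real.pi), φ ≠ 0 :=
    ae_restrict_of_ae (by simp [ae_iff])
  filter_upwards [h0, ae_restrict_mem measurableSet_Ioo] with φ h1 h2 h3
  exact h1 ((Real.sin_eq_zero_iff_of_lt_of_lt h2.1 h2.2).1 h3)

/-- The singular factor cancels the density |sin φ|^α of the angular measure. -/
theorem lintegral_abs_sin_rpow_neg_le (α : ℝ) :
    ∫⁻ φ, ENNReal.ofReal (|Real.sin φ| ^ (-α)) ∂angMeasure α ≤ ENNReal.ofReal (2 * Real.pi) := by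
  rw [lintegral_angMeasure α (by fun_prop)]
  refine (lintegral_mono (g := fun _ => 1) fun φ => ?_).trans ?_
  · rw [← ENNReal.ofReal_mul (by positivity), Real.rpow_neg (abs_nonneg _)]
    exact ENNReal.ofReal_le_one.2 mul_inv_le_one
  · rw [setLIntegral_one, Real.volume_Ioo]
    exact ENNReal.ofReal_le_ofReal (by linarith)

theorem rpow_distSq_le {α x y φ : ℝ} (hα : 0 < α) (hy : 0 < y) (hφ : Real.sin φ ≠ 0) :
    distSq x y φ ^ (-(α / 2)) ≤ y ^ (-α) * |Real.sin φ| ^ (-α) := by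
  have h1 : 0 < (y * |Real.sin φ|) ^ 2 := by positivity
  have h2 : (y * |Real.sin φ|) ^ 2 ≤ distSq x y φ := by
    rw [mul_pow, sq_abs, ← mul_pow]
    exact sq_mul_sin_le_distSq x y φ
  calc distSq x y φ ^ (-(α / 2)) ≤ ((y * |Real.sin φ|) ^ 2) ^ (-(α / 2)) :=
        Real.rpow_le_rpow_of_nonpos h1 h2 (by linarith)
    _ = (y * |Real.sin φ|) ^ (-α) := by
        rw [← Real.rpow_natCast, ← Real.rpow_mul (by positivity)]
        congr 1; push_cast; ring
    _ = _ := Real.mul_rpow hy.le (abs_nonneg _)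

theorem distSq_pos {x y φ : ℝ} (hy : 0 < y) (hφ : Real.sin φ ≠ 0) : 0 < distSq x y φ :=
  (by positivity : 0 < (y * Real.sin φ) ^ 2).trans_le (sq_mul_sin_le_distSq x y φ)

theorem lintegral_resProfile_distSq {α : ℝ} (hα : 0 < α) (x : ℝ) {y : ℝ} (hy : 0 < y) :
    ∫⁻ φ, ENNReal.ofReal (resProfile α (distSq x y φ)) ∂angMeasure α = resAngle α x y := by
  have e : ∀ᵐ φ ∂angMeasure α, ENNReal.ofReal (resProfile α (distSq x y φ)) =
      ∫⁻ t in Ioi (0 : ℝ), ENNReal.ofReal (Real.exp (-t)) *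
        ENNReal.ofReal (heatProfile α t (distSq x y φ)) := by
    filter_upwards [ae_sin_ne_zero] with φ hφ
    exact ENNReal.ofReal_toReal (lintegral_heatProfile_ne_top hα (distSq_pos hy hφ))
  rw [lintegral_congr_ae e, lintegral_lintegral_swap]
  · exact lintegral_congr fun t => lintegral_const_mul' _ _ ENNReal.ofReal_ne_top
  · refine Measurable.aemeasurable ?_
    unfold heatProfile distSq
    fun_prop

theorem exists_resProfile_le {α : ℝ} (hα : 0 < α) :
    ∃ C : ℝ, 0 < C ∧ ∀ x y φ : ℝ, 0 < y → Real.sin φ ≠ 0 →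
      resProfile α (distSq x y φ) ≤ C * y ^ (-α) * |Real.sin φ| ^ (-α) := by
  obtain ⟨C, hC0, hC⟩ := exists_lintegral_heatProfile_le hα
  refine ⟨C, hC0, fun x y φ hy hφ => ?_⟩
  have hd := distSq_pos (x := x) hy hφ
  have h1 : resProfile α (distSq x y φ) ≤ C * distSq x y φ ^ (-(α / 2)) :=
    ENNReal.toReal_le_of_le_ofReal (by positivity) (hC _ hd)
  refine h1.trans ?_
  rw [mul_assoc]
  gcongr
  exact rpow_distSq_le hα hy hφ

/-- The squared distance is at least (y sin φ)², so the singularity of the profile is at worst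
(y|sin φ|)^{-α}, which the angular measure integrates. The bound is uniform in x, including the
diagonal; by symmetry y^{-α} may be replaced by x^{-α}. -/
theorem exists_resAngle_le {α : ℝ} (hα : 0 < α) :
    ∃ C : ℝ, 0 < C ∧ ∀ x y : ℝ, 0 < y → resAngle α x y ≤ ENNReal.ofReal (C * y ^ (-α)) := by
  obtain ⟨C, hC0, hC⟩ := exists_resProfile_le hα
  have hpi := Real.pi_pos
  refine ⟨C * (2 * Real.pi), by positivity, fun x y hy => ?_⟩
  rw [← lintegral_resProfile_distSq hα x hy]
  calc ∫⁻ φ, ENNReal.ofReal (resProfile α (distSq x y φ)) ∂angMeasure α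
      ≤ ∫⁻ φ, ENNReal.ofReal (C * y ^ (-α)) * ENNReal.ofReal (|Real.sin φ| ^ (-α))
          ∂angMeasure α := by
        refine lintegral_mono_ae ?_
        filter_upwards [ae_sin_ne_zero] with φ hφ
        rw [← ENNReal.ofReal_mul (by positivity)]
        exact ENNReal.ofReal_le_ofReal (hC x y φ hy hφ)
    _ ≤ ENNReal.ofReal (C * y ^ (-α)) * ENNReal.ofReal (2 * Real.pi) := by
        rw [lintegral_const_mul' _ _ ENNReal.ofReal_ne_top]
        gcongr
        exact lintegral_abs_sin_rpow_neg_le α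
    _ = _ := by
        rw [← ENNReal.ofReal_mul (by positivity)]
        congr 1; ring

theorem resAngle_ne_top {α : ℝ} (hα : 0 < α) (x : ℝ) {y : ℝ} (hy : 0 < y) : resAngle α x y ≠ ⊤ := by
  obtain ⟨C, -, hC⟩ := exists_resAngle_le hα
  exact ne_top_of_le_ne_top ENNReal.ofReal_ne_top (hC x y hy)

theorem measurable_resKernel (α : ℝ) : Measurable (Function.uncurry (resKernel α)) :=
  measurable_profileKernel α (Complex.measurable_ofReal.comp (measurable_resProfile α))

theorem resKernel_eq {α : ℝ} (hα : 0 < α) (x : ℝ) {y : ℝ} (hy : 0 < y) :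
    resKernel α x y = ((x ^ α * y * (resAngle α x y).toReal : ℝ) : ℂ) := by
  have hm : Measurable fun φ => resProfile α (distSq x y φ) :=
    (measurable_resProfile α).comp (by unfold distSq; fun_prop)
  have e : ∫ φ, resProfile α (distSq x y φ) ∂angMeasure α =
      (∫⁻ φ, ENNReal.ofReal (resProfile α (distSq x y φ)) ∂angMeasure α).toReal :=
    integral_eq_lintegral_of_nonneg_ae (Eventually.of_forall fun φ => ENNReal.toReal_nonneg)
      hm.aestronglyMeasurable
  rw [resKernel, profileKernel, integral_complex_ofReal, e, lintegral_resProfile_distSq hα x hy,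
    ← Complex.ofReal_mul]

theorem enorm_resKernel {α : ℝ} (hα : 0 < α) {x y : ℝ} (hx : 0 < x) (hy : 0 < y) :
    ‖resKernel α x y‖ₑ = ENNReal.ofReal y * (ENNReal.ofReal (x ^ α) * resAngle α x y) := by
  rw [resKernel_eq hα x hy, ← ofReal_norm, Complex.norm_real, Real.norm_of_nonneg (by positivity),
    ENNReal.ofReal_mul (by positivity), ENNReal.ofReal_toReal (resAngle_ne_top hα x hy),
    ENNReal.ofReal_mul (by positivity)]
  ring

/-! ### Mapping properties of the resolvent between weighted spaces -/

theorem kernelBound_resKernel {α r m C : ℝ} (hα : 0 < α)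
    (h : ∀ y : ℝ, 0 < y → ∫⁻ t in Ioi (0 : ℝ), ENNReal.ofReal (Real.exp (-t)) *
      ∫⁻ x in Ioi (0 : ℝ), ENNReal.ofReal (x ^ (α + r)) * heatAngle α t y x ≤
        ENNReal.ofReal (C * y ^ (m - 1))) :
    KernelBound r m C (resKernel α) := by
  refine ⟨measurable_resKernel α, fun y hy => ?_⟩
  have e : ∀ x ∈ Ioi (0 : ℝ), ENNReal.ofReal (x ^ r) * ‖resKernel α x y‖ₑ =
      ENNReal.ofReal y * (ENNReal.ofReal (x ^ (α + r)) * resAngle α y x) := by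
    intro x (hx : 0 < x)
    rw [enorm_resKernel hα hx hy, Real.rpow_add hx, ENNReal.ofReal_mul (by positivity),
      resAngle_comm]
    ring
  rw [setLIntegral_congr_fun measurableSet_Ioi e, lintegral_const_mul' _ _ ENNReal.ofReal_ne_top,
    lintegral_mul_resAngle α y (by fun_prop)]
  grw [h y hy]
  rw [← ENNReal.ofReal_mul hy.le, Real.rpow_sub_one hy.ne']
  refine ENNReal.ofReal_le_ofReal (le_of_eq ?_)
  field_simp

theorem exists_kernelBound_resKernel_self {α m : ℝ} (hα : 0 < α) (hm : -1 - α < m) (hm1 : m ≤ 1) :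
    ∃ C : ℝ, KernelBound m m C (resKernel α) := by
  obtain ⟨M, hM0, -, hM⟩ := exists_moment_bound hα hm hm1
  refine ⟨M, kernelBound_resKernel hα fun y hy => ?_⟩
  calc ∫⁻ t in Ioi (0 : ℝ), ENNReal.ofReal (Real.exp (-t)) *
        ∫⁻ x in Ioi (0 : ℝ), ENNReal.ofReal (x ^ (α + m)) * heatAngle α t y x
      ≤ ∫⁻ t in Ioi (0 : ℝ), ENNReal.ofReal (Real.exp (-t)) * ENNReal.ofReal (M * y ^ (m - 1)) := by
        refine setLIntegral_mono' measurableSet_Ioi fun t (ht : 0 < t) => ?_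
        exact mul_le_mul_right (hM t y ht hy) _
    _ = ENNReal.ofReal (M * y ^ (m - 1)) := by
        rw [lintegral_mul_const' _ _ ENNReal.ofReal_ne_top, ← ofReal_integral_eq_lintegral_ofReal
          (integrableOn_exp_neg_Ioi 0) (Eventually.of_forall fun t => (Real.exp_pos _).le),
          integral_exp_neg_Ioi_zero, ENNReal.ofReal_one, one_mul]

/-- With a = 1 - m and b = 1 - r, the conditions are those of the moment estimate for the resolvent.
At m = 1 one has a = 0, and b < 2 becomes -1 < r, whence the open endpoint -1 in the domain. -/
theorem exists_kernelBound_resKernel {α r m : ℝ} (hα : 0 < α) (hr : r < 1) (hrα : -1 - α < r)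
    (hrm : r ≤ m) (hmr : m ≤ r + 2) (h : m < 1 ∨ m = 1 ∧ -1 < r) :
    ∃ C : ℝ, KernelBound r m C (resKernel α) := by
  obtain ⟨C, -, hC⟩ := exists_lintegral_exp_neg_rpow_heatAngle_le (a := 1 - m) (b := 1 - r) hα
    (by linarith) (by linarith) (by linarith) (by linarith)
    (h.imp (fun h => by linarith) fun h => ⟨by linarith [h.1], by linarith [h.2]⟩)
  refine ⟨C, kernelBound_resKernel hα fun y hy => ?_⟩
  have := hC y hy
  rwa [show α + 1 - (1 - r) = α + r by ring, show -(1 - m) = m - 1 by ring] at this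

/-! ### The resolvent inverts the transformed equation -/

theorem integral_gaussWeight_resKernel {α a y : ℝ} (hα : 0 < α) (ha : 0 ≤ a) (hy : 0 < y) :
    ∫ x in Ioi (0 : ℝ), gaussWeight a x • resKernel α x y =
      ∫ t in Ioi (0 : ℝ), ((Real.exp (-t) * ((1 + 4 * a * t) ^ (-halfDim α) *
        gaussWeight (a / (1 + 4 * a * t)) y) : ℝ) : ℂ) := by
  have h1 : ∀ x ∈ Ioi (0 : ℝ), gaussWeight a x • resKernel α x y =
      ((y * (ENNReal.ofReal (x ^ (α + 1) * Real.exp (-a * x ^ 2)) *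
          resAngle α y x).toReal : ℝ) : ℂ) := by
    intro x (hx : 0 < x)
    rw [resKernel_eq hα x hy, ENNReal.toReal_mul, ENNReal.toReal_ofReal (by positivity),
      resAngle_comm, Complex.real_smul, ← Complex.ofReal_mul, gaussWeight,
      Real.rpow_add_one hx.ne']
    congr 1
    ring
  have hm : Measurable fun x => resAngle α y x := by
    refine Measurable.lintegral_prod_right' (f := fun p : ℝ × ℝ =>
      ENNReal.ofReal (Real.exp (-p.2)) * heatAngle α p.2 y p.1) (Measurable.mul (by fun_prop) ?_)
    exact (measurable_heatAngle α).comp (by fun_prop : Measurable fun p : ℝ × ℝ => (p.2, y, p.1))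
  have e : ∀ t ∈ Ioi (0 : ℝ), ENNReal.ofReal (Real.exp (-t)) * ∫⁻ x in Ioi (0 : ℝ),
      ENNReal.ofReal (x ^ (α + 1) * Real.exp (-a * x ^ 2)) * heatAngle α t y x =
      ENNReal.ofReal (Real.exp (-t) * ((1 + 4 * a * t) ^ (-halfDim α) *
        Real.exp (-(a / (1 + 4 * a * t)) * y ^ 2))) := by
    intro t ht
    rw [lintegral_gaussian_heatAngle hα ha ht, ← ENNReal.ofReal_mul (Real.exp_pos _).le]
  rw [setIntegral_congr_fun measurableSet_Ioi h1, integral_complex_ofReal, integral_const_mul,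
    integral_toReal, lintegral_mul_resAngle α y (by fun_prop),
    setLIntegral_congr_fun measurableSet_Ioi e, integral_complex_ofReal,
    ← integral_eq_lintegral_of_nonneg_ae, ← integral_const_mul]
  · congr 1
    refine integral_congr_ae (Eventually.of_forall fun t => ?_)
    simp only [gaussWeight]
    ring
  · filter_upwards [ae_restrict_mem measurableSet_Ioi] with t (ht : 0 < t)
    positivity
  · exact Measurable.aestronglyMeasurable (by fun_prop)
  · exact (Measurable.mul (by fun_prop) hm).aemeasurable
  · filter_upwards [ae_restrict_mem measurableSet_Ioi] with x (hx : 0 < x)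
    exact ENNReal.mul_lt_top ENNReal.ofReal_lt_top (resAngle_ne_top hα y hx).lt_top

/-- The total power of 1+4at is -d/2 + (1-m)/2, which is negative because m > -1 - α. This makes the
transported weights bounded uniformly in time. -/
theorem exists_abs_transport_gaussWeight_le {α m : ℝ} (hm : -1 - α < m) (hm1 : m ≤ 1) {a : ℝ}
    (ha : 0 < a) : ∃ B : ℝ, 0 < B ∧ ∀ t y : ℝ, 0 ≤ t → 0 < y →
      |(1 + 4 * a * t) ^ (-halfDim α) * gaussWeight (a / (1 + 4 * a * t)) y| ≤ B * y ^ m := by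
  obtain ⟨B, hB0, hB⟩ := exists_abs_gaussWeight_le hm1
  refine ⟨B * a ^ (-((1 - m) / 2)), by positivity, fun t y ht hy => ?_⟩
  have h1 : 0 < 1 + 4 * a * t := by positivity
  have h2 : 1 ≤ 1 + 4 * a * t := by
    have : 0 ≤ 4 * a * t := by positivity
    linarith
  rw [abs_mul, abs_of_pos (by positivity)]
  calc (1 + 4 * a * t) ^ (-halfDim α) * |gaussWeight (a / (1 + 4 * a * t)) y|
      ≤ (1 + 4 * a * t) ^ (-halfDim α) *
        (B * (a / (1 + 4 * a * t)) ^ (-((1 - m) / 2)) * y ^ m) := by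
        gcongr
        exact hB _ y (by positivity) hy
    _ = (1 + 4 * a * t) ^ (-halfDim α + (1 - m) / 2) *
        (B * a ^ (-((1 - m) / 2)) * y ^ m) := by
        rw [Real.div_rpow ha.le h1.le, Real.rpow_neg h1.le ((1 - m) / 2), Real.rpow_add h1]
        field_simp
    _ ≤ 1 * (B * a ^ (-((1 - m) / 2)) * y ^ m) := by
        gcongr
        exact Real.rpow_le_one_of_one_le_of_nonpos h2 (by rw [halfDim]; linarith)
    _ = _ := one_mul _

theorem gaussTransform_resKernel {α m : ℝ} (hα : 0 < α) (hm : -1 - α < m) (hm1 : m ≤ 1)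
    {h : ℝ → ℂ} (hh : MemLp h 1 (weight m)) {a : ℝ} (ha : 0 < a) :
    gaussTransform a (kerFun (resKernel α) h) = ∫ t in Ioi (0 : ℝ), (Real.exp (-t) : ℂ) *
      (((1 + 4 * a * t) ^ (-halfDim α) : ℝ) * gaussTransform (a / (1 + 4 * a * t)) h) := by
  obtain ⟨C, hC⟩ := exists_kernelBound_resKernel_self hα hm hm1
  obtain ⟨B, -, hB⟩ := exists_abs_gaussWeight_le hm1
  obtain ⟨B', hB'0, hB'⟩ := exists_abs_transport_gaussWeight_le hm hm1 ha
  obtain ⟨hh1, hh2⟩ := memLp_weight_iff.1 hh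
  rw [gaussTransform, hC.pair_kerFun hh (measurable_gaussWeight a) (fun x hx => hB a x ha hx)]
  set w : ℝ → ℝ → ℝ := fun t y =>
    (1 + 4 * a * t) ^ (-halfDim α) * gaussWeight (a / (1 + 4 * a * t)) y with hw
  have e1 : ∀ y ∈ Ioi (0 : ℝ), (∫ x in Ioi (0 : ℝ), gaussWeight a x • resKernel α x y) * h y =
      ∫ t in Ioi (0 : ℝ), (Real.exp (-t) * w t y : ℝ) • h y := by
    intro y hy
    rw [integral_gaussWeight_resKernel hα ha.le hy, ← integral_mul_const]
    rfl
  rw [setIntegral_congr_fun measurableSet_Ioi e1, integral_integral_swap]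
  · refine integral_congr_ae (Eventually.of_forall fun t => ?_)
    simp only [hw, gaussTransform, pair, ← integral_const_mul]
    refine integral_congr_ae (Eventually.of_forall fun y => ?_)
    simp only [Complex.real_smul]
    push_cast
    ring
  · have hwm : Measurable fun p : ℝ × ℝ => Real.exp (-p.2) * w p.2 p.1 := by
      simp only [hw, gaussWeight]
      fun_prop
    have hm : AEStronglyMeasurable (Function.uncurry fun y t => (Real.exp (-t) * w t y : ℝ) • h y)
        ((volume.restrict (Ioi (0 : ℝ))).prod (volume.restrict (Ioi (0 : ℝ)))) :=
      hwm.aestronglyMeasurable.smul hh1.comp_fst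
    refine ⟨hm, ?_⟩
    rw [hasFiniteIntegral_iff_enorm, lintegral_prod _ hm.enorm]
    calc ∫⁻ y in Ioi (0 : ℝ), ∫⁻ t in Ioi (0 : ℝ), ‖(Real.exp (-t) * w t y : ℝ) • h y‖ₑ
        ≤ ∫⁻ y in Ioi (0 : ℝ), ∫⁻ t in Ioi (0 : ℝ), ENNReal.ofReal (Real.exp (-t)) *
            (ENNReal.ofReal B' * (ENNReal.ofReal (y ^ m) * ‖h y‖ₑ)) := by
          refine setLIntegral_mono_ae' measurableSet_Ioi
            (Eventually.of_forall fun y (hy : 0 < y) => ?_)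
          refine setLIntegral_mono_ae' measurableSet_Ioi
            (Eventually.of_forall fun t (ht : 0 < t) => ?_)
          rw [enorm_smul, enorm_mul, Real.enorm_eq_ofReal (Real.exp_pos _).le, mul_assoc,
            ← mul_assoc (ENNReal.ofReal B'), ← ENNReal.ofReal_mul hB'0.le]
          refine mul_le_mul_right (mul_le_mul_left ?_ _) _
          rw [← ofReal_norm]
          exact ENNReal.ofReal_le_ofReal (hB' t y ht.le hy)
      _ = ENNReal.ofReal B' * ∫⁻ y in Ioi (0 : ℝ), ENNReal.ofReal (y ^ m) * ‖h y‖ₑ := by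
          rw [← lintegral_const_mul' _ _ ENNReal.ofReal_ne_top]
          refine lintegral_congr fun y => ?_
          rw [lintegral_mul_const _ (by fun_prop), ← ofReal_integral_eq_lintegral_ofReal
            (integrableOn_exp_neg_Ioi 0) (Eventually.of_forall fun t => (Real.exp_pos _).le),
            integral_exp_neg_Ioi_zero, ENNReal.ofReal_one, one_mul]
      _ < ⊤ := ENNReal.mul_lt_top ENNReal.ofReal_lt_top hh2

theorem exists_norm_transport_le {α m : ℝ} (hm : -1 - α < m) (hm1 : m ≤ 1)
    {f : ℝ → ℂ} (hf : MemLp f 1 (weight m)) {a : ℝ} (ha : 0 < a) :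
    ∃ C : ℝ, ∀ t : ℝ, 0 ≤ t →
      ‖(((1 + 4 * a * t) ^ (-halfDim α) : ℝ) : ℂ) * gaussTransform (a / (1 + 4 * a * t)) f‖ ≤ C := by
  obtain ⟨B, hB0, hB⟩ := exists_abs_transport_gaussWeight_le hm hm1 ha
  obtain ⟨h1, h2⟩ := memLp_weight_iff.1 hf
  refine ⟨(ENNReal.ofReal B * ∫⁻ x in Ioi (0 : ℝ), ENNReal.ofReal (x ^ m) * ‖f x‖ₑ).toReal,
    fun t ht => ?_⟩
  rw [← toReal_enorm]
  refine ENNReal.toReal_mono (ENNReal.mul_lt_top ENNReal.ofReal_lt_top h2).ne ?_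
  have e : (((1 + 4 * a * t) ^ (-halfDim α) : ℝ) : ℂ) * gaussTransform (a / (1 + 4 * a * t)) f =
      pair (fun y => (1 + 4 * a * t) ^ (-halfDim α) * gaussWeight (a / (1 + 4 * a * t)) y) f := by
    rw [gaussTransform, pair, pair, ← integral_const_mul]
    simp_rw [mul_smul, Complex.real_smul]
  rw [e]
  exact (enorm_integral_le_lintegral_enorm _).trans
    (lintegral_pair_le (fun y hy => hB t y ht hy) f)

/-- If U and V are the transported transforms of f and g, then U' = V, so e^{-t}(U - V) is the
derivative of -e^{-t}U. Its integral over (0, ∞) is U(0), the transform of f, and it is also the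
transform of the resolvent applied to f - g. -/
theorem GaussODE.ae_eq_kerFun {α m : ℝ} (hα : 0 < α) (hm : -1 - α < m) (hm1 : m ≤ 1)
    {f g : ℝ → ℂ} (hf : MemLp f 1 (weight m)) (hg : MemLp g 1 (weight m)) (h : GaussODE α f g) :
    f =ᵐ[volume.restrict (Ioi 0)] kerFun (resKernel α) (f - g) := by
  obtain ⟨C, hC⟩ := exists_kernelBound_resKernel_self hα hm hm1
  refine ae_eq_of_gaussTransform_eq hm1 hf (hC.memLp (hf.sub hg)) fun a ha => ?_
  rw [gaussTransform_resKernel hα hm hm1 (hf.sub hg) ha]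
  set U : ℝ → ℂ := fun s => (((1 + 4 * a * s) ^ (-halfDim α) : ℝ) : ℂ) *
        gaussTransform (a / (1 + 4 * a * s)) f with hU
  set V : ℝ → ℂ := fun s => (((1 + 4 * a * s) ^ (-halfDim α) : ℝ) : ℂ) *
        gaussTransform (a / (1 + 4 * a * s)) g with hV
  obtain ⟨CU, hCU⟩ := exists_norm_transport_le hm hm1 hf ha
  obtain ⟨CV, hCV⟩ := exists_norm_transport_le hm hm1 hg ha
  have hUc := continuousOn_transport (α := α) hm1 hf ha
  have hVc := continuousOn_transport (α := α) hm1 hg ha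
  have hUd : ∀ t : ℝ, 0 < t → HasDerivAt U (V t) t := fun t ht =>
    h.hasDerivAt ha (by positivity)
  have e1 : ∀ t ∈ Ioi (0 : ℝ), (Real.exp (-t) : ℂ) * (((1 + 4 * a * t) ^ (-halfDim α) : ℝ) *
      gaussTransform (a / (1 + 4 * a * t)) (f - g)) = (Real.exp (-t) : ℂ) * (U t - V t) := by
    intro t (ht : 0 < t)
    rw [gaussTransform_sub hm1 (by positivity) hf hg, hU, hV]
    ring
  rw [setIntegral_congr_fun measurableSet_Ioi e1]
  have hexp : ∀ t : ℝ, HasDerivAt (fun t : ℝ => (Real.exp (-t) : ℂ)) (-(Real.exp (-t) : ℂ)) t := by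
    intro t
    have := ((hasDerivAt_neg t).exp).ofReal_comp
    refine this.congr_deriv ?_
    push_cast
    ring
  have hec : Continuous fun t : ℝ => (Real.exp (-t) : ℂ) := by fun_prop
  have key := integral_Ioi_of_hasDerivAt_of_tendsto (a := 0) (m := 0)
    (f := fun t => -((Real.exp (-t) : ℂ) * U t))
    (f' := fun t => (Real.exp (-t) : ℂ) * (U t - V t)) ?_ ?_ ?_ ?_
  · rw [key]
    simp [hU]
  · exact ((hec.continuousOn.mul hUc).neg 0 self_mem_Ici)
  · intro t ht
    refine (((hexp t).mul (hUd t ht)).neg).congr_deriv ?_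
    ring
  · have hi : IntegrableOn (fun t : ℝ => (CU + CV) * Real.exp (-t)) (Ioi 0) :=
      (integrableOn_exp_neg_Ioi 0).const_mul _
    refine Integrable.mono' hi ?_ ?_
    · exact ((hec.continuousOn.mul (hUc.sub hVc)).mono Ioi_subset_Ici_self).aestronglyMeasurable
        measurableSet_Ioi
    · filter_upwards [ae_restrict_mem measurableSet_Ioi] with t (ht : 0 < t)
      rw [norm_mul, Complex.norm_real, Real.norm_of_nonneg (Real.exp_pos _).le, mul_comm]
      gcongr
      exact (norm_sub_le _ _).trans (add_le_add (hCU t ht.le) (hCV t ht.le))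
  · have h0 : Tendsto (fun t : ℝ => Real.exp (-t) * CU) atTop (𝓝 0) := by
      simpa using (Real.tendsto_exp_neg_atTop_nhds_zero).mul_const CU
    refine squeeze_zero_norm' ?_ h0
    filter_upwards [eventually_ge_atTop 0] with t ht
    rw [norm_neg, norm_mul, Complex.norm_real, Real.norm_of_nonneg (Real.exp_pos _).le]
    gcongr
    exact hCU t ht

/-! ### The Dirichlet condition for the resolvent -/

theorem norm_resKernel {α : ℝ} (hα : 0 < α) {x y : ℝ} (hx : 0 < x) (hy : 0 < y) :
    ‖resKernel α x y‖ = x ^ α * y * (resAngle α x y).toReal := by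
  rw [resKernel_eq hα x hy, Complex.norm_real, Real.norm_of_nonneg (by positivity)]

/-- The two bounds come from the two forms x^{-α} and y^{-α} of the angular estimate. The first is a
majorant independent of x and integrable against X_1; the second gives decay as x → 0 for fixed y.
-/
theorem exists_norm_resKernel_le {α : ℝ} (hα : 0 < α) :
    ∃ C : ℝ, 0 < C ∧ ∀ x y : ℝ, 0 < x → 0 < y →
      ‖resKernel α x y‖ ≤ C * y ∧ ‖resKernel α x y‖ ≤ x ^ α * (C * y ^ (1 - α)) := by
  obtain ⟨C, hC0, hC⟩ := exists_resAngle_le hα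
  refine ⟨C, hC0, fun x y hx hy => ?_⟩
  have h1 : (resAngle α x y).toReal ≤ C * y ^ (-α) :=
    ENNReal.toReal_le_of_le_ofReal (by positivity) (hC x y hy)
  have h2 : (resAngle α x y).toReal ≤ C * x ^ (-α) := by
    rw [resAngle_comm]
    exact ENNReal.toReal_le_of_le_ofReal (by positivity) (hC y x hx)
  rw [norm_resKernel hα hx hy]
  constructor
  · calc x ^ α * y * (resAngle α x y).toReal ≤ x ^ α * y * (C * x ^ (-α)) := by gcongr
      _ = C * y := by
        rw [Real.rpow_neg hx.le]
        have := (Real.rpow_pos_of_pos hx α).ne'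
        field_simp
  · calc x ^ α * y * (resAngle α x y).toReal ≤ x ^ α * y * (C * y ^ (-α)) := by gcongr
      _ = _ := by
        rw [Real.rpow_neg hy.le, Real.rpow_sub hy, Real.rpow_one]
        ring

theorem continuousAt_resKernel {α : ℝ} (hα : 0 < α) {x y : ℝ} (hx : 0 < x) (hy : 0 < y) :
    ContinuousAt (fun x => resKernel α x y) x := by
  obtain ⟨C, hC0, hC⟩ := exists_resProfile_le hα
  refine ContinuousAt.mul ?_ ?_
  · refine Complex.continuous_ofReal.continuousAt.comp ?_
    exact (Real.continuousAt_rpow_const x α (Or.inl hx.ne')).mul continuousAt_const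
  · refine continuousAt_of_dominated (bound := fun φ => C * y ^ (-α) * |Real.sin φ| ^ (-α))
      ?_ ?_ ?_ ?_
    · refine Eventually.of_forall fun x => Measurable.aestronglyMeasurable ?_
      exact Complex.measurable_ofReal.comp ((measurable_resProfile α).comp
        (by unfold distSq; fun_prop))
    · refine Eventually.of_forall fun x => ?_
      filter_upwards [ae_sin_ne_zero] with φ hφ
      rw [Complex.norm_real, Real.norm_of_nonneg (by exact ENNReal.toReal_nonneg)]
      exact hC x y φ hy hφ
    · refine Integrable.const_mul ⟨Measurable.aestronglyMeasurable (by fun_prop), ?_⟩ _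
      rw [hasFiniteIntegral_iff_ofReal (Eventually.of_forall fun φ => by positivity)]
      exact (lintegral_abs_sin_rpow_neg_le α).trans_lt ENNReal.ofReal_lt_top
    · filter_upwards [ae_sin_ne_zero] with φ hφ
      refine Complex.continuous_ofReal.continuousAt.comp ?_
      have h1 : Continuous fun x => distSq x y φ := by unfold distSq; fun_prop
      exact ContinuousAt.comp (g := resProfile α) (continuousAt_resProfile hα (distSq_pos hy hφ))
        h1.continuousAt

/-- Dominated convergence with the majorant C y |h(y)|, both for continuity in x > 0 and for the
limit at zero. -/
theorem dirichletAtZero_kerFun_resKernel {α : ℝ} (hα : 0 < α) {h : ℝ → ℂ}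
    (hh : MemLp h 1 (weight 1)) : DirichletAtZero (kerFun (resKernel α) h) := by
  obtain ⟨C, hC0, hC⟩ := exists_norm_resKernel_le hα
  have hh1 := (memLp_weight_iff.1 hh).1
  have hbi : Integrable (fun y => ‖(C * y) • h y‖) (volume.restrict (Ioi 0)) :=
    (integrable_pair (m := 1) (C := C) (by fun_prop) (fun y hy => by
      rw [Real.rpow_one, abs_of_pos (by positivity)]) hh).norm
  have hmeas : ∀ x, AEStronglyMeasurable (fun y => resKernel α x y * h y)
      (volume.restrict (Ioi 0)) := fun x => by
    have : Measurable fun y => resKernel α x y :=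
      (measurable_resKernel α).comp (measurable_const.prodMk measurable_id)
    exact this.aestronglyMeasurable.mul hh1
  have hb : ∀ x, 0 < x → ∀ᵐ y ∂volume.restrict (Ioi (0 : ℝ)),
      ‖resKernel α x y * h y‖ ≤ ‖(C * y) • h y‖ := fun x hx => by
    filter_upwards [ae_restrict_mem measurableSet_Ioi] with y (hy : 0 < y)
    rw [norm_mul, norm_smul, Real.norm_of_nonneg (by positivity)]
    gcongr
    exact (hC x y hx hy).1
  refine ⟨_, fun x (hx : 0 < x) => ContinuousAt.continuousWithinAt ?_, ae_eq_rfl, ?_⟩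
  · refine continuousAt_of_dominated (bound := fun y => ‖(C * y) • h y‖)
      (Eventually.of_forall hmeas) ?_ hbi ?_
    · filter_upwards [Ioi_mem_nhds hx] with x' hx' using hb x' hx'
    · filter_upwards [ae_restrict_mem measurableSet_Ioi] with y (hy : 0 < y)
      exact (continuousAt_resKernel hα hx hy).mul continuousAt_const
  · have h0 : Tendsto (kerFun (resKernel α) h) (𝓝[>] 0) (𝓝 (∫ _ in Ioi (0 : ℝ), (0 : ℂ))) := by
      refine tendsto_integral_filter_of_dominated_convergence (fun y => ‖(C * y) • h y‖)
        (Eventually.of_forall hmeas) ?_ hbi ?_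
      · filter_upwards [self_mem_nhdsWithin] with x hx using hb x hx
      · filter_upwards [ae_restrict_mem measurableSet_Ioi] with y (hy : 0 < y)
        have h1 : Tendsto (fun x : ℝ => x ^ α * (C * y ^ (1 - α)) * ‖h y‖) (𝓝[>] 0) (𝓝 0) := by
          have h2 : Tendsto (fun x : ℝ => x ^ α) (𝓝[>] 0) (𝓝 0) := by
            have := (Real.continuousAt_rpow_const 0 α (Or.inr hα.le)).tendsto
            rw [Real.zero_rpow hα.ne'] at this
            exact this.mono_left nhdsWithin_le_nhds
          simpa using (h2.mul_const (C * y ^ (1 - α))).mul_const ‖h y‖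
        refine squeeze_zero_norm' ?_ h1
        filter_upwards [self_mem_nhdsWithin] with x hx
        rw [norm_mul]
        gcongr
        exact (hC x y hx hy).2
    simpa using h0

theorem DirichletAtZero.congr {f g : ℝ → ℂ} (hf : DirichletAtZero f)
    (h : g =ᵐ[volume.restrict (Ioi 0)] f) : DirichletAtZero g := by
  obtain ⟨u, hu, hfu, hu0⟩ := hf
  exact ⟨u, hu, h.trans hfu, hu0⟩

/-! ### From the transformed equation to the distributional one -/

theorem exists_abs_le_rpow (m : ℝ) {φ w : ℝ → ℝ} (hφc : HasCompactSupport φ)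
    (hφs : tsupport φ ⊆ Ioi 0) (hw : ContinuousOn w (Ioi 0)) (h0 : ∀ x, x ∉ tsupport φ → w x = 0) :
    ∃ C : ℝ, ∀ x, 0 < x → |w x| ≤ C * x ^ m := by
  obtain ⟨C, hC⟩ := hφc.isCompact.exists_bound_of_continuousOn (f := fun x => w x * x ^ (-m))
    ((hw.mono hφs).mul fun x hx =>
      (Real.continuousAt_rpow_const x _ (Or.inl (ne_of_gt (hφs hx)))).continuousWithinAt)
  refine ⟨|C|, fun x hx => ?_⟩
  by_cases hx1 : x ∈ tsupport φ
  · have h1 := (hC x hx1).trans (le_abs_self C)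
    rw [Real.norm_eq_abs, abs_mul, abs_of_pos (Real.rpow_pos_of_pos hx _), Real.rpow_neg hx.le,
      ← div_eq_mul_inv, div_le_iff₀ (by positivity)] at h1
    exact h1
  · rw [h0 x hx1, abs_zero]
    positivity

theorem measurable_besselAdjoint (κ : ℝ) {φ : ℝ → ℝ} (hφ : ContDiff ℝ ∞ φ) :
    Measurable (besselAdjoint κ φ) := by
  have h1 := measurable_deriv φ
  have h2 := measurable_deriv (deriv φ)
  have h3 := hφ.continuous.measurable
  unfold besselAdjoint
  fun_prop

/-- The resolvent kernel inverts the adjoint operator on test functions. -/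
theorem integral_test_resKernel {α : ℝ} (hα : 0 < α) {φ : ℝ → ℝ} (h1 : ContDiff ℝ ∞ φ)
    (h2 : HasCompactSupport φ) (h3 : tsupport φ ⊆ Ioi 0) :
    ∀ᵐ y ∂volume.restrict (Ioi (0 : ℝ)), ∫ x in Ioi (0 : ℝ),
      (φ x - besselAdjoint (1 - α) φ x) • resKernel α x y = φ y := by
  have hm1 := memLp_testLift α 0 h2 h3 h1.continuous.continuousOn
    (fun x hx => image_eq_zero_of_notMem_tsupport hx)
  have hm2 := memLp_testLift α 0 h2 h3 (continuousOn_besselAdjoint (1 - α) h1)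
      (fun x hx => besselAdjoint_eq_zero (1 - α) hx)
  filter_upwards [(gaussODE_testLift h1 h2 h3).ae_eq_kerFun hα (by linarith) zero_le_one hm1 hm2,
    ae_restrict_mem measurableSet_Ioi] with y hy (hy0 : 0 < y)
  rw [testLift, kerFun] at hy
  -- The kernel is x^α y times a symmetric function, so exchanging its arguments turns the factor
  -- x^{α-1} into y^{α-1}.
  have e : ∀ x ∈ Ioi (0 : ℝ), resKernel α y x *
      (testLift α φ - testLift α (besselAdjoint (1 - α) φ)) x =
      ((y ^ (α - 1) : ℝ) : ℂ) * ((φ x - besselAdjoint (1 - α) φ x) • resKernel α x y) := by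
    intro x (hx : 0 < x)
    rw [resKernel_eq hα y hx, resKernel_eq hα x hy0, resAngle_comm, Pi.sub_apply, testLift,
      testLift, Complex.real_smul, ← Complex.ofReal_sub, ← Complex.ofReal_mul,
      ← Complex.ofReal_mul, ← Complex.ofReal_mul]
    congr 1
    rw [Real.rpow_sub_one hx.ne', Real.rpow_sub_one hy0.ne']
    field_simp
  rw [setIntegral_congr_fun measurableSet_Ioi e, integral_const_mul, Complex.ofReal_mul] at hy
  refine (mul_left_cancel₀ ?_ hy).symm
  exact_mod_cast (Real.rpow_pos_of_pos hy0 _).ne'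

/-- Duality: insert f = R(f - g) and move R onto φ minus its adjoint image, which gives back φ. The
pairing of w with f then equals that of φ with f - g, and the terms φ f cancel. -/
theorem GaussODE.isBessel {α m : ℝ} (hα : 0 < α) (hm : -1 - α < m) (hm1 : m ≤ 1)
    {f g : ℝ → ℂ} (hf : MemLp f 1 (weight m)) (hg : MemLp g 1 (weight m)) (h : GaussODE α f g) :
    IsBessel (1 - α) f g := by
  intro φ h1 h2 h3
  obtain ⟨C, hC⟩ := exists_kernelBound_resKernel_self hα hm hm1
  set w : ℝ → ℝ := fun x => φ x - besselAdjoint (1 - α) φ x with hw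
  obtain ⟨B, hB⟩ := exists_abs_le_rpow m h2 h3 (w := w)
    (h1.continuous.continuousOn.sub (continuousOn_besselAdjoint (1 - α) h1))
    (fun x hx => by simp only [hw]; rw [image_eq_zero_of_notMem_tsupport hx,
      besselAdjoint_eq_zero (1 - α) hx, sub_zero])
  have key : pair w f = pair φ (f - g) := by
    rw [pair_congr (h.ae_eq_kerFun hα hm hm1 hf hg), hC.pair_kerFun (hf.sub hg)
      (w := w) (h1.continuous.measurable.sub (measurable_besselAdjoint (1 - α) h1)) hB]
    refine integral_congr_ae ?_
    filter_upwards [integral_test_resKernel hα h1 h2 h3] with y hy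
    rw [hy, Complex.real_smul]
  have lf := locallyIntegrableOn_of_memLp_weight hf
  have lg := locallyIntegrableOn_of_memLp_weight hg
  have i1 := integrable_test_right lf h1 h2 h3
  have i2 := integrable_test_left lf (1 - α) h1 h2 h3
  have i3 := integrable_test_right lg h1 h2 h3
  simp only [pair, hw, sub_smul, Pi.sub_apply, smul_sub] at key
  rw [integral_sub i1 i2, integral_sub i1 i3] at key
  exact sub_right_injective key

/-! ### The domain of the operator -/

theorem SideCondition.tendsto_average {κ m : ℝ} (hκ : κ < 1) (hm : κ - 2 < m) {f : ℝ → ℂ}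
    (hf : SideCondition κ m f) :
    Tendsto (fun n : ℕ => (n : ℝ≥0∞) * ∫⁻ x in Icc (1 / (n : ℝ)) (2 / n), ‖f x‖ₑ) atTop
      (𝓝 0) := by
  unfold SideCondition at hf
  split_ifs at hf with h1 h2
  -- The exponent min(m, -1) is admissible, since κ < 1 gives κ - 2 < -1.
  · exact tendsto_average_of_memLp (min_le_right m (-1))
      (hf _ ⟨lt_min hm (by linarith), min_le_left _ _⟩)
  · exact tendsto_average_of_memLp (by linarith : m - 2 ≤ -1)
      (hf _ ⟨le_rfl, by linarith⟩)
  · exact hf.2.tendsto_average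

/-- As f = R(f - g) with f - g in X_m, the integrability at other exponents and the Dirichlet
condition are mapping properties of R. -/
theorem GaussODE.sideCondition {κ m : ℝ} (hκ : κ < 1) (hm : κ - 2 < m) (hm1 : m ≤ 1)
    {f g : ℝ → ℂ} (hf : MemLp f 1 (weight m)) (hg : MemLp g 1 (weight m))
    (h : GaussODE (1 - κ) f g) : SideCondition κ m f := by
  have hα : 0 < 1 - κ := by linarith
  have he := h.ae_eq_kerFun hα (by linarith) hm1 hf hg
  have hmem : ∀ r, r < 1 → κ - 2 < r → r ≤ m → m ≤ r + 2 → (m < 1 ∨ m = 1 ∧ -1 < r) →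
      MemLp f 1 (weight r) := fun r h1 h2 h3 h4 h5 => by
    obtain ⟨C, hC⟩ := exists_kernelBound_resKernel hα h1 (by linarith) h3 h4 h5
    exact memLp_weight_congr he.symm (hC.memLp (hf.sub hg))
  unfold SideCondition
  split_ifs with h1 h2
  · exact fun r hr => hmem r (by linarith [hr.2]) hr.1 hr.2 (by linarith [hr.1])
      (Or.inl (by linarith))
  · exact fun r hr => hmem r (by linarith [hr.2]) (by linarith [hr.1]) hr.2 (by linarith [hr.1])
      (Or.inl h2)
  · have hm' : m = 1 := le_antisymm hm1 (not_lt.1 h2)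
    subst hm'
    refine ⟨fun r hr => ?_, (dirichletAtZero_kerFun_resKernel hα (hf.sub hg)).congr he⟩
    rcases hr.2.eq_or_lt with rfl | hr1
    · exact hf
    · exact hmem r hr1 (by linarith [hr.1]) hr.2 (by linarith [hr.1]) (Or.inr ⟨rfl, hr.1⟩)

theorem mem_graph_besselOp_iff {κ m : ℝ} {f g : X m} :
    (f, g) ∈ (besselOp κ m).graph ↔ SideCondition κ m f ∧ IsBessel κ f g := by
  rw [LinearPMap.mem_graph_iff]
  constructor
  · rintro ⟨u, hu, hg⟩
    simp only at hu hg
    subst hu hg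
    exact ⟨u.2.1, besselOp_spec u⟩
  · rintro ⟨h1, h2⟩
    refine ⟨⟨f, h1, g, h2⟩, rfl, ?_⟩
    exact IsBessel.unique (besselOp_spec (κ := κ) (m := m) ⟨f, h1, g, h2⟩) h2

/-- The bridge to the generator: the cutoff argument gives one direction, the resolvent
representation the other. -/
theorem mem_graph_besselOp_iff_gaussODE {κ m : ℝ} (hκ : κ < 1) (hm : κ - 2 < m) (hm1 : m ≤ 1)
    {f g : X m} : (f, g) ∈ (besselOp κ m).graph ↔ GaussODE (1 - κ) f g := by
  rw [mem_graph_besselOp_iff]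
  constructor
  · rintro ⟨h1, h2⟩
    exact gaussODE_of_isBessel hm1 (Lp.memLp f) (Lp.memLp g) (by rwa [sub_sub_cancel])
      (h1.tendsto_average hκ hm)
  · intro h
    have hb := h.isBessel (by linarith) (by linarith) hm1 (Lp.memLp f) (Lp.memLp g)
    rw [sub_sub_cancel] at hb
    exact ⟨h.sideCondition hκ hm hm1 (Lp.memLp f) (Lp.memLp g), hb⟩

/-! ### Assembly of the theorem -/

theorem isBoundedAnalyticSemigroup_heatOp {α m : ℝ} (hα : 0 < α) (hm : -1 - α < m) (hm1 : m ≤ 1) :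
    IsBoundedAnalyticSemigroup (Real.pi / 2) (heatOp α m) where
  angle_pos := by positivity
  angle_le := le_rfl
  map_zero := heatOp_zero α m
  map_add z hz w hw := heatOp_add hα hm hm1 (mem_openSector_pi_div_two.1 hz)
    (mem_openSector_pi_div_two.1 hw)
  analytic z hz := (differentiableAt_heatOp hα hm hm1
    (mem_openSector_pi_div_two.1 hz)).differentiableWithinAt
  tendsto_zero θ hθ f := tendsto_heatOp_sector hα hm hm1 (tendsto_heatOp hα hm hm1) hθ f
  bounded θ hθ := exists_norm_heatOp_sector_le hα hm hm1 hθ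

theorem isGenerator_heatOp {κ m : ℝ} (hκ : κ < 1) (hm : κ - 2 < m) (hm1 : m ≤ 1) :
    IsGenerator (besselOp κ m) (heatOp (1 - κ) m) := by
  have hα : 0 < 1 - κ := by linarith
  have hm' : -1 - (1 - κ) < m := by linarith
  intro f g
  rw [mem_graph_besselOp_iff_gaussODE hκ hm hm1]
  exact ⟨tendsto_quotient_of_gaussODE hα hm' hm1 (tendsto_heatOp hα hm' hm1),
    gaussODE_of_tendsto_quotient hα hm' hm1⟩

theorem isContractionSemigroup_heatOp {κ m : ℝ} (hκ : κ < 1) (hm : κ < m) (hm1 : m ≤ 1) :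
    IsContractionSemigroup (heatOp (1 - κ) m) := by
  intro t ht
  rcases ht.eq_or_lt with rfl | ht
  · rw [Complex.ofReal_zero, heatOp_zero]
    exact ContinuousLinearMap.norm_id_le
  · obtain ⟨M, -, hM1, hM⟩ := exists_norm_heatOp_ofReal_le (α := 1 - κ) (by linarith)
      (by linarith) hm1
    exact (hM t ht).trans (hM1 (by linarith)).le

end BesselHalfLine

end

theorem theorem1p1 (κ m : ℝ) (hκ : κ < 1) (hm : κ - 2 < m) (hm1 : m ≤ 1) :
    ∃ S : ℂ → BesselHalfLine.X m →L[ℂ] BesselHalfLine.X m,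
      IsBoundedAnalyticSemigroup (Real.pi / 2) S ∧
      IsPositiveSemigroup S ∧
      IsGenerator (BesselHalfLine.besselOp κ m) S ∧
      (κ < m → IsContractionSemigroup S) := by
  have hα : 0 < 1 - κ := by linarith
  have hm' : -1 - (1 - κ) < m := by linarith
  exact ⟨BesselHalfLine.heatOp (1 - κ) m,
    BesselHalfLine.isBoundedAnalyticSemigroup_heatOp hα hm' hm1,
    BesselHalfLine.isPositiveSemigroup_heatOp hα hm' hm1,
    BesselHalfLine.isGenerator_heatOp hκ hm hm1,
    fun h => BesselHalfLine.isContractionSemigroup_heatOp hκ h hm1⟩
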